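/- Let $\Lambda=2\omega_1\mathbb Z\oplus 2\omega_3\mathbb Z$ be a lattice in $\mathbb C$, with its Weierstrass functions $\sigma,\zeta,\wp$, half-periods $\omega_0=0$, $\omega_1$, $\omega_2=-\omega_1-\omega_3$, $\omega_3$, and $e_j=\wp(\omega_j)$ $(j=1,2,3)$. Let $\alpha,\kappa,k\in\mathbb C$ with $\alpha\notin\frac12\Lambda$ and $k\ne0$, and set $$t=\frac{e_3-e_1}{e_2-e_1},\qquad \lambda=\frac{\wp(\alpha)-e_1}{e_2-e_1},\qquad \mu=-\frac{(e_2-e_1)\kappa}{\wp'(\alpha)},\qquad z=\frac{\wp(x)-e_1}{e_2-e_1}.$$ **The equations.** For parameters $\theta_0,\theta_1,\theta_t,\theta_\infty$ put $\kappa_1=\frac{\theta_\infty-\theta_0-\theta_1-\theta_t}{2}$, $\kappa_2=-\frac{\theta_\infty+\theta_0+\theta_1+\theta_t}{2}$, $w_0=\frac{k\lambda}{t}$, $w_1=-\frac{k(\lambda-1)}{t-1}$, $w_t=\frac{k(\lambda-t)}{t(t-1)}$, $p=\lambda(\lambda-1)(\lambda-t)\mu^2$, and $$u_0=-\theta_0+\tfrac{\lambda}{t\theta_\infty}\bigl[p+\{2\kappa_1(\lambda-1)(\lambda-t)-\theta_1(\lambda-t)-t\theta_t(\lambda-1)\}\mu+\kappa_1\{\kappa_1(\lambda-t-1)-\theta_1-t\theta_t\}\bigr],$$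 $$u_1=-\theta_1-\tfrac{\lambda-1}{(t-1)\theta_\infty}\bigl[p+\{2\kappa_1(\lambda-1)(\lambda-t)+(\theta_\infty-\theta_1)(\lambda-t)-t\theta_t(\lambda-1)\}\mu+\kappa_1\{\kappa_1(\lambda-t+1)+\theta_0-(t-1)\theta_t\}\bigr],$$ $$u_t=-\theta_t+\tfrac{\lambda-t}{t(t-1)\theta_\infty}\bigl[p+\{2\kappa_1(\lambda-1)(\lambda-t)-\theta_1(\lambda-t)+t(\theta_\infty-\theta_t)(\lambda-1)\}\mu+\kappa_1\{\kappa_1(\lambda-t+1)+\theta_0+(t-1)(\theta_\infty-\theta_t)\}\bigr].$$ $D_Y(\theta_0,\theta_1,\theta_t,\theta_\infty;\lambda,\mu;k)$ is the system $$\frac{dY}{dz}=\Bigl(\frac{A_0}{z}+\frac{A_1}{z-1}+\frac{A_t}{z-t}\Bigr)Y,\qquad A_j=\begin{pmatrix}u_j+\theta_j&-w_j\\ u_j(u_j+\theta_j)/w_j&-u_j\end{pmatrix}\quad(j=0,1,t),$$ and $D_{y_1}(\theta_0,\theta_1,\theta_t,\theta_\infty;\lambda,\mu)$ is the equation $$y''+\Bigl(\frac{1-\theta_0}{z}+\frac{1-\theta_1}{z-1}+\frac{1-\theta_t}{z-t}-\frac1{z-\lambda}\Bigr)y'+\Bigl(\frac{\kappa_1(\kappa_2+1)}{z(z-1)}+\frac{\lambda(\lambda-1)\mu}{z(z-1)(z-\lambda)}-\frac{t(t-1)H}{z(z-1)(z-t)}\Bigr)y=0,$$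 $$H=\frac{1}{t(t-1)}\bigl[p-\{\theta_0(\lambda-1)(\lambda-t)+\theta_1\lambda(\lambda-t)+(\theta_t-1)\lambda(\lambda-1)\}\mu+\kappa_1(\kappa_2+1)(\lambda-t)\bigr].$$ **The integrals.** Let $i\in\{0,1,2,3\}$ and let $U\subset\mathbb C\setminus\frac12\Lambda$ be open. For $x\in U$ consider a contour $\xi(s)=\omega_i+(x-\omega_i)c(s)$, $0\le s\le 1$, from $-x+2\omega_i$ to $x$, where $c$ is of class $C^1$, does not depend on $x$, $c(0)=-1$, $c(1)=1$, $c'(0)\ne0\ne c'(1)$, and $\xi(s)\notin\pm x+\Lambda$ for all $0<s<1$ and $x\in U$. (For a single $x$, every contour that is $C^1$ with nonzero velocity at its ends and avoids $\pm x+\Lambda$ in between is of this form.) Fix a branch of $\sqrt{\sigma(x-\xi(s))\sigma(x+\xi(s))}$ that is continuous in $(x,s)\in U\times(0,1)$, and set, with integration along the contour, $$f_i(x)=\int_{-x+2\omega_i}^x\frac{e^{(\kappa+\zeta(\alpha))\xi}\sigma(x)\sigma(\xi-\alpha)}{\sqrt{\sigma(x-\xi)\sigma(x+\xi)}}\,d\xi,$$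 $$g_i(x)=\frac1{4k(e_2-e_1)}\int_{-x+2\omega_i}^x\Bigl(\kappa^2+\frac{\wp'(\xi)+\wp'(\alpha)}{\wp(\xi)-\wp(\alpha)}\kappa+2\wp(\xi)+\wp(\alpha)\Bigr)\frac{e^{(\kappa+\zeta(\alpha))\xi}\sigma(x)\sigma(\xi-\alpha)}{\sqrt{\sigma(x-\xi)\sigma(x+\xi)}}\,d\xi.$$ **Proposition.** (1) If the contours also avoid $\Lambda$ (for all $x\in U$), then the integral $g_i$ converges, and ${}^t(f_i(x),g_i(x))$, as a function of $z$ through any continuous local inverse $x=x(z)\in U$ on an open set of $z$, is a solution of $D_Y(0,0,0,1;\lambda,\mu;k)$. (2) In any case the integral $f_i$ converges and is holomorphic on $U$, and $f_i(x)$, as a function of $z$ in the same sense, is a solution of $D_{y_1}(0,0,0,1;\lambda,\mu)$ (where $z\ne\lambda$). In the variable $x$: for all $x\in U$ with $\wp(x)\ne\wp(\alpha)$, the function $y=f_i$ satisfies $$\frac{d^2y}{dx^2}+\Bigl\{\Bigl(\sum_{j=1}^3\frac1{2(\wp(x)-e_j)}\Bigr)-\frac1{\wp(x)-\wp(\alpha)}\Bigr\}\wp'(x)\frac{dy}{dx}+\Bigl\{-\kappa^2-\frac{\wp'(\alpha)}{\wp(x)-\wp(\alpha)}\kappa+\wp(x)-\wp(\alpha)\Bigr\}y=0.$$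 -/

import Mathlib

open Set

noncomputable section

namespace EllipticFuchs

/-! Weierstrass functions. The structure `PeriodPair` stores the full periods, so that
`L.ω₁ = 2 ω₁` and `L.ω₂ = 2 ω₃` in terms of the half-periods `ω₁, ω₃`. -/

/-- The half-periods `ω₀ = 0`, `ω₁`, `ω₂ = -ω₁ - ω₃`, `ω₃`. -/
def halfPeriod (L : PeriodPair) : Fin 4 → ℂ :=
  ![0, L.ω₁ / 2, -(L.ω₁ / 2) - L.ω₂ / 2, L.ω₂ / 2]

/-- `e_i = ℘(ω_i)`, used for `i = 1, 2, 3`. -/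
def eVal (L : PeriodPair) (i : Fin 4) : ℂ := L.weierstrassP (halfPeriod L i)

/-- The Weierstrass zeta function. The term of the sum at `l = 0` is `1 / x`, because of
the convention `a / 0 = 0`. -/
def wZeta (L : PeriodPair) (x : ℂ) : ℂ :=
  ∑' l : L.lattice, (1 / (x - l) + 1 / (l : ℂ) + x / (l : ℂ) ^ 2)

/-- The Weierstrass sigma function. -/
def wSigma (L : PeriodPair) (x : ℂ) : ℂ :=
  x * ∏' l : {l : L.lattice // l ≠ 0},
    ((1 - x / (l.1 : ℂ)) * Complex.exp (x / (l.1 : ℂ) + (x / (l.1 : ℂ)) ^ 2 / 2))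

/-! The Fuchsian system `D_Y(θ₀, θ₁, θ_t, θ_∞; λ, μ; k)` with singularities `0, 1, t, ∞`. -/

/-- `κ₁ = (θ_∞ - θ₀ - θ₁ - θ_t) / 2` -/
def kap1 (th0 th1 tht thi : ℂ) : ℂ := (thi - th0 - th1 - tht) / 2

/-- `κ₂ = -(θ_∞ + θ₀ + θ₁ + θ_t) / 2` -/
def kap2 (th0 th1 tht thi : ℂ) : ℂ := -(thi + th0 + th1 + tht) / 2

/-- `u₀` -/
def u0 (th0 th1 tht thi t lam mu : ℂ) : ℂ :=
  -th0 + lam / (t * thi) *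
    (lam * (lam - 1) * (lam - t) * mu ^ 2
      + (2 * kap1 th0 th1 tht thi * (lam - 1) * (lam - t) - th1 * (lam - t) - t * tht * (lam - 1)) * mu
      + kap1 th0 th1 tht thi * (kap1 th0 th1 tht thi * (lam - t - 1) - th1 - t * tht))

/-- `u₁` -/
def u1 (th0 th1 tht thi t lam mu : ℂ) : ℂ :=
  -th1 - (lam - 1) / ((t - 1) * thi) *
    (lam * (lam - 1) * (lam - t) * mu ^ 2
      + (2 * kap1 th0 th1 tht thi * (lam - 1) * (lam - t) + (thi - th1) * (lam - t) - t * tht * (lam - 1)) * mu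
      + kap1 th0 th1 tht thi * (kap1 th0 th1 tht thi * (lam - t + 1) + th0 - (t - 1) * tht))

/-- `u_t` -/
def ut (th0 th1 tht thi t lam mu : ℂ) : ℂ :=
  -tht + (lam - t) / (t * (t - 1) * thi) *
    (lam * (lam - 1) * (lam - t) * mu ^ 2
      + (2 * kap1 th0 th1 tht thi * (lam - 1) * (lam - t) - th1 * (lam - t) + t * (thi - tht) * (lam - 1)) * mu
      + kap1 th0 th1 tht thi * (kap1 th0 th1 tht thi * (lam - t + 1) + th0 + (t - 1) * (thi - tht)))

/-- A residue matrix with eigenvalues `0` and `th`. -/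
def resMatrix (u w th : ℂ) : Matrix (Fin 2) (Fin 2) ℂ :=
  !![u + th, -w; u * (u + th) / w, -u]

/-- `A(z) = A₀ / z + A₁ / (z - 1) + A_t / (z - t)` -/
def dyMatrix (th0 th1 tht thi t lam mu k z : ℂ) : Matrix (Fin 2) (Fin 2) ℂ :=
  (1 / z) • resMatrix (u0 th0 th1 tht thi t lam mu) (k * lam / t) th0
    + (1 / (z - 1)) •
        resMatrix (u1 th0 th1 tht thi t lam mu) (-(k * (lam - 1) / (t - 1))) th1
    + (1 / (z - t)) •
        resMatrix (ut th0 th1 tht thi t lam mu) (k * (lam - t) / (t * (t - 1))) tht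

/-- `Y` is a solution of the system `D_Y`, `dY/dz = A(z) Y`, on `V`
(meant for an open set `V` that omits `0, 1, t`). -/
def IsSolutionDY (th0 th1 tht thi t lam mu k : ℂ) (V : Set ℂ) (Y : ℂ → Fin 2 → ℂ) : Prop :=
  ∀ z ∈ V, HasDerivAt Y ((dyMatrix th0 th1 tht thi t lam mu k z).mulVec (Y z)) z

/-- The Hamiltonian `H`. -/
def hamH (th0 th1 tht thi t lam mu : ℂ) : ℂ :=
  1 / (t * (t - 1)) *
    (lam * (lam - 1) * (lam - t) * mu ^ 2
      - (th0 * (lam - 1) * (lam - t) + th1 * lam * (lam - t)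
          + (tht - 1) * lam * (lam - 1)) * mu
      + kap1 th0 th1 tht thi * (kap2 th0 th1 tht thi + 1) * (lam - t))

/-- `y` is a solution of the scalar equation `D_{y₁}(θ₀, θ₁, θ_t, θ_∞; λ, μ)` on `V`
(meant for an open set `V` that omits `0, 1, t, λ`). -/
def IsSolutionDy1 (th0 th1 tht thi t lam mu : ℂ) (V : Set ℂ) (y : ℂ → ℂ) : Prop :=
  DifferentiableOn ℂ y V ∧ ∀ z ∈ V,
    deriv (deriv y) z
      + ((1 - th0) / z + (1 - th1) / (z - 1) + (1 - tht) / (z - t) - 1 / (z - lam))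
          * deriv y z
      + (kap1 th0 th1 tht thi * (kap2 th0 th1 tht thi + 1) / (z * (z - 1))
          + lam * (lam - 1) * mu / (z * (z - 1) * (z - lam))
          - t * (t - 1) * hamH th0 th1 tht thi t lam mu / (z * (z - 1) * (z - t))) * y z = 0

/-! Contours from `-x + 2 ω_i` to `x`, and the integrals `f_i`, `g_i`. -/

/-- The contour `ξ = ω_i + (x - ω_i) c(s)`, `0 ≤ s ≤ 1`. It runs from `-x + 2 ω_i` to `x` when
`c` runs from `-1` to `1`. For one fixed `x ≠ ω_i` every contour with these end points has this
form; for varying `x` the formula is the deformation of the contour with its end points. -/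
def contour (L : PeriodPair) (i : Fin 4) (c : ℝ → ℂ) (x : ℂ) (s : ℝ) : ℂ :=
  halfPeriod L i + (x - halfPeriod L i) * c s

/-- The data that give a meaning to `∫_{-x+2ω_i}^{x} … / √(σ(x-ξ)σ(x+ξ)) dξ` for `x` in an open
set `U`: a shape `c` of the contour, and a continuous branch `S x s` of the square root of
`σ(x-ξ)σ(x+ξ)` at the point `ξ = contour L i c x s`. -/
structure IsContourData (L : PeriodPair) (i : Fin 4) (U : Set ℂ) (c : ℝ → ℂ)
    (S : ℂ → ℝ → ℂ) : Prop where
  isOpen : IsOpen U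
  /-- `U` avoids the half-periods, i.e. the singularities `z = 0, 1, t, ∞`. -/
  notHalf : ∀ x ∈ U, 2 * x ∉ L.lattice
  smooth : ContDiff ℝ 1 c
  left : c 0 = -1
  right : c 1 = 1
  /-- the contour leaves and reaches its end points with nonzero velocity -/
  left_regular : deriv c 0 ≠ 0
  right_regular : deriv c 1 ≠ 0
  /-- between its end points the contour avoids the branch points `ξ ∈ ±x + Λ` -/
  avoid : ∀ x ∈ U, ∀ s ∈ Ioo (0 : ℝ) 1,
    x - contour L i c x s ∉ L.lattice ∧ x + contour L i c x s ∉ L.lattice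
  branch_continuous : ContinuousOn (fun p : ℂ × ℝ => S p.1 p.2) (U ×ˢ Ioo (0 : ℝ) 1)
  branch_sq : ∀ x ∈ U, ∀ s ∈ Ioo (0 : ℝ) 1,
    S x s ^ 2 = wSigma L (x - contour L i c x s) * wSigma L (x + contour L i c x s)

/-- The integrand of `f_i`, where `r` is the value of `√(σ(x-ξ)σ(x+ξ))`. -/
def fKernel (L : PeriodPair) (al ka x xi r : ℂ) : ℂ :=
  Complex.exp ((ka + wZeta L al) * xi) * wSigma L x * wSigma L (xi - al) / r

/-- The weight that distinguishes the integrand of `g_i` from that of `f_i`. -/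
def gWeight (L : PeriodPair) (al ka xi : ℂ) : ℂ :=
  ka ^ 2
    + (L.derivWeierstrassP xi + L.derivWeierstrassP al)
        / (L.weierstrassP xi - L.weierstrassP al) * ka
    + 2 * L.weierstrassP xi + L.weierstrassP al

/-- The integrand of `f_i`, pulled back to the parameter `s` of the contour. -/
def fPull (L : PeriodPair) (al ka : ℂ) (i : Fin 4) (c : ℝ → ℂ) (S : ℂ → ℝ → ℂ) (x : ℂ)
    (s : ℝ) : ℂ :=
  fKernel L al ka x (contour L i c x s) (S x s) * deriv (contour L i c x) s

/-- The integrand of `g_i` without its constant factor, pulled back to the parameter `s`. -/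
def gPull (L : PeriodPair) (al ka : ℂ) (i : Fin 4) (c : ℝ → ℂ) (S : ℂ → ℝ → ℂ) (x : ℂ)
    (s : ℝ) : ℂ :=
  gWeight L al ka (contour L i c x s) * fKernel L al ka x (contour L i c x s) (S x s)
    * deriv (contour L i c x) s

/-- `f_i(x)` -/
def fInt (L : PeriodPair) (al ka : ℂ) (i : Fin 4) (c : ℝ → ℂ) (S : ℂ → ℝ → ℂ) (x : ℂ) : ℂ :=
  ∫ s in (0 : ℝ)..1, fPull L al ka i c S x s

/-- `g_i(x)` -/
def gInt (L : PeriodPair) (al ka k : ℂ) (i : Fin 4) (c : ℝ → ℂ) (S : ℂ → ℝ → ℂ) (x : ℂ) : ℂ :=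
  1 / (4 * k * (eVal L 2 - eVal L 1)) * ∫ s in (0 : ℝ)..1, gPull L al ka i c S x s

/-- `z = (℘(x) - e₁) / (e₂ - e₁)` -/
def zOf (L : PeriodPair) (x : ℂ) : ℂ :=
  (L.weierstrassP x - eVal L 1) / (eVal L 2 - eVal L 1)

/-- `t = (e₃ - e₁) / (e₂ - e₁)` -/
def tOf (L : PeriodPair) : ℂ := (eVal L 3 - eVal L 1) / (eVal L 2 - eVal L 1)

/-- `μ = -(e₂ - e₁) κ / ℘'(α)` -/
def muOf (L : PeriodPair) (al ka : ℂ) : ℂ :=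
  -((eVal L 2 - eVal L 1) * ka / L.derivWeierstrassP al)

/-- `φ` is a branch on `V`, with values in `U`, of the inverse of `x ↦ z`. -/
structure IsInverseBranch (L : PeriodPair) (U V : Set ℂ) (φ : ℂ → ℂ) : Prop where
  isOpen : IsOpen V
  continuousOn : ContinuousOn φ V
  mapsTo : MapsTo φ V U
  right_inv : ∀ z ∈ V, zOf L (φ z) = z

end EllipticFuchs

end

/-! Write the integrand of `f_i` as Φ(x, ξ) = θ(x, ξ) φ(ξ), where θ = σ(x) / √(σ(x-ξ)σ(x+ξ)) and
φ(ξ) = exp((κ+ζ(α))ξ) σ(ξ-α), and the equation in the variable x as y'' + p y' + q y = 0 with p, q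
given by `coeffP`, `coeffQ`. The core is the partial differential equation Φ_xx + p Φ_x + q Φ = Φ_ξξ
+ T Φ_ξ with T = `coeffT` independent of ξ (`kernel_pde`). Divided by θ it becomes, by the addition
formulas for ζ and ℘, a rational identity between the values of ℘ and ℘' at x, ξ, α
(`elliptic_identity`). The addition formulas are successive derivatives of the formula for
σ(x+y)σ(x-y) in `wSigma_mul`, which follows from Liouville's theorem.

The end points of the contour move with x, so everything is pulled back to the fixed interval by ξ =
ω_i + (x-ω_i) c(s), for which ξ_x = c. Then d/dx (Φ ξ_s) = Φ_x ξ_s + d/ds (cΦ) and d²/dx² (Φ ξ_s) =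
Φ_xx ξ_s + d/ds (2cΦ_x + c²Φ_ξ). With the partial differential equation, the operator of the
ordinary equation sends the pulled back integrand to the s-derivative of `psi` = 2cΦ_x + (1+c²)Φ_ξ +
(pc+T)Φ. At an end point the singularities of order -3/2 in Φ_x and Φ_ξ cancel, and the values of p
and T cancel what is left at order -1/2, so `psi` tends to 0. Differentiation under the integral
rests on the bound of 1/√(σ(x-ξ)σ(x+ξ)) by a multiple of (s(1-s))^(-1/2), locally uniform in x. This
gives `fInt_ode`.

For `g_i`, put ψ = φ/σ. The weight is ψ''/ψ, so weight times φ is `gam` = σψ'', holomorphic off Λ. A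
second exact relation, `kernel_first_order`, expresses ℘'(x) f' through f and the weighted integral
G (`first_order_relation`). Differentiating it and eliminating f'' by `fInt_ode` yields the
derivative of G (`deriv_integral_gReg`); the factor (℘(x)-℘(α))² cancels, so the system stays
regular at z = λ. What remains is the change of variable z and a comparison of coefficients, written
in the roots e₁, e₂, e₃. -/

namespace EllipticFuchs

open Filter Topology

/-! ### The Weierstrass functions `σ` and `ζ` -/

/-- The elementary factor `(1 - w) exp (w + w² / 2)`. -/
noncomputable def elemFactor (w : ℂ) : ℂ := (1 - w) * Complex.exp (w + w ^ 2 / 2)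

lemma hasDerivAt_elemFactor (w : ℂ) :
    HasDerivAt elemFactor (-w ^ 2 * Complex.exp (w + w ^ 2 / 2)) w := by
  have h1 : HasDerivAt (fun w : ℂ => 1 - w) (-1) w := by
    simpa using (hasDerivAt_id w).const_sub 1
  have h2 : HasDerivAt (fun w : ℂ => w + w ^ 2 / 2) (1 + w) w := by
    have := (hasDerivAt_id w).add (((hasDerivAt_id w).pow 2).div_const 2)
    exact this.congr_deriv (by simp)
  exact (h1.mul h2.cexp).congr_deriv (by ring)

/-- The derivative -w² exp(w + w²/2) vanishes to second order at 0, so the mean value inequality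
gives a cubic bound. Exponent 3 exceeds the rank 2 of the lattice, which makes the product for σ
converge. -/
lemma norm_elemFactor_sub_one_le {w : ℂ} (hw : ‖w‖ ≤ 1) :
    ‖elemFactor w - 1‖ ≤ Real.exp 2 * ‖w‖ ^ 3 := by
  have key := (convex_closedBall (0 : ℂ) ‖w‖).norm_image_sub_le_of_norm_hasDerivWithin_le
    (f := elemFactor) (C := ‖w‖ ^ 2 * Real.exp 2) (x := 0) (y := w)
    (fun x _ => (hasDerivAt_elemFactor x).hasDerivWithinAt) (fun x hx => ?_) (by simp) (by simp)
  · have h0 : elemFactor 0 = 1 := by simp [elemFactor]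
    rw [h0, sub_zero] at key
    linarith [key]
  · have hx' : ‖x‖ ≤ ‖w‖ := by simpa using hx
    rw [norm_mul, norm_neg, norm_pow]
    gcongr
    -- For ‖x‖ ≤ 1 the exponent has norm at most 3/2.
    refine (Complex.norm_exp_le_exp_norm _).trans (Real.exp_le_exp.2 ?_)
    have : ‖x + x ^ 2 / 2‖ ≤ ‖x‖ + ‖x‖ ^ 2 / 2 := by
      refine (norm_add_le _ _).trans ?_
      simp
    nlinarith [norm_nonneg x]

variable (L : PeriodPair)

lemma summable_lattice_norm_rpow : Summable fun l : L.lattice => ‖l‖ ^ (-3 : ℝ) :=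
  ZLattice.summable_norm_rpow _ _ (by simp; norm_num)

lemma zetaSummand_eq {x l : ℂ} (hl : l ≠ 0) (hx : x ≠ l) :
    1 / (x - l) + 1 / l + x / l ^ 2 = x ^ 2 / (l ^ 2 * (x - l)) := by
  have := sub_ne_zero.2 hx
  field_simp
  ring

lemma hasSumLocallyUniformly_wZeta :
    HasSumLocallyUniformly
      (fun (l : L.lattice) (x : ℂ) => 1 / (x - l) + 1 / (l : ℂ) + x / (l : ℂ) ^ 2) (wZeta L) := by
  refine L.hasSumLocallyUniformly_aux (u := fun r l => 2 * r ^ 2 * ‖l‖ ^ (-3 : ℝ)) _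
    (fun _ _ => (summable_lattice_norm_rpow L).mul_left _) fun r hr =>
    Filter.eventually_atTop.mpr ⟨2 * r, ?_⟩
  rintro _ h s hs l rfl
  have hl : 0 < ‖(l : ℂ)‖ := by linarith
  have hl0 : (l : ℂ) ≠ 0 := norm_pos_iff.1 hl
  have hne : s ≠ l := by rintro rfl; linarith
  have h3 : ‖(l : ℂ)‖ / 2 ≤ ‖s - l‖ := by
    have := norm_sub_norm_le (l : ℂ) s
    rw [norm_sub_rev] at this
    linarith
  rw [zetaSummand_eq hl0 hne, norm_div, norm_mul, norm_pow, norm_pow]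
  have : ‖l‖ ^ (-3 : ℝ) = (‖(l : ℂ)‖ ^ 3)⁻¹ := by
    rw [Real.rpow_neg (by positivity)]
    norm_cast
  rw [this]
  calc ‖s‖ ^ 2 / (‖(l : ℂ)‖ ^ 2 * ‖s - l‖) ≤ r ^ 2 / (‖(l : ℂ)‖ ^ 2 * (‖(l : ℂ)‖ / 2)) := by
        gcongr
    _ = 2 * r ^ 2 * (‖(l : ℂ)‖ ^ 3)⁻¹ := by field_simp

/-- The series for ζ converges locally uniformly, so it may be differentiated term by term; the
derivatives are the negatives of the terms of ℘. -/
lemma hasDerivAt_wZeta {x : ℂ} (hx : x ∉ L.lattice) :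
    HasDerivAt (wZeta L) (-L.weierstrassP x) x := by
  have hO : IsOpen ((L.lattice : Set ℂ)ᶜ) := L.isClosed_lattice.isOpen_compl
  have hd : ∀ l : L.lattice, ∀ y ∈ (L.lattice : Set ℂ)ᶜ,
      HasDerivAt (fun x : ℂ => 1 / (x - l) + 1 / (l : ℂ) + x / (l : ℂ) ^ 2)
        (-(1 / (y - l) ^ 2 - 1 / (l : ℂ) ^ 2)) y := by
    intro l y hy
    have hne : y - l ≠ 0 := sub_ne_zero.2 (fun h => hy (h ▸ l.2))
    have h1 : HasDerivAt (fun x : ℂ => 1 / (x - l)) (-(1 / (y - l) ^ 2)) y := by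
      simp only [one_div]
      exact (((hasDerivAt_id y).sub_const (l : ℂ)).inv hne).congr_deriv (by simp [neg_div])
    exact ((h1.add_const (1 / (l : ℂ))).add
      ((hasDerivAt_id y).div_const ((l : ℂ) ^ 2))).congr_deriv (by ring)
  have hT := (hasSumLocallyUniformly_wZeta L).tendstoLocallyUniformlyOn (s := (L.lattice : Set ℂ)ᶜ)
  have hF : ∀ s : Finset L.lattice, DifferentiableOn ℂ
      (fun x => ∑ l ∈ s, (1 / (x - l) + 1 / (l : ℂ) + x / (l : ℂ) ^ 2)) (L.lattice : Set ℂ)ᶜ :=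
    fun s => .fun_sum fun l _ => fun y hy => (hd l y hy).differentiableAt.differentiableWithinAt
  have hdiff : DifferentiableOn ℂ (wZeta L) (L.lattice : Set ℂ)ᶜ :=
    hT.differentiableOn (.of_forall hF) hO
  have hderiv := (hT.deriv (.of_forall hF) hO).tendsto_at hx
  have h2 := (L.hasSum_weierstrassP x).neg
  have heq : deriv (wZeta L) x = -L.weierstrassP x := by
    refine tendsto_nhds_unique hderiv (Tendsto.congr (fun s => ?_) h2)
    simp only [Function.comp_apply]
    exact ((HasDerivAt.fun_sum fun l _ => hd l x hx).deriv).symm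
  rw [← heq]
  exact (hdiff.differentiableAt (hO.mem_nhds hx)).hasDerivAt

/-- The product part of the sigma function. -/
noncomputable def sigmaProd (x : ℂ) : ℂ := ∏' l : {l : L.lattice // l ≠ 0}, elemFactor (x / (l.1 : ℂ))

lemma wSigma_eq (x : ℂ) : wSigma L x = x * sigmaProd L x := rfl

lemma sigmaProd_bound (r : ℝ) (hr : 0 < r) :
    ∀ᶠ l : {l : L.lattice // l ≠ 0} in cofinite, ∀ x ∈ Metric.ball (0 : ℂ) r,
      ‖elemFactor (x / (l.1 : ℂ)) - 1‖ ≤ Real.exp 2 * r ^ 3 * ‖l.1‖ ^ (-3 : ℝ) := by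
  have hfin : {l : L.lattice | ‖l‖ ≤ r}.Finite := by
    refine (isCompact_iff_finite.mp (isCompact_closedBall (0 : L.lattice) r)).subset ?_
    intro l hl
    simpa using hl
  have : ∀ᶠ l : L.lattice in cofinite, r < ‖l‖ := by
    filter_upwards [hfin.compl_mem_cofinite] with l hl
    simpa using hl
  have h2 := (Subtype.val_injective (p := fun l : L.lattice => l ≠ 0)).tendsto_cofinite.eventually
    this
  filter_upwards [h2] with l hl x hx
  have hx' : ‖x‖ < r := by simpa using hx
  have hl' : r < ‖(l.1 : ℂ)‖ := hl
  have hpos : 0 < ‖(l.1 : ℂ)‖ := hr.trans hl'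
  have h3 : ‖l.1‖ ^ (-3 : ℝ) = (‖(l.1 : ℂ)‖ ^ 3)⁻¹ := by
    rw [Real.rpow_neg (by positivity)]
    norm_cast
  refine (norm_elemFactor_sub_one_le ?_).trans ?_
  · rw [norm_div, div_le_one hpos]
    linarith
  · rw [h3, norm_div, div_pow, mul_assoc, ← div_eq_mul_inv]
    gcongr

lemma summable_sigmaProd_bound (C : ℝ) :
    Summable fun l : {l : L.lattice // l ≠ 0} => C * ‖l.1‖ ^ (-3 : ℝ) :=
  ((summable_lattice_norm_rpow L).subtype _).mul_left _

lemma differentiable_elemFactor : Differentiable ℂ elemFactor := fun w =>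
  (hasDerivAt_elemFactor w).differentiableAt

lemma differentiable_elemFactor_div (l : ℂ) : Differentiable ℂ fun x => elemFactor (x / l) :=
  differentiable_elemFactor.comp (differentiable_id.div_const l)

lemma hasProdLocallyUniformlyOn_sigmaProd (r : ℝ) (hr : 0 < r) :
    HasProdLocallyUniformlyOn
      (fun (l : {l : L.lattice // l ≠ 0}) (x : ℂ) => elemFactor (x / (l.1 : ℂ)))
      (sigmaProd L) (Metric.ball 0 r) := by
  have := Summable.hasProdLocallyUniformlyOn_one_add (K := Metric.ball (0 : ℂ) r)
    (f := fun (l : {l : L.lattice // l ≠ 0}) (x : ℂ) => elemFactor (x / (l.1 : ℂ)) - 1)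
    Metric.isOpen_ball (summable_sigmaProd_bound L _) (sigmaProd_bound L r hr)
    (fun l => ((differentiable_elemFactor_div _).continuous.sub continuous_const).continuousOn)
  simp only [add_sub_cancel] at this
  exact this

lemma differentiable_sigmaProd : Differentiable ℂ (sigmaProd L) := by
  intro x
  have hx : x ∈ Metric.ball (0 : ℂ) (‖x‖ + 1) := by simp
  have h := (hasProdLocallyUniformlyOn_sigmaProd L (‖x‖ + 1) (by positivity))
  rw [hasProdLocallyUniformlyOn_iff_tendstoLocallyUniformlyOn] at h
  refine (h.differentiableOn (.of_forall fun s => ?_) Metric.isOpen_ball).differentiableAt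
    (Metric.isOpen_ball.mem_nhds hx)
  exact (Differentiable.fun_finsetProd fun l _ =>
    differentiable_elemFactor_div _).differentiableOn

lemma sigmaProd_zero : sigmaProd L 0 = 1 := by
  simp [sigmaProd, elemFactor]

lemma elemFactor_eq_zero {w : ℂ} : elemFactor w = 0 ↔ w = 1 := by
  simp [elemFactor, sub_eq_zero, eq_comm (a := w)]

lemma elemFactor_div_ne_zero {x : ℂ} (hx : x ∉ L.lattice) (l : {l : L.lattice // l ≠ 0}) :
    elemFactor (x / (l.1 : ℂ)) ≠ 0 := by
  have hl : (l.1 : ℂ) ≠ 0 := by simpa using l.2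
  rw [Ne, elemFactor_eq_zero, div_eq_one_iff_eq hl]
  rintro rfl
  exact hx l.1.2

lemma sigmaProd_ne_zero {x : ℂ} (hx : x ∉ L.lattice) : sigmaProd L x ≠ 0 := by
  have h := tprod_one_add_ne_zero_of_summable
    (f := fun l : {l : L.lattice // l ≠ 0} => elemFactor (x / (l.1 : ℂ)) - 1)
    (fun l => by simpa using elemFactor_div_ne_zero L hx l) ?_
  · simpa [sigmaProd] using h
  · refine Summable.of_norm_bounded_eventually
      (summable_sigmaProd_bound L (Real.exp 2 * (‖x‖ + 1) ^ 3)) ?_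
    filter_upwards [sigmaProd_bound L (‖x‖ + 1) (by positivity)] with l hl
    simpa using hl x (by simp)

lemma logDeriv_elemFactor_div {x l : ℂ} (hl : l ≠ 0) (hx : x ≠ l) :
    logDeriv (fun x => elemFactor (x / l)) x = 1 / (x - l) + 1 / l + x / l ^ 2 := by
  have h := (hasDerivAt_elemFactor (x / l)).comp x ((hasDerivAt_id x).div_const l)
  have h' : deriv (fun x => elemFactor (x / l)) x
    = -(x / l) ^ 2 * Complex.exp (x / l + (x / l) ^ 2 / 2) * (1 / l) := h.deriv
  rw [logDeriv_apply, h', zetaSummand_eq hl hx, elemFactor]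
  have h1 : x - l ≠ 0 := sub_ne_zero.2 hx
  have h2 : 1 - x / l ≠ 0 := by
    rw [Ne, sub_eq_zero, eq_comm, div_eq_one_iff_eq hl]
    exact hx
  have h3 : l - x ≠ 0 := sub_ne_zero.2 hx.symm
  have h4 : 1 - x / l = -(x - l) / l := by field_simp; ring
  rw [h4]
  have := Complex.exp_ne_zero (x / l + (x / l) ^ 2 / 2)
  generalize Complex.exp (x / l + (x / l) ^ 2 / 2) = E at *
  field_simp

lemma logDeriv_sigmaProd {x : ℂ} (hx : x ∉ L.lattice) :
    logDeriv (sigmaProd L) x = wZeta L x - 1 / x := by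
  have hsum : Summable fun l : L.lattice => 1 / (x - l) + 1 / (l : ℂ) + x / (l : ℂ) ^ 2 :=
    ((hasSumLocallyUniformly_wZeta L).hasSum (x := x)).summable
  have hterm : ∀ l : {l : L.lattice // l ≠ 0}, logDeriv (fun x => elemFactor (x / (l.1 : ℂ))) x
      = 1 / (x - l.1) + 1 / (l.1 : ℂ) + x / (l.1 : ℂ) ^ 2 := by
    intro l
    exact logDeriv_elemFactor_div (by simpa using l.2) (fun h => hx (h ▸ l.1.2))
  have h1 : logDeriv (sigmaProd L) x
      = ∑' l : {l : L.lattice // l ≠ 0}, logDeriv (fun x => elemFactor (x / (l.1 : ℂ))) x := by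
    refine logDeriv_tprod_eq_tsum (s := Metric.ball 0 (‖x‖ + 1)) Metric.isOpen_ball (by simp)
      (fun l => elemFactor_div_ne_zero L hx l)
      (fun l => (differentiable_elemFactor_div _).differentiableOn) ?_
      (hasProdLocallyUniformlyOn_sigmaProd L _ (by positivity)).multipliableLocallyUniformlyOn
      (sigmaProd_ne_zero L hx)
    simp_rw [hterm]
    exact hsum.subtype _
  -- The term of ζ at l = 0 is 1/x because of division by zero in the other two summands. It belongs
  -- to the factor x of σ and not to `sigmaProd`.
  have h2 := hsum.tsum_subtype_add_tsum_subtype_compl {0}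
  rw [h1]
  simp_rw [hterm]
  rw [wZeta, ← h2]
  have h3 : ∑' l : ({0} : Set L.lattice), (1 / (x - l.1) + 1 / (l.1 : ℂ) + x / (l.1 : ℂ) ^ 2)
      = 1 / x := by
    rw [tsum_singleton (0 : L.lattice) (fun l => 1 / (x - l) + 1 / (l : ℂ) + x / (l : ℂ) ^ 2)]
    simp
  rw [h3, add_sub_cancel_left]
  rfl

lemma differentiable_wSigma : Differentiable ℂ (wSigma L) :=
  differentiable_id.mul (differentiable_sigmaProd L)

lemma continuous_wSigma : Continuous (wSigma L) := (differentiable_wSigma L).continuous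

lemma wSigma_ne_zero {x : ℂ} (hx : x ∉ L.lattice) : wSigma L x ≠ 0 :=
  mul_ne_zero (fun h => hx (h ▸ L.lattice.zero_mem)) (sigmaProd_ne_zero L hx)

lemma hasDerivAt_wSigma_zero : HasDerivAt (wSigma L) 1 0 := by
  exact ((hasDerivAt_id (0 : ℂ)).mul (differentiable_sigmaProd L 0).hasDerivAt).congr_deriv
    (by simp [sigmaProd_zero])

lemma hasDerivAt_wSigma {x : ℂ} (hx : x ∉ L.lattice) :
    HasDerivAt (wSigma L) (wSigma L x * wZeta L x) x := by
  have hx0 : x ≠ 0 := fun h => hx (h ▸ L.lattice.zero_mem)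
  have h := (hasDerivAt_id x).mul (differentiable_sigmaProd L x).hasDerivAt
  have h2 := logDeriv_sigmaProd L hx
  have h3 := sigmaProd_ne_zero L hx
  rw [logDeriv_apply, div_eq_iff h3] at h2
  rw [h2] at h
  refine HasDerivAt.congr_deriv (f := wSigma L) h ?_
  rw [wSigma_eq]
  simp only [id]
  field_simp
  ring

end EllipticFuchs

namespace EllipticFuchs

open Filter Topology

variable (L : PeriodPair)

/-! ### The complement of the lattice, extension by continuity, and Liouville's theorem for elliptic
functions. -/

lemma countable_lattice : (L.lattice : Set ℂ).Countable :=
  countable_of_Lindelof_of_discrete (X := L.lattice)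

lemma isOpen_compl_lattice : IsOpen ((L.lattice : Set ℂ)ᶜ) := L.isClosed_lattice.isOpen_compl

lemma isPreconnected_compl_lattice : IsPreconnected ((L.lattice : Set ℂ)ᶜ) :=
  ((countable_lattice L).isConnected_compl_of_one_lt_rank (by simp)).2

lemma eventually_punctured_notMem_lattice (x : ℂ) : ∀ᶠ y in 𝓝[≠] x, y ∉ L.lattice := by
  filter_upwards [mem_nhdsWithin_of_mem_nhds (L.compl_lattice_sdiff_singleton_mem_nhds x),
    self_mem_nhdsWithin] with y hy hyx h
  exact hy ⟨h, hyx⟩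

/-- Two functions that are continuous on an open set and agree off a countable set agree. -/
lemma eqOn_of_eqOn_diff_countable {f g : ℂ → ℂ} {O C : Set ℂ} (hO : IsOpen O) (hC : C.Countable)
    (hf : ContinuousOn f O) (hg : ContinuousOn g O) (h : EqOn f g (O \ C)) : EqOn f g O := by
  have hsub : O ⊆ closure (O \ C) := by
    have := (hC.dense_compl ℂ).open_subset_closure_inter hO
    rwa [← sdiff_eq] at this
  exact h.of_subset_closure hf hg sdiff_subset hsub

/-- A doubly periodic function, holomorphic off the lattice, with poles of order less than one,
is constant. -/
lemma eq_of_periodic_of_tendsto {h : ℂ → ℂ} (hd : DifferentiableOn ℂ h (L.lattice : Set ℂ)ᶜ)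
    (hper : ∀ l ∈ L.lattice, ∀ z ∉ L.lattice, h (z + l) = h z)
    (hlim : Tendsto (fun z => z * h z) (𝓝[≠] 0) (𝓝 0)) {x y : ℂ} (hx : x ∉ L.lattice)
    (hy : y ∉ L.lattice) : h x = h y := by
  classical
  set K := limUnder (𝓝[≠] (0 : ℂ)) h
  -- One limit, taken at 0, serves at every lattice point by periodicity; the extension is then
  -- entire with compact range.
  set H : ℂ → ℂ := fun z => if z ∈ L.lattice then K else h z
  have hHper : ∀ z w, w ∈ L.lattice → H (z + w) = H z := by
    intro z w hw
    have : z + w ∈ L.lattice ↔ z ∈ L.lattice := L.lattice.add_mem_iff_left hw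
    by_cases hz : z ∈ L.lattice
    · simp [H, hz, this]
    · simp [H, hz, this, hper w hw z hz]
  have hs := L.compl_lattice_sdiff_singleton_mem_nhds 0
  have hH0 : DifferentiableAt ℂ H 0 := by
    have h1 := Complex.differentiableOn_update_limUnder_of_isLittleO (f := h) hs
      (hd.mono ?_) ?_
    · refine (h1.differentiableAt hs).congr_of_eventuallyEq ?_
      filter_upwards [hs] with z hz
      by_cases hz0 : z = 0
      · simp [hz0, H, K]
      · have : z ∉ L.lattice := fun h => hz ⟨h, hz0⟩
        simp [H, this, hz0]
    · rintro z ⟨hz, hz0⟩ hzL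
      exact hz ⟨hzL, hz0⟩
    · rw [Asymptotics.isLittleO_iff_tendsto']
      -- The removable singularity criterion concerns h(z) - h(0), so the contribution of the
      -- arbitrary value h(0) has to be removed as well.
      · have h2 : Tendsto (fun z : ℂ => z * h 0) (𝓝[≠] 0) (𝓝 0) := by
          have : Tendsto (fun z : ℂ => z * h 0) (𝓝 0) (𝓝 (0 * h 0)) :=
            (continuous_id.mul continuous_const).tendsto 0
          rw [zero_mul] at this
          exact this.mono_left nhdsWithin_le_nhds
        refine (by simpa using hlim.sub h2 : Tendsto _ _ _).congr fun z => ?_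
        simp
        ring
      · filter_upwards [self_mem_nhdsWithin] with z hz h
        simp at h
        exact absurd h hz
  have hHd : Differentiable ℂ H := by
    intro z
    by_cases hz : z ∈ L.lattice
    · have : H = fun w => H (w - z) := by
        ext w
        rw [← hHper (w - z) z hz, sub_add_cancel]
      rw [this]
      refine DifferentiableAt.comp z (g := H) (f := fun w => w - z) ?_ (by fun_prop)
      simpa using hH0
    · refine (hd.differentiableAt ((isOpen_compl_lattice L).mem_nhds hz)).congr_of_eventuallyEq ?_
      filter_upwards [(isOpen_compl_lattice L).mem_nhds hz] with w hw
      simp [H, show w ∉ L.lattice from hw]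
  have := hHd.apply_eq_apply_of_bounded
    (IsZLattice.isCompact_range_of_periodic L.lattice _ hHd.continuous hHper).isBounded x y
  simpa [H, hx, hy] using this

/-! ### Parity and quasi-periodicity -/

lemma neg_notMem {x : ℂ} (hx : x ∉ L.lattice) : -x ∉ L.lattice := by
  simpa using hx

lemma wZeta_neg (x : ℂ) : wZeta L (-x) = -wZeta L x := by
  rw [wZeta, wZeta, ← (Equiv.neg L.lattice).tsum_eq, ← tsum_neg]
  congr with l
  simp only [Equiv.neg_apply, NegMemClass.coe_neg, sub_neg_eq_add, neg_sq]
  rw [show -x + (l : ℂ) = -(x - l) by ring]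
  simp only [one_div, inv_neg]
  ring

lemma sigmaProd_neg (x : ℂ) : sigmaProd L (-x) = sigmaProd L x := by
  let e : {l : L.lattice // l ≠ 0} ≃ {l : L.lattice // l ≠ 0} :=
    (Equiv.neg L.lattice).subtypeEquiv (fun l => by simp)
  rw [sigmaProd, sigmaProd, ← e.tprod_eq]
  congr with l
  simp [e]

lemma wSigma_neg (x : ℂ) : wSigma L (-x) = -wSigma L x := by
  rw [wSigma_eq, wSigma_eq, sigmaProd_neg, neg_mul]

lemma add_notMem {x l : ℂ} (hx : x ∉ L.lattice) (hl : l ∈ L.lattice) : x + l ∉ L.lattice := by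
  rwa [L.lattice.add_mem_iff_left hl]

lemma hasDerivAt_weierstrassP {x : ℂ} (hx : x ∉ L.lattice) :
    HasDerivAt L.weierstrassP (L.derivWeierstrassP x) x := by
  rw [← L.deriv_weierstrassP]
  exact (L.differentiableOn_weierstrassP.differentiableAt
    ((isOpen_compl_lattice L).mem_nhds hx)).hasDerivAt

/-- The difference ζ(x+l) - ζ(x) has derivative ℘(x) - ℘(x+l) = 0 on the connected complement of Λ.
-/
lemma exists_wZeta_add {l : ℂ} (hl : l ∈ L.lattice) :
    ∃ η : ℂ, ∀ x ∉ L.lattice, wZeta L (x + l) = wZeta L x + η := by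
  have hd : ∀ x ∉ L.lattice, HasDerivAt (fun x => wZeta L (x + l) - wZeta L x) 0 x := by
    intro x hx
    have h1 := (hasDerivAt_wZeta L (add_notMem L hx hl)).comp_add_const x l
    refine (h1.sub (hasDerivAt_wZeta L hx)).congr_deriv ?_
    rw [L.weierstrassP_add_coe x ⟨l, hl⟩, sub_self]
  obtain ⟨η, hη⟩ := (isOpen_compl_lattice L).exists_is_const_of_deriv_eq_zero
    (isPreconnected_compl_lattice L)
    (fun x hx => (hd x hx).differentiableAt.differentiableWithinAt) (fun x hx => (hd x hx).deriv)
  refine ⟨η, fun x hx => ?_⟩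
  have := hη x hx
  linear_combination this

/-- The quotient of both sides has logarithmic derivative ζ(x+l) - ζ(x) - η = 0, hence is constant
off Λ. Continuity extends the formula to Λ, where it shows that σ vanishes. -/
lemma exists_wSigma_add {l : ℂ} (hl : l ∈ L.lattice) :
    ∃ C η : ℂ, C ≠ 0 ∧ ∀ x, wSigma L (x + l) = C * Complex.exp (η * x) * wSigma L x := by
  obtain ⟨η, hη⟩ := exists_wZeta_add L hl
  have hd : ∀ x ∉ L.lattice,
      HasDerivAt (fun x => wSigma L (x + l) / (Complex.exp (η * x) * wSigma L x)) 0 x := by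
    intro x hx
    have h1 := (hasDerivAt_wSigma L (add_notMem L hx hl)).comp_add_const x l
    have h2 : HasDerivAt (fun x => Complex.exp (η * x)) (Complex.exp (η * x) * (η * 1)) x :=
      ((hasDerivAt_id x).const_mul η).cexp
    have hne : Complex.exp (η * x) * wSigma L x ≠ 0 :=
      mul_ne_zero (Complex.exp_ne_zero _) (wSigma_ne_zero L hx)
    refine (h1.div (h2.mul (hasDerivAt_wSigma L hx)) hne).congr_deriv ?_
    rw [div_eq_zero_iff, hη x hx]
    left
    simp only [Pi.mul_apply]
    ring
  obtain ⟨C, hC⟩ := (isOpen_compl_lattice L).exists_is_const_of_deriv_eq_zero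
    (isPreconnected_compl_lattice L)
    (fun x hx => (hd x hx).differentiableAt.differentiableWithinAt) (fun x hx => (hd x hx).deriv)
  have key : ∀ x ∉ L.lattice, wSigma L (x + l) = C * Complex.exp (η * x) * wSigma L x := by
    intro x hx
    have := hC x hx
    rw [div_eq_iff (mul_ne_zero (Complex.exp_ne_zero _) (wSigma_ne_zero L hx))] at this
    rw [this]
    ring
  have cσ := continuous_wSigma L
  refine ⟨C, η, ?_, fun x => ?_⟩
  · rintro rfl
    have h1 := key _ L.ω₁_div_two_notMem_lattice
    rw [zero_mul, zero_mul] at h1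
    exact wSigma_ne_zero L (add_notMem L L.ω₁_div_two_notMem_lattice hl) h1
  · refine eqOn_of_eqOn_diff_countable (f := fun x => wSigma L (x + l))
      (g := fun x => C * Complex.exp (η * x) * wSigma L x) isOpen_univ (countable_lattice L) ?_ ?_ ?_ (mem_univ x)
    · fun_prop
    · fun_prop
    · rintro y ⟨-, hy⟩
      exact key y hy

lemma wSigma_zero : wSigma L 0 = 0 := by simp [wSigma_eq]

lemma wSigma_of_mem {l : ℂ} (hl : l ∈ L.lattice) : wSigma L l = 0 := by
  obtain ⟨C, η, -, h⟩ := exists_wSigma_add L hl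
  simpa [wSigma_zero] using h 0

lemma wSigma_eq_zero_iff {x : ℂ} : wSigma L x = 0 ↔ x ∈ L.lattice :=
  ⟨fun h => by_contra fun hx => wSigma_ne_zero L hx h, wSigma_of_mem L⟩

lemma deriv_wSigma_ne_zero {l : ℂ} (hl : l ∈ L.lattice) : deriv (wSigma L) l ≠ 0 := by
  obtain ⟨C, η, hC, h⟩ := exists_wSigma_add L hl
  have h1 : HasDerivAt (fun x => wSigma L (x + l)) (deriv (wSigma L) l) 0 := by
    have := (differentiable_wSigma L (0 + l)).hasDerivAt.comp_add_const 0 l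
    simpa using this
  have h2 : HasDerivAt (fun x => C * Complex.exp (η * x)) (C * (Complex.exp (η * 0) * (η * 1))) 0 :=
    (((hasDerivAt_id (0 : ℂ)).const_mul η).cexp).const_mul C
  have h3 := h2.mul (hasDerivAt_wSigma_zero L)
  have h4 : (fun x => wSigma L (x + l)) = (fun x => C * Complex.exp (η * x)) * wSigma L := by
    ext x
    exact h x
  rw [h4] at h1
  rw [h1.unique h3]
  simp [wSigma_zero, hC]

end EllipticFuchs

namespace EllipticFuchs

open Filter Topology

variable (L : PeriodPair)

/-! ### Addition formulas -/

/-- The quotient is (N(z) - 1)/z² and ℘(z) is 1/z² plus a function regular at 0, so the double poles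
cancel and N(z)/z remains. As N is even with N(0) = 0, also N'(0) = 0, and there is no simple pole
either. -/
lemma tendsto_mul_sigma_quotient {y : ℂ} (hy : y ∉ L.lattice) :
    Tendsto (fun z => z * (wSigma L (z + y) * wSigma L (z - y) / (wSigma L z ^ 2 * wSigma L y ^ 2)
      + L.weierstrassP z)) (𝓝[≠] 0) (𝓝 0) := by
  have hσy := wSigma_ne_zero L hy
  set N : ℂ → ℂ := fun z =>
    wSigma L (z + y) * wSigma L (z - y) / (sigmaProd L z ^ 2 * wSigma L y ^ 2) + 1
  have dσ := differentiable_wSigma L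
  have d1 := differentiable_sigmaProd L
  have hN0 : N 0 = 0 := by
    simp only [N, zero_add, zero_sub, wSigma_neg, sigmaProd_zero]
    field_simp
    ring
  have hNneg : ∀ z, N (-z) = N z := by
    intro z
    simp only [N, sigmaProd_neg]
    rw [show -z + y = -(z - y) by ring, show -z - y = -(z + y) by ring, wSigma_neg, wSigma_neg]
    ring
  have hNd : DifferentiableAt ℂ N 0 := by
    refine DifferentiableAt.add_const _ (DifferentiableAt.div ?_ ?_ ?_)
    · fun_prop
    · fun_prop
    · simp [sigmaProd_zero, hσy]
  have hN' : HasDerivAt N 0 0 := by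
    have h1 := hNd.hasDerivAt
    have h2 : HasDerivAt N (deriv N 0) (-0) := by simpa using h1
    have h3 : HasDerivAt (fun z => N (-z)) (-deriv N 0) 0 := by
      exact (h2.comp (0 : ℂ) (hasDerivAt_neg (0 : ℂ))).congr_deriv (by simp)
    simp only [hNneg] at h3
    have h4 := h1.unique h3
    have h5 : deriv N 0 = 0 := by linear_combination h4 / 2
    rwa [h5] at h1
  have hE : Tendsto (fun z => z * L.weierstrassPExcept 0 z) (𝓝[≠] 0) (𝓝 0) := by
    have h1 : ContinuousAt (fun z => z * L.weierstrassPExcept 0 z) 0 :=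
      continuousAt_id.mul (L.analyticAt_weierstrassPExcept 0).continuousAt
    have := h1.tendsto.mono_left (nhdsWithin_le_nhds (s := {0}ᶜ))
    simpa using this
  have hS := hasDerivAt_iff_tendsto_slope.1 hN'
  have := hS.add hE
  rw [add_zero] at this
  refine this.congr' ?_
  filter_upwards [self_mem_nhdsWithin, eventually_punctured_notMem_lattice L 0] with z hz hzL
  have hz0 : z ≠ 0 := hz
  have hs := sigmaProd_ne_zero L hzL
  have h6 := L.weierstrassPExcept_def 0 z
  simp only [ZeroMemClass.coe_zero, sub_zero] at h6
  rw [slope_def_field, hN0, h6, wSigma_eq L z]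
  simp only [N]
  field_simp
  ring

/-- `σ(x + y) σ(x - y) = -σ(x)² σ(y)² (℘(x) - ℘(y))` -/
lemma wSigma_mul {x y : ℂ} (hx : x ∉ L.lattice) (hy : y ∉ L.lattice) :
    wSigma L (x + y) * wSigma L (x - y)
      = -(wSigma L x ^ 2 * wSigma L y ^ 2 * (L.weierstrassP x - L.weierstrassP y)) := by
  have hσy := wSigma_ne_zero L hy
  have hσx := wSigma_ne_zero L hx
  have dσ := differentiable_wSigma L
  -- The elliptic function σ(z+y)σ(z-y)/(σ(z)²σ(y)²) + ℘(z) is constant; at z = y its first term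
  -- vanishes, so the constant is ℘(y).
  have h := eq_of_periodic_of_tendsto L (h := fun z =>
    wSigma L (z + y) * wSigma L (z - y) / (wSigma L z ^ 2 * wSigma L y ^ 2) + L.weierstrassP z)
    ?_ ?_ (tendsto_mul_sigma_quotient L hy) hx hy
  · simp only [sub_self, wSigma_zero, mul_zero, zero_div, zero_add] at h
    field_simp at h
    linear_combination h
  · intro z hz
    have hσz := wSigma_ne_zero L hz
    refine DifferentiableAt.differentiableWithinAt (DifferentiableAt.add
      (DifferentiableAt.div ?_ ?_ ?_) (hasDerivAt_weierstrassP L hz).differentiableAt)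
    · fun_prop
    · fun_prop
    · simp [hσy, hσz]
  · intro l hl z hz
    obtain ⟨C, η, hC, h⟩ := exists_wSigma_add L hl
    have hσz := wSigma_ne_zero L hz
    have hP : L.weierstrassP (z + l) = L.weierstrassP z := L.weierstrassP_add_coe z ⟨l, hl⟩
    rw [hP, show z + l + y = z + y + l by ring, show z + l - y = z - y + l by ring, h, h, h,
      show η * (z + y) = η * z + η * y by ring, show η * (z - y) = η * z + -(η * y) by ring,
      Complex.exp_add, Complex.exp_add, Complex.exp_neg]
    have e1 := Complex.exp_ne_zero (η * z)
    have e2 := Complex.exp_ne_zero (η * y)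
    field_simp

lemma weierstrassP_eq_iff {x y : ℂ} (hx : x ∉ L.lattice) (hy : y ∉ L.lattice) :
    L.weierstrassP x = L.weierstrassP y ↔ x + y ∈ L.lattice ∨ x - y ∈ L.lattice := by
  have h := wSigma_mul L hx hy
  rw [← wSigma_eq_zero_iff, ← wSigma_eq_zero_iff, ← mul_eq_zero, h]
  simp [wSigma_ne_zero L hx, wSigma_ne_zero L hy, sub_eq_zero]

/-- `℘'(x) = -σ(2x) / σ(x)⁴` -/
lemma derivWeierstrassP_eq {x : ℂ} (hx : x ∉ L.lattice) :
    L.derivWeierstrassP x = -wSigma L (2 * x) / wSigma L x ^ 4 := by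
  have hσx := wSigma_ne_zero L hx
  have dσ := differentiable_wSigma L
  have h1 : HasDerivAt (fun u => wSigma L (u + x) * wSigma L (u - x))
      (deriv (wSigma L) (x + x) * wSigma L (x - x) + wSigma L (x + x) * 1) x := by
    refine HasDerivAt.mul ((dσ (x + x)).hasDerivAt.comp_add_const x x) ?_
    have : HasDerivAt (wSigma L) 1 (x - x) := by
      rw [sub_self]
      exact hasDerivAt_wSigma_zero L
    exact this.comp_sub_const x x
  have h2 : HasDerivAt (fun u => -(wSigma L u ^ 2 * wSigma L x ^ 2
      * (L.weierstrassP u - L.weierstrassP x)))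
      (-(wSigma L x ^ 2 * wSigma L x ^ 2 * L.derivWeierstrassP x)) x := by
    have h3 : HasDerivAt (fun u => wSigma L u ^ 2 * wSigma L x ^ 2)
        (deriv (fun u => wSigma L u ^ 2 * wSigma L x ^ 2) x) x :=
      DifferentiableAt.hasDerivAt (by fun_prop)
    refine ((h3.mul ((hasDerivAt_weierstrassP L hx).sub_const (L.weierstrassP x))).neg).congr_deriv
      ?_
    ring
  have h4 := h1.unique (h2.congr_of_eventuallyEq ?_)
  · rw [sub_self, wSigma_zero, ← two_mul] at h4
    field_simp
    linear_combination h4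
  · filter_upwards [(isOpen_compl_lattice L).mem_nhds hx] with u hu
    exact wSigma_mul L hu hx

lemma notMem_of_two_mul_notMem {x : ℂ} (hx : 2 * x ∉ L.lattice) : x ∉ L.lattice := fun h =>
  hx (by rw [two_mul]; exact add_mem h h)

lemma derivWeierstrassP_ne_zero {x : ℂ} (hx : 2 * x ∉ L.lattice) : L.derivWeierstrassP x ≠ 0 := by
  have hx' := notMem_of_two_mul_notMem L hx
  rw [derivWeierstrassP_eq L hx']
  exact div_ne_zero (neg_ne_zero.2 (wSigma_ne_zero L hx)) (pow_ne_zero _ (wSigma_ne_zero L hx'))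

lemma countable_preimage_lattice {f : ℂ → ℂ} (hf : Function.Injective f) :
    {x | f x ∈ L.lattice}.Countable :=
  (countable_lattice L).preimage hf

/-- Differentiate the cubic equation for ℘'² and cancel 2℘'. This is allowed off the half-periods, a
countable set that continuity fills in. -/
lemma hasDerivAt_derivWeierstrassP {x : ℂ} (hx : x ∉ L.lattice) :
    HasDerivAt L.derivWeierstrassP (6 * L.weierstrassP x ^ 2 - L.g₂ / 2) x := by
  have hO := isOpen_compl_lattice L
  have hd := L.differentiableOn_derivWeierstrassP
  have heq : EqOn (deriv L.derivWeierstrassP) (fun x => 6 * L.weierstrassP x ^ 2 - L.g₂ / 2)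
      (L.lattice : Set ℂ)ᶜ := by
    refine eqOn_of_eqOn_diff_countable hO
      (countable_preimage_lattice L (mul_right_injective₀ (two_ne_zero (α := ℂ)))) ?_ ?_ ?_
    · exact (hd.deriv hO).continuousOn
    · have := L.differentiableOn_weierstrassP.continuousOn
      fun_prop
    · rintro y ⟨hy, hy2⟩
      have h1 := (hd.differentiableAt (hO.mem_nhds hy)).hasDerivAt
      have hP := hasDerivAt_weierstrassP L hy
      have h3 : HasDerivAt (fun z => L.derivWeierstrassP z ^ 2)
          (12 * L.weierstrassP y ^ 2 * L.derivWeierstrassP y - L.g₂ * L.derivWeierstrassP y) y := by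
        have h4 : HasDerivAt (fun z => 4 * L.weierstrassP z ^ 3 - L.g₂ * L.weierstrassP z - L.g₃)
            (12 * L.weierstrassP y ^ 2 * L.derivWeierstrassP y - L.g₂ * L.derivWeierstrassP y) y := by
          refine ((((hP.pow 3).const_mul 4).sub (hP.const_mul L.g₂)).sub_const L.g₃).congr_deriv ?_
          simp
          ring
        refine h4.congr_of_eventuallyEq ?_
        filter_upwards [hO.mem_nhds hy] with z hz using L.derivWeierstrassP_sq z hz
      have h5 := (h1.pow 2).unique h3
      have h6 := derivWeierstrassP_ne_zero L (x := y) hy2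
      simp only [Nat.cast_ofNat, Nat.add_one_sub_one, pow_one] at h5
      refine mul_left_cancel₀ (mul_ne_zero two_ne_zero h6) ?_
      linear_combination h5
  have := (hd.differentiableAt (hO.mem_nhds hx)).hasDerivAt
  rwa [heq hx] at this

/-- `ζ(x + y) + ζ(x - y) = 2 ζ(x) + ℘'(x) / (℘(x) - ℘(y))` -/
lemma wZeta_add_add_sub {x y : ℂ} (hx : x ∉ L.lattice) (hy : y ∉ L.lattice)
    (hxy : x + y ∉ L.lattice) (hxy' : x - y ∉ L.lattice) :
    wZeta L (x + y) + wZeta L (x - y)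
      = 2 * wZeta L x + L.derivWeierstrassP x / (L.weierstrassP x - L.weierstrassP y) := by
  have hP : L.weierstrassP x - L.weierstrassP y ≠ 0 := by
    rw [sub_ne_zero, Ne, weierstrassP_eq_iff L hx hy]
    tauto
  -- The formula is the logarithmic derivative of `wSigma_mul` in x.
  have h1 := ((hasDerivAt_wSigma L hxy).comp_add_const x y).mul
    ((hasDerivAt_wSigma L hxy').comp_sub_const x y)
  have h2 := (((((hasDerivAt_wSigma L hx).pow 2).mul_const (wSigma L y ^ 2)).mul
    ((hasDerivAt_weierstrassP L hx).sub_const (L.weierstrassP y))).neg)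
  have h3 := h1.unique (h2.congr_of_eventuallyEq ?_)
  · have h4 := wSigma_mul L hx hy
    have hs : wSigma L x ^ 2 * wSigma L y ^ 2 ≠ 0 :=
      mul_ne_zero (pow_ne_zero _ (wSigma_ne_zero L hx)) (pow_ne_zero _ (wSigma_ne_zero L hy))
    simp only [Nat.cast_ofNat, Nat.add_one_sub_one, pow_one, Pi.pow_apply] at h3
    field_simp
    refine mul_left_cancel₀ hs ?_
    linear_combination -h3 + (wZeta L (x + y) + wZeta L (x - y)) * h4
  · filter_upwards [(isOpen_compl_lattice L).mem_nhds hx] with u hu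
    exact wSigma_mul L hu hy

/-- `ζ(x - y) = ζ(x) - ζ(y) + (℘'(x) + ℘'(y)) / (2 (℘(x) - ℘(y)))` -/
lemma wZeta_sub {x y : ℂ} (hx : x ∉ L.lattice) (hy : y ∉ L.lattice)
    (hxy : x + y ∉ L.lattice) (hxy' : x - y ∉ L.lattice) :
    wZeta L (x - y) = wZeta L x - wZeta L y
      + (L.derivWeierstrassP x + L.derivWeierstrassP y)
        / (L.weierstrassP x - L.weierstrassP y) / 2 := by
  have h1 := wZeta_add_add_sub L hx hy hxy hxy'
  -- Half the difference of the formula for (x, y) and the one for (y, x) isolates ζ(x-y), because ζ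
  -- is odd.
  have h2 := wZeta_add_add_sub L hy hx (by rwa [add_comm]) (by rw [← neg_sub]; exact neg_notMem L hxy')
  rw [add_comm y x, show y - x = -(x - y) by ring, wZeta_neg,
    ← neg_sub (L.weierstrassP x), div_neg] at h2
  rw [add_div]
  linear_combination h1 / 2 - h2 / 2

/-- `ζ(2x) = 2 ζ(x) + ℘''(x) / (2 ℘'(x))` -/
lemma wZeta_two_mul {x : ℂ} (hx : 2 * x ∉ L.lattice) :
    wZeta L (2 * x) = 2 * wZeta L x
      + (6 * L.weierstrassP x ^ 2 - L.g₂ / 2) / (2 * L.derivWeierstrassP x) := by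
  have hx' := notMem_of_two_mul_notMem L hx
  have h1 := hasDerivAt_derivWeierstrassP L hx'
  have hσ := wSigma_ne_zero L hx'
  have h2 : HasDerivAt (fun x => wSigma L (2 * x)) (wSigma L (2 * x) * wZeta L (2 * x) * (2 * 1)) x :=
    (hasDerivAt_wSigma L hx).comp x ((hasDerivAt_id x).const_mul 2)
  -- The duplication formula is the logarithmic derivative of ℘'(x) = -σ(2x)/σ(x)⁴.
  have h3 := h2.neg.div ((hasDerivAt_wSigma L hx').pow 4) (pow_ne_zero 4 hσ)
  have h4 := h1.unique (h3.congr_of_eventuallyEq ?_)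
  · rw [h4, derivWeierstrassP_eq L hx']
    have := wSigma_ne_zero L hx
    simp only [Pi.neg_apply, Pi.pow_apply, Nat.cast_ofNat, Nat.add_one_sub_one]
    field_simp
    ring
  · filter_upwards [(isOpen_compl_lattice L).mem_nhds hx'] with u hu
    exact derivWeierstrassP_eq L hu

/-- `℘(x - y) = ((℘'(x) + ℘'(y)) / (℘(x) - ℘(y)))² / 4 - ℘(x) - ℘(y)` -/
lemma weierstrassP_sub {x y : ℂ} (hx : x ∉ L.lattice) (hy : y ∉ L.lattice)
    (hxy : x + y ∉ L.lattice) (hxy' : x - y ∉ L.lattice) :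
    L.weierstrassP (x - y) = ((L.derivWeierstrassP x + L.derivWeierstrassP y)
        / (L.weierstrassP x - L.weierstrassP y)) ^ 2 / 4 - L.weierstrassP x - L.weierstrassP y := by
  have hP : L.weierstrassP x - L.weierstrassP y ≠ 0 := by
    rw [sub_ne_zero, Ne, weierstrassP_eq_iff L hx hy]
    tauto
  -- Differentiate `wZeta_sub` in x; the two cubic equations then remove the squares of ℘'(x) and
  -- ℘'(y).
  have h1 := (hasDerivAt_wZeta L hxy').comp_sub_const x y
  have h2 := ((hasDerivAt_wZeta L hx).sub_const (wZeta L y)).add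
    ((((hasDerivAt_derivWeierstrassP L hx).add_const (L.derivWeierstrassP y)).div
      ((hasDerivAt_weierstrassP L hx).sub_const (L.weierstrassP y)) hP).div_const 2)
  have h3 := h1.unique (h2.congr_of_eventuallyEq ?_)
  · have e1 := L.derivWeierstrassP_sq x hx
    have e2 := L.derivWeierstrassP_sq y hy
    rw [neg_eq_iff_eq_neg] at h3
    rw [h3]
    field_simp
    linear_combination 4 * e1 - 4 * e2
  · have o1 : ∀ᶠ u in 𝓝 x, u + y ∉ L.lattice :=
      ((continuous_id.add continuous_const).continuousAt (x := x)).eventually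
        ((isOpen_compl_lattice L).mem_nhds hxy)
    have o2 : ∀ᶠ u in 𝓝 x, u - y ∉ L.lattice :=
      ((continuous_id.sub continuous_const).continuousAt (x := x)).eventually
        ((isOpen_compl_lattice L).mem_nhds hxy')
    filter_upwards [(isOpen_compl_lattice L).mem_nhds hx, o1, o2] with u hu hu1 hu2
    exact wZeta_sub L hu hy hu1 hu2

end EllipticFuchs

namespace EllipticFuchs

open Filter Topology

variable (L : PeriodPair)

/-! ### Half-periods -/

lemma two_mul_halfPeriod_mem (i : Fin 4) : 2 * halfPeriod L i ∈ L.lattice := by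
  rw [PeriodPair.mem_lattice]
  fin_cases i
  · exact ⟨0, 0, by simp [halfPeriod]⟩
  · exact ⟨1, 0, by simp [halfPeriod]; ring⟩
  · exact ⟨-1, -1, by simp [halfPeriod]; ring⟩
  · exact ⟨0, 1, by simp [halfPeriod]; ring⟩

lemma half_combination_notMem {m n : ℤ} (h : ¬ (Even m ∧ Even n)) :
    (m : ℂ) * (L.ω₁ / 2) + n * (L.ω₂ / 2) ∉ L.lattice := by
  intro hmem
  obtain ⟨a, b, hab⟩ := PeriodPair.mem_lattice.1 hmem
  have h1 := LinearIndependent.pair_iff.1 L.indep ((a : ℝ) - m / 2) ((b : ℝ) - n / 2) (by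
    simp only [Complex.real_smul]
    push_cast
    linear_combination hab)
  refine h ⟨⟨a, ?_⟩, ⟨b, ?_⟩⟩
  · have : (m : ℝ) = a + a := by linarith [h1.1]
    exact_mod_cast this
  · have : (n : ℝ) = b + b := by linarith [h1.2]
    exact_mod_cast this

lemma halfPeriod_notMem {i : Fin 4} (hi : i ≠ 0) : halfPeriod L i ∉ L.lattice := by
  fin_cases i
  · exact absurd rfl hi
  · simpa [halfPeriod] using half_combination_notMem L (m := 1) (n := 0) (by simp)
  · have e : halfPeriod L 2 = ((-1 : ℤ) : ℂ) * (L.ω₁ / 2) + ((-1 : ℤ) : ℂ) * (L.ω₂ / 2) := by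
      simp only [halfPeriod, Matrix.cons_val]
      push_cast
      ring
    exact e ▸ half_combination_notMem L (by simp)
  · simpa [halfPeriod] using half_combination_notMem L (m := 0) (n := 1) (by simp)

/-- Equal values would put ω_i + ω_j or ω_i - ω_j in Λ. These conditions are equivalent since 2ω_j ∈
Λ, and each sum has an odd coordinate in the half-period basis. -/
lemma eVal_ne : eVal L 2 ≠ eVal L 1 ∧ eVal L 3 ≠ eVal L 1 ∧ eVal L 3 ≠ eVal L 2 := by
  have aux : ∀ i j : Fin 4, i ≠ 0 → j ≠ 0 → halfPeriod L i + halfPeriod L j ∉ L.lattice →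
      eVal L i ≠ eVal L j := by
    intro i j hi hj h heq
    rcases (weierstrassP_eq_iff L (halfPeriod_notMem L hi) (halfPeriod_notMem L hj)).1 heq with h1 | h1
    · exact h h1
    · refine h ?_
      have := add_mem h1 (two_mul_halfPeriod_mem L j)
      convert this using 1
      ring
  refine ⟨aux 2 1 (by decide) (by decide) ?_, aux 3 1 (by decide) (by decide) ?_,
    aux 3 2 (by decide) (by decide) ?_⟩
  · have e : halfPeriod L 2 + halfPeriod L 1
        = ((0 : ℤ) : ℂ) * (L.ω₁ / 2) + ((-1 : ℤ) : ℂ) * (L.ω₂ / 2) := by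
      simp only [halfPeriod, Matrix.cons_val]
      push_cast
      ring
    exact e ▸ half_combination_notMem L (by simp)
  · have e : halfPeriod L 3 + halfPeriod L 1
        = ((1 : ℤ) : ℂ) * (L.ω₁ / 2) + ((1 : ℤ) : ℂ) * (L.ω₂ / 2) := by
      simp only [halfPeriod, Matrix.cons_val]
      push_cast
      ring
    exact e ▸ half_combination_notMem L (by simp)
  · have e : halfPeriod L 3 + halfPeriod L 2
        = ((-1 : ℤ) : ℂ) * (L.ω₁ / 2) + ((0 : ℤ) : ℂ) * (L.ω₂ / 2) := by
      simp only [halfPeriod, Matrix.cons_val]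
      push_cast
      ring
    exact e ▸ half_combination_notMem L (by simp)

lemma derivWeierstrassP_eq_zero_of_two_mul_mem {x : ℂ} (hx : 2 * x ∈ L.lattice) :
    L.derivWeierstrassP x = 0 := by
  have h1 := L.derivWeierstrassP_add_coe (-x) ⟨2 * x, hx⟩
  rw [show -x + ((⟨2 * x, hx⟩ : L.lattice) : ℂ) = x by simp; ring, L.derivWeierstrassP_neg] at h1
  linear_combination h1 / 2

/-- The invariants in terms of `e₁, e₂, e₃`. -/
lemma invariants_eq : eVal L 1 + eVal L 2 + eVal L 3 = 0 ∧
    L.g₂ = -4 * (eVal L 1 * eVal L 2 + eVal L 1 * eVal L 3 + eVal L 2 * eVal L 3) ∧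
    L.g₃ = 4 * (eVal L 1 * eVal L 2 * eVal L 3) := by
  have root : ∀ i : Fin 4, i ≠ 0 → 4 * eVal L i ^ 3 - L.g₂ * eVal L i - L.g₃ = 0 := by
    intro i hi
    have := L.derivWeierstrassP_sq _ (halfPeriod_notMem L hi)
    rw [derivWeierstrassP_eq_zero_of_two_mul_mem L (two_mul_halfPeriod_mem L i)] at this
    rw [eVal, ← this]
    ring
  have r1 := root 1 (by decide)
  have r2 := root 2 (by decide)
  have r3 := root 3 (by decide)
  obtain ⟨h21, h31, h32⟩ := eVal_ne L
  -- Divided differences of the cubic at its three distinct roots yield Vieta's formulas.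
  have q1 : 4 * (eVal L 2 ^ 2 + eVal L 2 * eVal L 1 + eVal L 1 ^ 2) - L.g₂ = 0 := by
    refine mul_left_cancel₀ (sub_ne_zero.2 h21) ?_
    linear_combination r2 - r1
  have q2 : 4 * (eVal L 3 ^ 2 + eVal L 3 * eVal L 1 + eVal L 1 ^ 2) - L.g₂ = 0 := by
    refine mul_left_cancel₀ (sub_ne_zero.2 h31) ?_
    linear_combination r3 - r1
  have s : eVal L 1 + eVal L 2 + eVal L 3 = 0 := by
    refine mul_left_cancel₀ (sub_ne_zero.2 h32) ?_
    linear_combination (q2 - q1) / 4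
  refine ⟨s, ?_, ?_⟩
  · linear_combination -q1 + 4 * (eVal L 1 + eVal L 2) * s
  · linear_combination -r1 + eVal L 1 * q1 - 4 * eVal L 1 * eVal L 2 * s

lemma derivWeierstrassP_sq_eq_prod {x : ℂ} (hx : x ∉ L.lattice) :
    L.derivWeierstrassP x ^ 2 = 4 * (L.weierstrassP x - eVal L 1) * (L.weierstrassP x - eVal L 2)
      * (L.weierstrassP x - eVal L 3) := by
  obtain ⟨s, h2, h3⟩ := invariants_eq L
  rw [L.derivWeierstrassP_sq x hx, h2, h3]
  linear_combination 4 * L.weierstrassP x ^ 2 * s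

lemma weierstrassP_ne_eVal {x : ℂ} (hx : 2 * x ∉ L.lattice) :
    L.weierstrassP x ≠ eVal L 1 ∧ L.weierstrassP x ≠ eVal L 2 ∧ L.weierstrassP x ≠ eVal L 3 := by
  have h := derivWeierstrassP_ne_zero L hx
  have h2 := derivWeierstrassP_sq_eq_prod L (notMem_of_two_mul_notMem L hx)
  have h3 := pow_ne_zero 2 h
  rw [h2] at h3
  refine ⟨?_, ?_, ?_⟩ <;> intro h4 <;> simp [h4] at h3

/-! ### The kernel and its differential equations -/

/-- The factor of the kernel that depends on `ξ` only. -/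
noncomputable def phi (al ka xi : ℂ) : ℂ := Complex.exp ((ka + wZeta L al) * xi) * wSigma L (xi - al)

/-- The factor of the kernel of `g_i` that depends on `ξ` only, holomorphic off the lattice. -/
noncomputable def gam (al ka xi : ℂ) : ℂ :=
  deriv (deriv (phi L al ka)) xi - 2 * wZeta L xi * deriv (phi L al ka) xi
    + (L.weierstrassP xi + wZeta L xi ^ 2) * phi L al ka xi

/-- The logarithmic derivative in `x` of `σ(x) / √(σ(x-ξ)σ(x+ξ))`. -/
noncomputable def lgx (x xi : ℂ) : ℂ := wZeta L x - wZeta L (x - xi) / 2 - wZeta L (x + xi) / 2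

/-- The logarithmic derivative in `ξ` of `σ(x) / √(σ(x-ξ)σ(x+ξ))`. -/
noncomputable def lgxi (x xi : ℂ) : ℂ := wZeta L (x - xi) / 2 - wZeta L (x + xi) / 2

lemma differentiable_phi (al ka : ℂ) : Differentiable ℂ (phi L al ka) := by
  have := differentiable_wSigma L
  unfold phi
  fun_prop

lemma differentiable_deriv {f : ℂ → ℂ} (hf : Differentiable ℂ f) : Differentiable ℂ (deriv f) := by
  rw [← differentiableOn_univ] at hf ⊢
  exact hf.deriv isOpen_univ

lemma differentiable_deriv_phi (al ka : ℂ) : Differentiable ℂ (deriv (phi L al ka)) :=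
  differentiable_deriv (differentiable_phi L al ka)

lemma differentiable_deriv_deriv_phi (al ka : ℂ) :
    Differentiable ℂ (deriv (deriv (phi L al ka))) :=
  differentiable_deriv (differentiable_deriv_phi L al ka)

lemma hasDerivAt_phi {al xi : ℂ} (ka : ℂ) (h : xi - al ∉ L.lattice) :
    HasDerivAt (phi L al ka) ((ka + wZeta L al + wZeta L (xi - al)) * phi L al ka xi) xi := by
  have h1 : HasDerivAt (fun x => Complex.exp ((ka + wZeta L al) * x))
    (Complex.exp ((ka + wZeta L al) * xi) * ((ka + wZeta L al) * 1)) xi :=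
    ((hasDerivAt_id xi).const_mul (ka + wZeta L al)).cexp
  refine HasDerivAt.congr_deriv (f := phi L al ka)
    (h1.mul ((hasDerivAt_wSigma L h).comp_sub_const xi al)) ?_
  rw [phi]
  ring

lemma eventually_sub_notMem {xi al : ℂ} (h : xi - al ∉ L.lattice) :
    ∀ᶠ y in 𝓝 xi, y - al ∉ L.lattice :=
  ((continuous_id.sub continuous_const).continuousAt (x := xi)).eventually
    ((isOpen_compl_lattice L).mem_nhds h)

lemma deriv_phi {al xi : ℂ} (ka : ℂ) (h : xi - al ∉ L.lattice) :
    deriv (phi L al ka) xi = (ka + wZeta L al + wZeta L (xi - al)) * phi L al ka xi :=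
  (hasDerivAt_phi L ka h).deriv

lemma deriv_deriv_phi {al xi : ℂ} (ka : ℂ) (h : xi - al ∉ L.lattice) :
    deriv (deriv (phi L al ka)) xi
      = ((ka + wZeta L al + wZeta L (xi - al)) ^ 2 - L.weierstrassP (xi - al)) * phi L al ka xi := by
  have h1 := (((hasDerivAt_wZeta L h).comp_sub_const xi al).const_add (ka + wZeta L al)).mul
    (hasDerivAt_phi L ka h)
  have h2 : deriv (phi L al ka) =ᶠ[𝓝 xi]
      ((fun y => ka + wZeta L al + wZeta L (y - al)) * phi L al ka) := by
    filter_upwards [eventually_sub_notMem L h] with y hy using deriv_phi L ka hy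
  rw [h2.deriv_eq, h1.deriv]
  ring

lemma continuousOn_wZeta : ContinuousOn (wZeta L) (L.lattice : Set ℂ)ᶜ := fun _ hx =>
  (hasDerivAt_wZeta L hx).continuousAt.continuousWithinAt

lemma lgx_eq {x xi : ℂ} (hx : x ∉ L.lattice) (hxi : xi ∉ L.lattice) (h1 : x - xi ∉ L.lattice)
    (h2 : x + xi ∉ L.lattice) :
    lgx L x xi = L.derivWeierstrassP x / (L.weierstrassP xi - L.weierstrassP x) / 2 := by
  have := wZeta_add_add_sub L hx hxi h2 h1
  rw [lgx, ← neg_sub (L.weierstrassP x), div_neg]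
  linear_combination -this / 2

lemma lgxi_eq {x xi : ℂ} (hx : x ∉ L.lattice) (hxi : xi ∉ L.lattice) (h1 : x - xi ∉ L.lattice)
    (h2 : x + xi ∉ L.lattice) :
    lgxi L x xi = -wZeta L xi
      - L.derivWeierstrassP xi / (L.weierstrassP xi - L.weierstrassP x) / 2 := by
  have := wZeta_add_add_sub L hxi hx (by rwa [add_comm]) (by rw [← neg_sub]; exact neg_notMem L h1)
  rw [add_comm xi x, ← neg_sub x xi, wZeta_neg] at this
  rw [lgxi]
  linear_combination -this / 2

lemma isOpen_avoid (x : ℂ) : IsOpen {xi : ℂ | x - xi ∉ L.lattice ∧ x + xi ∉ L.lattice} :=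
  ((isOpen_compl_lattice L).preimage (continuous_const.sub continuous_id)).inter
    ((isOpen_compl_lattice L).preimage (continuous_const.add continuous_id))

lemma countable_exceptional (al : ℂ) :
    {xi : ℂ | xi ∈ L.lattice ∨ xi - al ∈ L.lattice ∨ xi + al ∈ L.lattice}.Countable :=
  (countable_lattice L).union
    ((countable_preimage_lattice L (f := fun xi => xi - al) (sub_left_injective)).union
      (countable_preimage_lattice L (f := fun xi => xi + al) (add_left_injective al)))

lemma continuousOn_lgx (x : ℂ) :
    ContinuousOn (lgx L x) {xi : ℂ | x - xi ∉ L.lattice ∧ x + xi ∉ L.lattice} := by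
  have h1 : ContinuousOn (fun xi => wZeta L (x - xi))
      {xi : ℂ | x - xi ∉ L.lattice ∧ x + xi ∉ L.lattice} :=
    (continuousOn_wZeta L).comp (by fun_prop) fun xi h => h.1
  have h2 : ContinuousOn (fun xi => wZeta L (x + xi))
      {xi : ℂ | x - xi ∉ L.lattice ∧ x + xi ∉ L.lattice} :=
    (continuousOn_wZeta L).comp (by fun_prop) fun xi h => h.2
  unfold lgx
  fun_prop

lemma continuousOn_lgxi (x : ℂ) :
    ContinuousOn (lgxi L x) {xi : ℂ | x - xi ∉ L.lattice ∧ x + xi ∉ L.lattice} := by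
  have h1 : ContinuousOn (fun xi => wZeta L (x - xi))
      {xi : ℂ | x - xi ∉ L.lattice ∧ x + xi ∉ L.lattice} :=
    (continuousOn_wZeta L).comp (by fun_prop) fun xi h => h.1
  have h2 : ContinuousOn (fun xi => wZeta L (x + xi))
      {xi : ℂ | x - xi ∉ L.lattice ∧ x + xi ∉ L.lattice} :=
    (continuousOn_wZeta L).comp (by fun_prop) fun xi h => h.2
  unfold lgxi
  fun_prop

/-- The coefficient of `dy/dx` in the equation for `f_i`. -/
noncomputable def coeffP (al x : ℂ) : ℂ :=
  (6 * L.weierstrassP x ^ 2 - L.g₂ / 2) / L.derivWeierstrassP x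
    - L.derivWeierstrassP x / (L.weierstrassP x - L.weierstrassP al)

/-- The coefficient of `y` in the equation for `f_i`. -/
noncomputable def coeffQ (al ka x : ℂ) : ℂ :=
  -ka ^ 2 - L.derivWeierstrassP al / (L.weierstrassP x - L.weierstrassP al) * ka
    + L.weierstrassP x - L.weierstrassP al

/-- The coefficient of `∂Φ/∂ξ` in the partial differential equation of the kernel. -/
noncomputable def coeffT (al ka x : ℂ) : ℂ :=
  -2 * ka - L.derivWeierstrassP al / (L.weierstrassP x - L.weierstrassP al)

lemma weierstrassP_sub_ne_zero {x y : ℂ} (hx : x ∉ L.lattice) (hy : y ∉ L.lattice)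
    (h1 : x + y ∉ L.lattice) (h2 : x - y ∉ L.lattice) :
    L.weierstrassP x - L.weierstrassP y ≠ 0 := by
  rw [sub_ne_zero, Ne, weierstrassP_eq_iff L hx hy]
  tauto

/-- The algebraic content of `kernel_pde`: P, A, Q stand for ℘ at x, α, ξ, and P', A', Q' for ℘'
there. -/
lemma elliptic_identity {P P' A A' Q Q' ka g2 g3 : ℂ} (hP : P' ^ 2 = 4 * P ^ 3 - g2 * P - g3)
    (hA : A' ^ 2 = 4 * A ^ 3 - g2 * A - g3) (hQ : Q' ^ 2 = 4 * Q ^ 3 - g2 * Q - g3)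
    (hPA : P - A ≠ 0) (hQA : Q - A ≠ 0) (hQP : Q - P ≠ 0) (hP' : P' ≠ 0) :
    (P' / (Q - P) / 2) ^ 2 - (ka + (Q' + A') / (Q - A) / 2 - Q' / (Q - P) / 2) ^ 2
      + (((Q' + A') / (Q - A)) ^ 2 / 4 - Q - A)
      + ((6 * P ^ 2 - g2 / 2) / P' - P' / (P - A)) * (P' / (Q - P) / 2)
      - (-2 * ka - A' / (P - A)) * (ka + (Q' + A') / (Q - A) / 2 - Q' / (Q - P) / 2)
      + (-ka ^ 2 - A' / (P - A) * ka + P - A) - P = 0 := by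
  -- All terms in κ and all mixed products of derivatives cancel. In the form reached here P', A',
  -- Q' occur only squared, so the cubic equations can be substituted.
  have h1 : (P' / (Q - P) / 2) ^ 2 - (ka + (Q' + A') / (Q - A) / 2 - Q' / (Q - P) / 2) ^ 2
      + (((Q' + A') / (Q - A)) ^ 2 / 4 - Q - A)
      + ((6 * P ^ 2 - g2 / 2) / P' - P' / (P - A)) * (P' / (Q - P) / 2)
      - (-2 * ka - A' / (P - A)) * (ka + (Q' + A') / (Q - A) / 2 - Q' / (Q - P) / 2)
      + (-ka ^ 2 - A' / (P - A) * ka + P - A) - P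
      = (P' ^ 2 - Q' ^ 2) / (4 * (Q - P) ^ 2) + Q' ^ 2 / (2 * (Q - A) * (Q - P)) - Q - 2 * A
        + (6 * P ^ 2 - g2 / 2) / (2 * (Q - P)) - P' ^ 2 / (2 * (P - A) * (Q - P))
        + A' ^ 2 / (2 * (Q - A) * (P - A)) := by
    field_simp
    ring
  rw [h1, hP, hA, hQ]
  field_simp
  ring

/-- The partial differential equation of the kernel, divided by `σ(x) / √(σ(x-ξ)σ(x+ξ))`. -/
lemma kernel_pde {al ka x xi : ℂ} (hal : 2 * al ∉ L.lattice) (hx : 2 * x ∉ L.lattice)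
    (hxal : L.weierstrassP x ≠ L.weierstrassP al)
    (h1 : x - xi ∉ L.lattice) (h2 : x + xi ∉ L.lattice) :
    (lgx L x xi ^ 2 - lgxi L x xi ^ 2 - L.weierstrassP x + coeffP L al x * lgx L x xi
        + coeffQ L al ka x - coeffT L al ka x * lgxi L x xi) * phi L al ka xi
      = deriv (deriv (phi L al ka)) xi
        + (2 * lgxi L x xi + coeffT L al ka x) * deriv (phi L al ka) xi := by
  have cx := continuousOn_lgx L x
  have cxi := continuousOn_lgxi L x
  have c0 := (differentiable_phi L al ka).continuous
  have c1 := (differentiable_deriv_phi L al ka).continuous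
  have c2 := (differentiable_deriv_deriv_phi L al ka).continuous
  -- The addition formulas fail for ξ in Λ or in ±α + Λ. Both sides are continuous there, as φ is
  -- entire, so it is enough to exclude this countable set.
  refine eqOn_of_eqOn_diff_countable (isOpen_avoid L x) (countable_exceptional L al)
    (f := fun xi => (lgx L x xi ^ 2 - lgxi L x xi ^ 2 - L.weierstrassP x
        + coeffP L al x * lgx L x xi
        + coeffQ L al ka x - coeffT L al ka x * lgxi L x xi) * phi L al ka xi)
    (g := fun xi => deriv (deriv (phi L al ka)) xi
        + (2 * lgxi L x xi + coeffT L al ka x) * deriv (phi L al ka) xi)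
    (by fun_prop) (by fun_prop) ?_ ⟨h1, h2⟩
  rintro y ⟨⟨hy1, hy2⟩, hy3⟩
  simp only [mem_ofPred_eq, not_or] at hy3
  obtain ⟨hy0, hya, hya'⟩ := hy3
  have hx' := notMem_of_two_mul_notMem L hx
  have hal' := notMem_of_two_mul_notMem L hal
  have hid := elliptic_identity (ka := ka) (L.derivWeierstrassP_sq x hx')
    (L.derivWeierstrassP_sq al hal') (L.derivWeierstrassP_sq y hy0) (sub_ne_zero.2 hxal)
    (weierstrassP_sub_ne_zero L hy0 hal' hya' hya)
    (weierstrassP_sub_ne_zero L hy0 hx' (by rwa [add_comm])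
      (by rw [← neg_sub]; exact neg_notMem L hy1))
    (derivWeierstrassP_ne_zero L hx)
  have e1 := wZeta_sub L hy0 hal' hya' hya
  have e2 := weierstrassP_sub L hy0 hal' hya' hya
  simp only []
  rw [deriv_deriv_phi L ka hya, deriv_phi L ka hya, e1, e2, lgx_eq L hx' hy0 hy1 hy2,
    lgxi_eq L hx' hy0 hy1 hy2, coeffP, coeffQ, coeffT]
  linear_combination phi L al ka y * hid

/-- With ψ = φ/σ, the logarithmic derivative of ψ is κ + R/2, where R = (℘'(ξ)+℘'(α))/(℘(ξ)-℘(α)).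
Hence ψ''/ψ = (κ+R/2)² + ℘(ξ) - ℘(ξ-α); the addition formula cancels R²/4 and leaves the weight,
while σψ'' is `gam`. -/
lemma gWeight_mul_phi {al xi : ℂ} (ka : ℂ) (hal : 2 * al ∉ L.lattice) (h0 : xi ∉ L.lattice)
    (h1 : xi - al ∉ L.lattice) (h2 : xi + al ∉ L.lattice) :
    gWeight L al ka xi * phi L al ka xi = gam L al ka xi := by
  have hal' := notMem_of_two_mul_notMem L hal
  rw [gam, deriv_deriv_phi L ka h1, deriv_phi L ka h1, wZeta_sub L h0 hal' h2 h1,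
    weierstrassP_sub L h0 hal' h2 h1, gWeight]
  ring

/-- The function of `ξ` whose product with `σ(x) / √(σ(x-ξ)σ(x+ξ))` is a primitive in the
first-order relation between the two kernels. -/
noncomputable def prim (al ka x xi : ℂ) : ℂ :=
  2 * (L.weierstrassP xi - L.weierstrassP x)
      * (deriv (phi L al ka) xi - ka * phi L al ka xi - wZeta L xi * phi L al ka xi)
    - L.derivWeierstrassP xi * phi L al ka xi

/-- The derivative of `prim` in `ξ`. -/
noncomputable def primDeriv (al ka x xi : ℂ) : ℂ :=
  2 * L.derivWeierstrassP xi
      * (deriv (phi L al ka) xi - ka * phi L al ka xi - wZeta L xi * phi L al ka xi)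
    + 2 * (L.weierstrassP xi - L.weierstrassP x)
      * (deriv (deriv (phi L al ka)) xi - ka * deriv (phi L al ka) xi
        + L.weierstrassP xi * phi L al ka xi - wZeta L xi * deriv (phi L al ka) xi)
    - (6 * L.weierstrassP xi ^ 2 - L.g₂ / 2) * phi L al ka xi
    - L.derivWeierstrassP xi * deriv (phi L al ka) xi

lemma hasDerivAt_prim {xi : ℂ} (al ka x : ℂ) (h : xi ∉ L.lattice) :
    HasDerivAt (prim L al ka x) (primDeriv L al ka x xi) xi := by
  have d0 := (differentiable_phi L al ka xi).hasDerivAt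
  have d1 := (differentiable_deriv_phi L al ka xi).hasDerivAt
  have hP := hasDerivAt_weierstrassP L h
  have h1 := ((hP.sub_const (L.weierstrassP x)).const_mul 2).mul
    ((d1.sub (d0.const_mul ka)).sub ((hasDerivAt_wZeta L h).mul d0))
  have h2 := h1.sub ((hasDerivAt_derivWeierstrassP L h).mul d0)
  refine HasDerivAt.congr_deriv (f := prim L al ka x) h2 ?_
  rw [primDeriv]
  simp only [Pi.mul_apply, Pi.sub_apply]
  ring

lemma elliptic_identity_first {P P' A A' Q Q' ka g2 g3 : ℂ}
    (hP : P' ^ 2 = 4 * P ^ 3 - g2 * P - g3)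
    (hQ : Q' ^ 2 = 4 * Q ^ 3 - g2 * Q - g3) (hQA : Q - A ≠ 0) (hQP : Q - P ≠ 0) :
    P' * (P' / (Q - P) / 2) - (P - A) * (ka * ((Q' + A') / (Q - A)) + 2 * Q - 2 * P) + ka * A'
      = ka * ((Q - P) * ((Q' + A') / (Q - A)) - Q') + 2 * (Q - P) * (2 * Q + A)
        - (6 * Q ^ 2 - g2 / 2) + Q' * (Q' / (Q - P) / 2) := by
  have h1 : P' * (P' / (Q - P) / 2) = P' ^ 2 / (Q - P) / 2 := by ring
  have h2 : Q' * (Q' / (Q - P) / 2) = Q' ^ 2 / (Q - P) / 2 := by ring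
  rw [h1, h2, hP, hQ]
  field_simp
  ring

/-- The first-order relation between the two kernels, divided by
`σ(x) / √(σ(x-ξ)σ(x+ξ))`. -/
lemma kernel_first_order {al ka x xi : ℂ} (hal : 2 * al ∉ L.lattice) (hx : x ∉ L.lattice)
    (h0 : xi ∉ L.lattice) (h1 : x - xi ∉ L.lattice) (h2 : x + xi ∉ L.lattice) :
    L.derivWeierstrassP x * lgx L x xi * phi L al ka xi
        - (L.weierstrassP x - L.weierstrassP al) * (gam L al ka xi
          - (ka ^ 2 + L.weierstrassP al + 2 * L.weierstrassP x) * phi L al ka xi)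
        + ka * L.derivWeierstrassP al * phi L al ka xi
      = primDeriv L al ka x xi + lgxi L x xi * prim L al ka x xi := by
  have hal' := notMem_of_two_mul_notMem L hal
  set O : Set ℂ := {xi | x - xi ∉ L.lattice ∧ x + xi ∉ L.lattice} ∩ (L.lattice : Set ℂ)ᶜ
  have cx : ContinuousOn (lgx L x) O := (continuousOn_lgx L x).mono inter_subset_left
  have cxi : ContinuousOn (lgxi L x) O := (continuousOn_lgxi L x).mono inter_subset_left
  have cz : ContinuousOn (wZeta L) O := (continuousOn_wZeta L).mono inter_subset_right
  have cP : ContinuousOn L.weierstrassP O :=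
    L.differentiableOn_weierstrassP.continuousOn.mono inter_subset_right
  have cP' : ContinuousOn L.derivWeierstrassP O :=
    L.differentiableOn_derivWeierstrassP.continuousOn.mono inter_subset_right
  have c0 := (differentiable_phi L al ka).continuous
  have c1 := (differentiable_deriv_phi L al ka).continuous
  have c2 := (differentiable_deriv_deriv_phi L al ka).continuous
  refine eqOn_of_eqOn_diff_countable (O := O) ((isOpen_avoid L x).inter (isOpen_compl_lattice L))
    (countable_exceptional L al)
    (f := fun xi => L.derivWeierstrassP x * lgx L x xi * phi L al ka xi
        - (L.weierstrassP x - L.weierstrassP al) * (gam L al ka xi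
          - (ka ^ 2 + L.weierstrassP al + 2 * L.weierstrassP x) * phi L al ka xi)
        + ka * L.derivWeierstrassP al * phi L al ka xi)
    (g := fun xi => primDeriv L al ka x xi + lgxi L x xi * prim L al ka x xi)
    (by unfold gam; fun_prop) (by unfold prim primDeriv; fun_prop) ?_ ⟨⟨h1, h2⟩, h0⟩
  rintro y ⟨⟨⟨hy1, hy2⟩, hy0⟩, hy3⟩
  simp only [mem_ofPred_eq, not_or] at hy3
  obtain ⟨-, hya, hya'⟩ := hy3
  have hid := elliptic_identity_first (ka := ka) (A' := L.derivWeierstrassP al)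
    (L.derivWeierstrassP_sq x hx) (L.derivWeierstrassP_sq y hy0)
    (weierstrassP_sub_ne_zero L hy0 hal' hya' hya)
    (weierstrassP_sub_ne_zero L hy0 hx (by rwa [add_comm])
      (by rw [← neg_sub]; exact neg_notMem L hy1))
  have e1 := wZeta_sub L hy0 hal' hya' hya
  have e2 := weierstrassP_sub L hy0 hal' hya' hya
  simp only []
  rw [← gWeight_mul_phi L ka hal hy0 hya hya', primDeriv, prim, gWeight,
    deriv_deriv_phi L ka hya, deriv_phi L ka hya, e1, e2, lgx_eq L hx hy0 hy1 hy2,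
    lgxi_eq L hx hy0 hy1 hy2]
  have hQP := weierstrassP_sub_ne_zero L hy0 hx (by rwa [add_comm])
      (by rw [← neg_sub]; exact neg_notMem L hy1)
  -- The factor ℘(ξ)-℘(x) of `prim` meets the denominator of `lgxi`.
  have h3 : (L.weierstrassP y - L.weierstrassP x)
      * (L.derivWeierstrassP y / (L.weierstrassP y - L.weierstrassP x) / 2)
      = L.derivWeierstrassP y / 2 := by field_simp
  linear_combination phi L al ka y * hid + phi L al ka y * ((L.derivWeierstrassP y
    + L.derivWeierstrassP al) / (L.weierstrassP y - L.weierstrassP al)) * h3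

end EllipticFuchs

namespace EllipticFuchs

open Filter Topology MeasureTheory

/-! ### Holomorphic dependence of integrals on a parameter -/

/-- An integrand on `(0, 1)` that depends holomorphically on a parameter, with locally uniform
integrable bounds. -/
structure IsParamIntegrand (U : Set ℂ) (F : ℂ → ℝ → ℂ) : Prop where
  diff : ∀ s ∈ Ioo (0 : ℝ) 1, DifferentiableOn ℂ (fun x => F x s) U
  meas : ∀ x ∈ U, AEStronglyMeasurable (F x) (volume.restrict (Ioo (0 : ℝ) 1))
  bound : ∀ x₀ ∈ U, ∃ r > 0, Metric.ball x₀ r ⊆ U ∧ ∃ B : ℝ → ℝ, IntegrableOn B (Ioo (0 : ℝ) 1) ∧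
    ∀ x ∈ Metric.ball x₀ r, ∀ s ∈ Ioo (0 : ℝ) 1, ‖F x s‖ ≤ B s

namespace IsParamIntegrand

variable {U : Set ℂ} {F : ℂ → ℝ → ℂ}

lemma integrableOn (h : IsParamIntegrand U F) {x : ℂ} (hx : x ∈ U) :
    IntegrableOn (F x) (Ioo (0 : ℝ) 1) := by
  obtain ⟨r, hr, -, B, hB, hle⟩ := h.bound x hx
  refine Integrable.mono' hB (h.meas x hx) ?_
  filter_upwards [ae_restrict_mem measurableSet_Ioo] with s hs
  exact hle x (Metric.mem_ball_self hr) s hs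

lemma intervalIntegrable (h : IsParamIntegrand U F) {x : ℂ} (hx : x ∈ U) :
    IntervalIntegrable (F x) volume 0 1 := by
  rw [intervalIntegrable_iff_integrableOn_Ioo_of_le zero_le_one]
  exact h.integrableOn hx

/-- The x-derivative is again an admissible integrand, so it can be differentiated under the
integral a second time: measurability passes to the limit of difference quotients, and Cauchy's
estimate on circles of radius r/4 gives the bound. -/
lemma deriv (hU : IsOpen U) (h : IsParamIntegrand U F) :
    IsParamIntegrand U fun x s => deriv (fun y => F y s) x where
  diff s hs := (h.diff s hs).deriv hU
  meas x hx := by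
    obtain ⟨r, hr, hsub, -⟩ := h.bound x hx
    let u : ℕ → ℂ := fun n => (r / 2 : ℂ) * (1 / ((n : ℂ) + 1))
    have hn : ∀ n : ℕ, ((n : ℂ) + 1) ≠ 0 := fun n => Nat.cast_add_one_ne_zero n
    have hu0 : ∀ n, u n ≠ 0 := fun n => by
      have : (r : ℂ) ≠ 0 := by exact_mod_cast hr.ne'
      simp [u, this, hn]
    have hul : Tendsto u atTop (𝓝 0) := by
      have : Tendsto (fun n : ℕ => 1 / ((n : ℂ) + 1)) atTop (𝓝 0) :=
        tendsto_one_div_add_atTop_nhds_zero_nat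
      simpa [u] using this.const_mul (r / 2 : ℂ)
    have hux : ∀ n, x + u n ∈ U := fun n => hsub (by
      rw [Metric.mem_ball, dist_eq_norm, add_sub_cancel_left]
      have h1 : ‖1 / ((n : ℂ) + 1)‖ ≤ 1 := by
        have : ‖(n : ℂ) + 1‖ = n + 1 := by
          exact_mod_cast Complex.norm_natCast (n + 1)
        rw [norm_div, norm_one, this, div_le_one (by positivity)]
        linarith [Nat.cast_nonneg (α := ℝ) n]
      have h2 : ‖(r / 2 : ℂ)‖ = r / 2 := by
        rw [norm_div, Complex.norm_real, Real.norm_of_nonneg hr.le]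
        simp
      rw [norm_mul, h2]
      nlinarith [norm_nonneg (1 / ((n : ℂ) + 1))])
    refine aestronglyMeasurable_of_tendsto_ae atTop
      (f := fun n s => (u n)⁻¹ * (F (x + u n) s - F x s))
      (fun n => ((h.meas _ (hux n)).sub (h.meas x hx)).const_mul _) ?_
    filter_upwards [ae_restrict_mem measurableSet_Ioo] with s hs
    have hd := ((h.diff s hs).differentiableAt (hU.mem_nhds hx)).hasDerivAt
    rw [hasDerivAt_iff_tendsto_slope_zero] at hd
    exact hd.comp (tendsto_nhdsWithin_iff.2 ⟨hul, .of_forall hu0⟩)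
  bound x₀ hx₀ := by
    obtain ⟨r, hr, hsub, B, hB, hle⟩ := h.bound x₀ hx₀
    refine ⟨r / 2, by positivity, (Metric.ball_subset_ball (by linarith)).trans hsub,
      fun s => B s / (r / 4), hB.div_const _, fun x hx s hs => ?_⟩
    have hin : Metric.closedBall x (r / 4) ⊆ Metric.ball x₀ r := by
      refine Metric.closedBall_subset_ball' ?_
      have := Metric.mem_ball.1 hx
      linarith
    refine Complex.norm_deriv_le_of_forall_mem_sphere_norm_le (by positivity) ?_ ?_
    · exact ((h.diff s hs).mono ((Metric.closure_ball_subset_closedBall.trans hin).trans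
        hsub)).diffContOnCl
    · intro z hz
      exact hle z (hin (Metric.sphere_subset_closedBall hz)) s hs

lemma hasDerivAt (hU : IsOpen U) (h : IsParamIntegrand U F) {x : ℂ} (hx : x ∈ U) :
    HasDerivAt (fun x => ∫ s in (0 : ℝ)..1, F x s)
      (∫ s in (0 : ℝ)..1, _root_.deriv (fun y => F y s) x) x := by
  simp only [intervalIntegral.integral_of_le zero_le_one, integral_Ioc_eq_integral_Ioo]
  obtain ⟨r, hr, hsub, B, hB, hle⟩ := (h.deriv hU).bound x hx
  refine (hasDerivAt_integral_of_dominated_loc_of_deriv_le (μ := volume.restrict (Ioo (0 : ℝ) 1))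
    (F' := fun x s => _root_.deriv (fun y => F y s) x) (bound := B) (Metric.ball_mem_nhds x hr) ?_ (h.integrableOn hx) ((h.deriv hU).meas x hx) ?_
    hB ?_).2
  · filter_upwards [hU.mem_nhds hx] with y hy using h.meas y hy
  · filter_upwards [ae_restrict_mem measurableSet_Ioo] with s hs y hy
    exact hle y hy s hs
  · filter_upwards [ae_restrict_mem measurableSet_Ioo] with s hs y hy
    exact ((h.diff s hs).differentiableAt (hU.mem_nhds (hsub hy))).hasDerivAt

lemma congr {G : ℂ → ℝ → ℂ} (h : IsParamIntegrand U F)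
    (hFG : ∀ x ∈ U, ∀ s ∈ Ioo (0 : ℝ) 1, F x s = G x s) : IsParamIntegrand U G where
  diff s hs := (h.diff s hs).congr fun x hx => (hFG x hx s hs).symm
  meas x hx := (h.meas x hx).congr (by
    filter_upwards [ae_restrict_mem measurableSet_Ioo] with s hs using hFG x hx s hs)
  bound x₀ hx₀ := by
    obtain ⟨r, hr, hsub, B, hB, hle⟩ := h.bound x₀ hx₀
    exact ⟨r, hr, hsub, B, hB, fun x hx s hs => hFG x (hsub hx) s hs ▸ hle x hx s hs⟩

end IsParamIntegrand

/-! ### Derivatives of continuous square roots, and integrability of the end point weight. -/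

/-- A continuous square root of a function with derivative `d` is differentiable. -/
lemma hasDerivAt_of_sq {𝕜 : Type*} [NontriviallyNormedField 𝕜] [NormedAlgebra 𝕜 ℂ] {f : 𝕜 → ℂ}
    {d : ℂ} {x : 𝕜} (hc : ContinuousAt f x) (h0 : f x ≠ 0)
    (h : HasDerivAt (fun y => f y ^ 2) d x) : HasDerivAt f (d / (2 * f x)) x := by
  rw [hasDerivAt_iff_tendsto_slope] at h ⊢
  have h1 : Tendsto (fun y => f y + f x) (𝓝[≠] x) (𝓝 (2 * f x)) := by
    rw [two_mul]
    exact (hc.tendsto.add_const _).mono_left nhdsWithin_le_nhds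
  have h2 : (2 * f x) ≠ 0 := mul_ne_zero two_ne_zero h0
  refine (h.div h1 h2).congr' ?_
  filter_upwards [h1.eventually_ne h2] with y hy
  rw [Pi.div_apply, slope_def_module, slope_def_module, div_eq_iff hy, smul_mul_assoc]
  congr 1
  ring

lemma hasDerivAt_of_sq_real {f : ℝ → ℂ} {d : ℂ} {x : ℝ} (hc : ContinuousAt f x) (h0 : f x ≠ 0)
    (h : HasDerivAt (fun y => f y ^ 2) d x) : HasDerivAt f (d / (2 * f x)) x :=
  hasDerivAt_of_sq hc h0 h

lemma inv_sqrt_le {s : ℝ} (hs : s ∈ Ioo (0 : ℝ) 1) :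
    (Real.sqrt (s * (1 - s)))⁻¹ ≤ s ^ (-(1 / 2) : ℝ) + (1 - s) ^ (-(1 / 2) : ℝ) := by
  obtain ⟨h0, h1⟩ := hs
  have h1' : 0 < 1 - s := by linarith
  rw [Real.rpow_neg h0.le, Real.rpow_neg h1'.le, ← Real.sqrt_eq_rpow, ← Real.sqrt_eq_rpow,
    Real.sqrt_mul h0.le]
  have a := Real.sqrt_pos.2 h0
  have b := Real.sqrt_pos.2 h1'
  have ha := Real.sq_sqrt h0.le
  have hb := Real.sq_sqrt h1'.le
  rw [← sub_nonneg]
  have : (√s)⁻¹ + (√(1 - s))⁻¹ - (√s * √(1 - s))⁻¹ = (√s + √(1 - s) - 1) / (√s * √(1 - s)) := by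
    field_simp
    ring
  rw [this]
  refine div_nonneg ?_ (by positivity)
  -- √s + √(1-s) ≥ 1, because the squares of these two numbers in [0, 1] add up to 1.
  nlinarith

lemma integrableOn_inv_sqrt :
    IntegrableOn (fun s : ℝ => (Real.sqrt (s * (1 - s)))⁻¹) (Ioo (0 : ℝ) 1) := by
  have h1 : IntervalIntegrable (fun s : ℝ => s ^ (-(1 / 2) : ℝ)) volume 0 1 :=
    intervalIntegral.intervalIntegrable_rpow' (by norm_num)
  have h2 : IntervalIntegrable (fun s : ℝ => (1 - s) ^ (-(1 / 2) : ℝ)) volume 0 1 := by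
    simpa using (h1.comp_sub_left 1).symm
  have h3 := h1.add h2
  rw [intervalIntegrable_iff_integrableOn_Ioo_of_le zero_le_one] at h3
  refine Integrable.mono' h3 ?_ ?_
  · exact Measurable.aestronglyMeasurable (by fun_prop)
  · filter_upwards [ae_restrict_mem measurableSet_Ioo] with s hs
    rw [Real.norm_of_nonneg (by positivity)]
    exact inv_sqrt_le hs

end EllipticFuchs

namespace EllipticFuchs

open Filter Topology MeasureTheory

variable {L : PeriodPair} {i : Fin 4} {U : Set ℂ} {c : ℝ → ℂ} {S : ℂ → ℝ → ℂ}

/-! ### Geometry of the contour -/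

lemma dslope_continuous {𝕜 : Type*} [NontriviallyNormedField 𝕜] [NormedSpace 𝕜 ℂ] {f : 𝕜 → ℂ}
    (hf : Differentiable 𝕜 f) (a : 𝕜) : Continuous (dslope f a) := by
  rw [continuous_iff_continuousAt]
  intro b
  rcases eq_or_ne b a with rfl | hb
  · exact continuousAt_dslope_same.2 (hf b)
  · exact (continuousAt_dslope_of_ne hb).2 (hf b).continuousAt

namespace IsContourData

lemma notMem (hD : IsContourData L i U c S) {x : ℂ} (hx : x ∈ U) : x ∉ L.lattice :=
  notMem_of_two_mul_notMem L (hD.notHalf x hx)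

lemma two_sub_notMem (hD : IsContourData L i U c S) {x : ℂ} (hx : x ∈ U) :
    2 * x - 2 * halfPeriod L i ∉ L.lattice := fun h => hD.notHalf x hx (by
  have := add_mem h (two_mul_halfPeriod_mem L i)
  rwa [sub_add_cancel] at this)

lemma sub_ne_zero (hD : IsContourData L i U c S) {x : ℂ} (hx : x ∈ U) :
    x - halfPeriod L i ≠ 0 := fun h => hD.two_sub_notMem hx (by
  rw [show 2 * x - 2 * halfPeriod L i = 2 * (x - halfPeriod L i) by ring, h, mul_zero]
  exact zero_mem _)

lemma differentiable (hD : IsContourData L i U c S) : Differentiable ℝ c :=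
  hD.smooth.differentiable one_ne_zero

lemma continuous_deriv (hD : IsContourData L i U c S) : Continuous (deriv c) :=
  hD.smooth.continuous_deriv le_rfl

lemma hasDerivAt (hD : IsContourData L i U c S) (s : ℝ) : HasDerivAt c (deriv c s) s :=
  (hD.differentiable s).hasDerivAt

lemma hasDerivAt_contour (hD : IsContourData L i U c S) (x : ℂ) (s : ℝ) :
    HasDerivAt (contour L i c x) ((x - halfPeriod L i) * deriv c s) s :=
  ((hD.hasDerivAt s).const_mul _).const_add _

lemma deriv_contour (hD : IsContourData L i U c S) (x : ℂ) (s : ℝ) :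
    deriv (contour L i c x) s = (x - halfPeriod L i) * deriv c s :=
  (hD.hasDerivAt_contour x s).deriv

lemma continuous_contour (hD : IsContourData L i U c S) :
    Continuous fun p : ℂ × ℝ => contour L i c p.1 p.2 := by
  have := hD.differentiable.continuous
  unfold contour
  fun_prop

lemma hasDerivAt_contour_param (L : PeriodPair) (i : Fin 4) (c : ℝ → ℂ) (x : ℂ) (s : ℝ) :
    HasDerivAt (fun x => contour L i c x s) (c s) x := by
  have := (((hasDerivAt_id x).sub_const (halfPeriod L i)).mul_const (c s)).const_add
    (halfPeriod L i)
  exact this.congr_deriv (one_mul _)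

lemma branch_ne_zero (hD : IsContourData L i U c S) {x : ℂ} (hx : x ∈ U) {s : ℝ}
    (hs : s ∈ Ioo (0 : ℝ) 1) : S x s ≠ 0 := by
  have h1 := hD.avoid x hx s hs
  have h2 := hD.branch_sq x hx s hs
  intro h
  rw [h, zero_pow two_ne_zero, eq_comm, mul_eq_zero, wSigma_eq_zero_iff, wSigma_eq_zero_iff] at h2
  tauto

lemma continuousAt_branch (hD : IsContourData L i U c S) {x : ℂ} (hx : x ∈ U) {s : ℝ}
    (hs : s ∈ Ioo (0 : ℝ) 1) : ContinuousAt (fun p : ℂ × ℝ => S p.1 p.2) (x, s) :=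
  hD.branch_continuous.continuousAt ((hD.isOpen.prod isOpen_Ioo).mem_nhds ⟨hx, hs⟩)

/-- The quotient `σ(x-ξ)σ(x+ξ) / (s (1-s))`, extended to the end points of the contour. -/
lemma exists_reduced (hD : IsContourData L i U c S) : ∃ G : ℂ × ℝ → ℂ, Continuous G ∧
    (∀ p ∈ U ×ˢ Icc (0 : ℝ) 1, G p ≠ 0) ∧
    ∀ x s, wSigma L (x - contour L i c x s) * wSigma L (x + contour L i c x s)
      = (s * (1 - s) : ℝ) * G (x, s) := by
  set ω := halfPeriod L i with hω
  have dσ := differentiable_wSigma L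
  have c1 := dslope_continuous hD.differentiable 0
  have c2 := dslope_continuous hD.differentiable 1
  have c3 := dslope_continuous dσ 0
  have c4 := dslope_continuous dσ (2 * ω)
  have cc := hD.continuous_contour
  have h1 : ∀ x s, x - contour L i c x s = (x - ω) * (1 - c s) := fun x s => by
    rw [contour]; ring
  have h2 : ∀ x s, x + contour L i c x s = 2 * ω + (x - ω) * (1 + c s) := fun x s => by
    rw [contour]; ring
  have e1 : ∀ s, 1 - c s = (1 - s : ℝ) * dslope c 1 s := fun s => by
    have := sub_smul_dslope c 1 s
    rw [hD.right, Complex.real_smul] at this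
    push_cast at this ⊢
    linear_combination this
  have e2 : ∀ s, 1 + c s = (s : ℝ) * dslope c 0 s := fun s => by
    have := sub_smul_dslope c 0 s
    rw [hD.left, Complex.real_smul] at this
    push_cast at this ⊢
    linear_combination -this
  have e3 : ∀ w, wSigma L w = w * dslope (wSigma L) 0 w := fun w => by
    have := sub_smul_dslope (wSigma L) 0 w
    rw [wSigma_zero, smul_eq_mul] at this
    linear_combination -this
  have e4 : ∀ w, wSigma L (2 * ω + w) = w * dslope (wSigma L) (2 * ω) (2 * ω + w) := fun w => by
    have := sub_smul_dslope (wSigma L) (2 * ω) (2 * ω + w)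
    rw [wSigma_of_mem L (two_mul_halfPeriod_mem L i), smul_eq_mul] at this
    linear_combination -this
  -- Since x-ξ = (x-ω)(1-c) and x+ξ = 2ω + (x-ω)(1+c), the zeros at the two ends are split off by
  -- divided differences of c at 1 and 0, and of σ at the lattice points 0 and 2ω.
  refine ⟨fun p => (p.1 - ω) ^ 2 * dslope c 1 p.2 * dslope c 0 p.2
    * dslope (wSigma L) 0 (p.1 - contour L i c p.1 p.2)
    * dslope (wSigma L) (2 * ω) (p.1 + contour L i c p.1 p.2), by fun_prop, ?_, ?_⟩
  swap
  · intro x s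
    simp only
    rw [h2, e4, ← h2, e3 (x - _)]
    nth_rw 1 [h1]
    rw [e1, e2]
    push_cast
    ring
  rintro ⟨x, s⟩ ⟨hx, hs0, hs1⟩
  have hxω := hD.sub_ne_zero hx
  have hend := hD.two_sub_notMem hx
  rw [show 2 * x - 2 * halfPeriod L i = (x - ω) * (1 + 1) by rw [hω]; ring] at hend
  simp only at hx hs0 hs1 ⊢
  have hz : ∀ w ∉ L.lattice, dslope (wSigma L) 0 w ≠ 0 := fun w hw h => by
    have := e3 w
    rw [h, mul_zero, wSigma_eq_zero_iff] at this
    exact hw this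
  have hz2 : ∀ w, 2 * ω + w ∉ L.lattice → dslope (wSigma L) (2 * ω) (2 * ω + w) ≠ 0 :=
    fun w hw h => by
      have := e4 w
      rw [h, mul_zero, wSigma_eq_zero_iff] at this
      exact hw this
  -- At an end point the vanishing divided differences reduce to derivatives: nonzero velocity of c,
  -- simple zeros of σ. Elsewhere a zero would contradict `avoid`, or 2x ∉ Λ at the opposite end.
  refine mul_ne_zero (mul_ne_zero (mul_ne_zero (mul_ne_zero (pow_ne_zero 2 hxω) ?_) ?_) ?_) ?_
  · rcases hs1.eq_or_lt with rfl | hs1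
    · rw [dslope_same]
      exact hD.right_regular
    · intro h
      have h3 := e1 s
      rw [h, mul_zero] at h3
      rcases hs0.eq_or_lt with rfl | hs0
      · rw [hD.left] at h3
        norm_num at h3
      · refine (hD.avoid x hx s ⟨hs0, hs1⟩).1 ?_
        rw [h1, h3, mul_zero]
        exact zero_mem _
  · rcases hs0.eq_or_lt with rfl | hs0
    · rw [dslope_same]
      exact hD.left_regular
    · intro h
      have h3 := e2 s
      rw [h, mul_zero] at h3
      rcases hs1.eq_or_lt with rfl | hs1
      · rw [hD.right] at h3
        norm_num at h3
      · refine (hD.avoid x hx s ⟨hs0, hs1⟩).2 ?_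
        rw [h2, h3, mul_zero, add_zero]
        exact two_mul_halfPeriod_mem L i
  · rcases hs1.eq_or_lt with rfl | hs1
    · rw [h1, hD.right, sub_self, mul_zero, dslope_same, (hasDerivAt_wSigma_zero L).deriv]
      exact one_ne_zero
    · refine hz _ ?_
      rcases hs0.eq_or_lt with rfl | hs0
      · rw [h1, hD.left, sub_neg_eq_add]
        exact hend
      · exact (hD.avoid x hx s ⟨hs0, hs1⟩).1
  · rcases hs0.eq_or_lt with rfl | hs0
    · rw [h2, hD.left, add_neg_cancel, mul_zero, add_zero, dslope_same]
      exact deriv_wSigma_ne_zero L (two_mul_halfPeriod_mem L i)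
    · rw [h2]
      refine hz2 _ ?_
      rw [← h2]
      rcases hs1.eq_or_lt with rfl | hs1
      · rw [h2, hD.right]
        intro h
        exact hend ((L.lattice.add_mem_iff_right (two_mul_halfPeriod_mem L i)).1 h)
      · exact (hD.avoid x hx s ⟨hs0, hs1⟩).2

/-- The inverse of the square root has at most inverse square root singularities at the end points
of the contour, locally uniformly in `x`. -/
lemma exists_inv_branch_le (hD : IsContourData L i U c S) {x₀ : ℂ} (hx₀ : x₀ ∈ U) :
    ∃ r > 0, Metric.closedBall x₀ r ⊆ U ∧ ∃ M > 0, ∀ x ∈ Metric.closedBall x₀ r,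
      ∀ s ∈ Ioo (0 : ℝ) 1, ‖(S x s)⁻¹‖ ≤ M * (Real.sqrt (s * (1 - s)))⁻¹ := by
  obtain ⟨G, hGc, hG0, hG⟩ := hD.exists_reduced
  obtain ⟨r, hr, hsub⟩ := Metric.nhds_basis_closedBall.mem_iff.1 (hD.isOpen.mem_nhds hx₀)
  have hK : IsCompact (Metric.closedBall x₀ r ×ˢ Icc (0 : ℝ) 1) :=
    (isCompact_closedBall x₀ r).prod isCompact_Icc
  -- The constant comes from the positive minimum of ‖G‖ on the compact set.
  obtain ⟨p, hp, hmin⟩ := hK.exists_isMinOn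
    ⟨(x₀, 0), Metric.mem_closedBall_self hr.le, by simp⟩ hGc.norm.continuousOn
  have hm : 0 < ‖G p‖ := norm_pos_iff.2 (hG0 p ⟨hsub hp.1, hp.2⟩)
  refine ⟨r, hr, hsub, (Real.sqrt ‖G p‖)⁻¹, by positivity, fun x hx s hs => ?_⟩
  have hpos : 0 < s * (1 - s) := mul_pos hs.1 (by linarith [hs.2])
  have h1 : ‖S x s‖ ^ 2 = (s * (1 - s)) * ‖G (x, s)‖ := by
    rw [← norm_pow, hD.branch_sq x (hsub hx) s hs, hG, norm_mul, Complex.norm_real,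
      Real.norm_of_nonneg hpos.le]
  have h2 : ‖G p‖ ≤ ‖G (x, s)‖ := hmin (a := (x, s)) ⟨hx, Ioo_subset_Icc_self hs⟩
  rw [norm_inv, ← mul_inv, ← Real.sqrt_mul hm.le]
  refine inv_anti₀ (by positivity) ?_
  rw [← Real.sqrt_sq (norm_nonneg (S x s)), h1]
  refine Real.sqrt_le_sqrt ?_
  rw [mul_comm]
  gcongr

/-! ### Derivatives along the contour -/

/-- `σ(x) / √(σ(x-ξ)σ(x+ξ))` -/
lemma hasDerivAt_theta_param (hD : IsContourData L i U c S) {x : ℂ} (hx : x ∈ U) {s : ℝ}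
    (hs : s ∈ Ioo (0 : ℝ) 1) :
    HasDerivAt (fun x => wSigma L x / S x s)
      (wSigma L x / S x s * (lgx L x (contour L i c x s) + c s * lgxi L x (contour L i c x s)))
      x := by
  have hS0 := hD.branch_ne_zero hx hs
  have hsq := hD.branch_sq x hx s hs
  obtain ⟨ha, hb⟩ := hD.avoid x hx s hs
  have hξ := hasDerivAt_contour_param L i c x s
  have hcont : ContinuousAt (fun y => S y s) x :=
    (hD.continuousAt_branch hx hs).comp (f := fun y : ℂ => (y, s)) (by fun_prop)
  have h1 := ((hasDerivAt_wSigma L ha).comp x ((hasDerivAt_id x).sub hξ)).mul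
    ((hasDerivAt_wSigma L hb).comp x ((hasDerivAt_id x).add hξ))
  have h2 : HasDerivAt (fun y => S y s ^ 2) _ x := h1.congr_of_eventuallyEq (by
    filter_upwards [hD.isOpen.mem_nhds hx] with y hy using hD.branch_sq y hy s hs)
  have h3 := hasDerivAt_of_sq hcont hS0 h2
  refine ((hasDerivAt_wSigma L (hD.notMem hx)).div h3 hS0).congr_deriv ?_
  simp only [Function.comp_apply, Pi.sub_apply, Pi.add_apply, id, lgx, lgxi]
  field_simp
  linear_combination wSigma L x * (wZeta L (x - contour L i c x s) * (1 - c s)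
    + wZeta L (x + contour L i c x s) * (1 + c s)) * hsq

lemma hasDerivAt_theta (hD : IsContourData L i U c S) {x : ℂ} (hx : x ∈ U) {s : ℝ}
    (hs : s ∈ Ioo (0 : ℝ) 1) :
    HasDerivAt (fun s => wSigma L x / S x s)
      (wSigma L x / S x s * (lgxi L x (contour L i c x s)
        * ((x - halfPeriod L i) * deriv c s))) s := by
  have hS0 := hD.branch_ne_zero hx hs
  have hsq := hD.branch_sq x hx s hs
  obtain ⟨ha, hb⟩ := hD.avoid x hx s hs
  have hξ := hD.hasDerivAt_contour x s
  have hcont : ContinuousAt (fun s => S x s) s :=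
    (hD.continuousAt_branch hx hs).comp (f := fun s : ℝ => (x, s)) (by fun_prop)
  have h1 := ((hasDerivAt_wSigma L ha).comp s (hξ.const_sub x)).mul
    ((hasDerivAt_wSigma L hb).comp s (hξ.const_add x))
  have h2 : HasDerivAt (fun s => S x s ^ 2) _ s := h1.congr_of_eventuallyEq (by
    filter_upwards [isOpen_Ioo.mem_nhds hs] with y hy using hD.branch_sq x hx y hy)
  have h3 := hasDerivAt_of_sq_real hcont hS0 h2
  refine ((hasDerivAt_const s (wSigma L x)).div h3 hS0).congr_deriv ?_
  simp only [Function.comp_apply, lgxi]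
  field_simp
  linear_combination wSigma L x * ((x - halfPeriod L i) * deriv c s) * (-wZeta L (x - contour L i c x s)
    + wZeta L (x + contour L i c x s)) * hsq

/-- The derivative in `x`, for a fixed parameter of the contour, of an integrand. -/
lemma hasDerivAt_integrand (hD : IsContourData L i U c S) {x : ℂ} (hx : x ∈ U) {s : ℝ}
    (hs : s ∈ Ioo (0 : ℝ) 1) {n : ℂ → ℂ} {n' : ℂ}
    (hn : HasDerivAt n n' (contour L i c x s)) :
    HasDerivAt (fun x => wSigma L x / S x s * n (contour L i c x s)
        * ((x - halfPeriod L i) * deriv c s))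
      (wSigma L x / S x s * deriv c s * (((lgx L x (contour L i c x s)
        + c s * lgxi L x (contour L i c x s)) * n (contour L i c x s) + c s * n')
          * (x - halfPeriod L i) + n (contour L i c x s))) x := by
  have h1 := ((hD.hasDerivAt_theta_param hx hs).mul (hn.comp x
    (hasDerivAt_contour_param L i c x s))).mul
    (((hasDerivAt_id x).sub_const (halfPeriod L i)).mul_const (deriv c s))
  refine h1.congr_deriv ?_
  simp only [Function.comp_apply, Pi.mul_apply, id]
  ring

lemma isParamIntegrand (hD : IsContourData L i U c S) {O : Set ℂ} (hO : IsOpen O) {n : ℂ → ℂ}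
    (hn : DifferentiableOn ℂ n O)
    (hmaps : ∀ x ∈ U, ∀ s ∈ Icc (0 : ℝ) 1, contour L i c x s ∈ O) :
    IsParamIntegrand U fun x s => wSigma L x / S x s * n (contour L i c x s)
        * ((x - halfPeriod L i) * deriv c s) where
  diff s hs x hx := (hD.hasDerivAt_integrand hx hs
    (hn.differentiableAt (hO.mem_nhds (hmaps x hx s
      (Ioo_subset_Icc_self hs)))).hasDerivAt).differentiableAt.differentiableWithinAt
  meas x hx := by
    refine ContinuousOn.aestronglyMeasurable (fun s hs => ?_) measurableSet_Ioo
    have h1 := (hD.hasDerivAt_theta hx hs).continuousAt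
    have h2 : ContinuousAt (fun s => n (contour L i c x s)) s :=
      (hn.differentiableAt (hO.mem_nhds (hmaps x hx s
        (Ioo_subset_Icc_self hs)))).continuousAt.comp (hD.hasDerivAt_contour x s).continuousAt
    have h3 := hD.continuous_deriv.continuousAt (x := s)
    exact ((h1.mul h2).mul (continuousAt_const.mul h3)).continuousWithinAt
  bound x₀ hx₀ := by
    obtain ⟨r, hr, hsub, M, hM, hle⟩ := hD.exists_inv_branch_le hx₀
    have hK : IsCompact (Metric.closedBall x₀ r ×ˢ Icc (0 : ℝ) 1) :=
      (isCompact_closedBall x₀ r).prod isCompact_Icc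
    have cc := hD.continuous_contour
    have cd := hD.continuous_deriv
    have cσ : Continuous fun p : ℂ × ℝ => wSigma L p.1 := (continuous_wSigma L).comp continuous_fst
    have cn : ContinuousOn (fun p : ℂ × ℝ => n (contour L i c p.1 p.2))
        (Metric.closedBall x₀ r ×ˢ Icc (0 : ℝ) 1) :=
      hn.continuousOn.comp cc.continuousOn fun p hp => hmaps p.1 (hsub hp.1) p.2 hp.2
    obtain ⟨C, hC⟩ := hK.exists_bound_of_continuousOn
      (f := fun p : ℂ × ℝ => wSigma L p.1 * n (contour L i c p.1 p.2)
        * ((p.1 - halfPeriod L i) * deriv c p.2))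
      ((cσ.continuousOn.mul cn).mul (by fun_prop))
    refine ⟨r, hr, Metric.ball_subset_closedBall.trans hsub,
      fun s => C * M * (Real.sqrt (s * (1 - s)))⁻¹, integrableOn_inv_sqrt.const_mul _,
      fun x hx s hs => ?_⟩
    have hx' := Metric.ball_subset_closedBall hx
    have h1 := hC (x, s) ⟨hx', Ioo_subset_Icc_self hs⟩
    have h2 := hle x hx' s hs
    have h0 : 0 ≤ C := (norm_nonneg _).trans h1
    calc ‖wSigma L x / S x s * n (contour L i c x s) * ((x - halfPeriod L i) * deriv c s)‖
        = ‖wSigma L x * n (contour L i c x s) * ((x - halfPeriod L i) * deriv c s)‖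
          * ‖(S x s)⁻¹‖ := by
          rw [← norm_mul]
          congr 1
          ring
      _ ≤ C * (M * (Real.sqrt (s * (1 - s)))⁻¹) := by gcongr
      _ = C * M * (Real.sqrt (s * (1 - s)))⁻¹ := by ring

end IsContourData

end EllipticFuchs

namespace EllipticFuchs

open Filter Topology MeasureTheory Asymptotics

variable {L : PeriodPair} {i : Fin 4} {U : Set ℂ} {c : ℝ → ℂ} {S : ℂ → ℝ → ℂ}

/-! ### The differential equations of the integrands -/

namespace IsContourData

lemma fPull_eq (hD : IsContourData L i U c S) (al ka x : ℂ) (s : ℝ) :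
    fPull L al ka i c S x s = wSigma L x / S x s * phi L al ka (contour L i c x s)
      * ((x - halfPeriod L i) * deriv c s) := by
  rw [fPull, fKernel, hD.deriv_contour, phi]
  ring

lemma isParamIntegrand_fPull (hD : IsContourData L i U c S) (al ka : ℂ) :
    IsParamIntegrand U (fPull L al ka i c S) :=
  (hD.isParamIntegrand isOpen_univ (differentiable_phi L al ka).differentiableOn
    fun _ _ _ _ => mem_univ _).congr fun x _ s _ => (hD.fPull_eq al ka x s).symm

/-- The derivative of `fPull` in `x`. -/
lemma hasDerivAt_fPull (hD : IsContourData L i U c S) (al ka : ℂ) {x : ℂ} (hx : x ∈ U) {s : ℝ}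
    (hs : s ∈ Ioo (0 : ℝ) 1) :
    HasDerivAt (fun x => fPull L al ka i c S x s)
      (wSigma L x / S x s * deriv c s * (((lgx L x (contour L i c x s)
        + c s * lgxi L x (contour L i c x s)) * phi L al ka (contour L i c x s)
          + c s * deriv (phi L al ka) (contour L i c x s))
          * (x - halfPeriod L i) + phi L al ka (contour L i c x s))) x := by
  simp only [hD.fPull_eq]
  exact hD.hasDerivAt_integrand hx hs (differentiable_phi L al ka _).hasDerivAt

/-- The second derivative of `fPull` in `x`. -/
lemma hasDerivAt_deriv_fPull (hD : IsContourData L i U c S) (al ka : ℂ) {x : ℂ} (hx : x ∈ U)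
    {s : ℝ} (hs : s ∈ Ioo (0 : ℝ) 1) {xi v a b p₁ p₂ f₀ f₁ f₂ : ℂ}
    (hxi : xi = contour L i c x s) (hv : v = c s) (ha : a = lgx L x xi) (hb : b = lgxi L x xi)
    (hp₁ : p₁ = L.weierstrassP (x - xi)) (hp₂ : p₂ = L.weierstrassP (x + xi))
    (hf₀ : f₀ = phi L al ka xi) (hf₁ : f₁ = deriv (phi L al ka) xi)
    (hf₂ : f₂ = deriv (deriv (phi L al ka)) xi) :
    HasDerivAt (fun y => deriv (fun x => fPull L al ka i c S x s) y)
      (wSigma L x / S x s * deriv c s * ((a + v * b) * (((a + v * b) * f₀ + v * f₁)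
            * (x - halfPeriod L i) + f₀)
        + (((-L.weierstrassP x + p₁ * (1 - v) / 2 + p₂ * (1 + v) / 2)
              + v * (-p₁ * (1 - v) / 2 + p₂ * (1 + v) / 2)) * f₀
            + (a + v * b) * (v * f₁) + v * (v * f₂)) * (x - halfPeriod L i)
        + ((a + v * b) * f₀ + v * f₁) + v * f₁)) x := by
  subst hxi hv ha hb hp₁ hp₂ hf₀ hf₁ hf₂
  obtain ⟨h1, h2⟩ := hD.avoid x hx s hs
  have hξ := hasDerivAt_contour_param L i c x s
  have z1 := (hasDerivAt_wZeta L h1).comp x ((hasDerivAt_id x).sub hξ)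
  have z2 := (hasDerivAt_wZeta L h2).comp x ((hasDerivAt_id x).add hξ)
  have dz := hasDerivAt_wZeta L (hD.notMem hx)
  have d0 := (differentiable_phi L al ka _).hasDerivAt.comp x hξ
  have d1 := (differentiable_deriv_phi L al ka _).hasDerivAt.comp x hξ
  have da := (dz.sub (z1.div_const 2)).sub (z2.div_const 2)
  have db := (z1.div_const 2).sub (z2.div_const 2)
  have hT := hD.hasDerivAt_theta_param hx hs
  have hall := (hT.mul_const (deriv c s)).mul
    (((((da.add (db.const_mul (c s))).mul d0).add (d1.const_mul (c s))).mul
      ((hasDerivAt_id x).sub_const (halfPeriod L i))).add d0)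
  refine (hall.congr_of_eventuallyEq ?_).congr_deriv ?_
  · filter_upwards [hD.isOpen.mem_nhds hx] with y hy using (hD.hasDerivAt_fPull al ka hy hs).deriv
  simp only [Function.comp_apply, Pi.mul_apply, Pi.add_apply, Pi.sub_apply, id, lgx, lgxi]
  ring

/-- A primitive along the contour of the equation for `fPull`. -/
noncomputable def psi (L : PeriodPair) (al ka : ℂ) (i : Fin 4) (c : ℝ → ℂ) (S : ℂ → ℝ → ℂ) (x : ℂ)
    (s : ℝ) : ℂ :=
  wSigma L x / S x s *
    (2 * c s * (lgx L x (contour L i c x s) * phi L al ka (contour L i c x s))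
      + (1 + c s ^ 2) * (deriv (phi L al ka) (contour L i c x s)
        + lgxi L x (contour L i c x s) * phi L al ka (contour L i c x s))
      + (coeffP L al x * c s + coeffT L al ka x) * phi L al ka (contour L i c x s))

/-- The total derivatives 2cΦ_x + c²Φ_ξ and pcΦ come from ξ_x = c when x is differentiated at fixed
s. The remaining Φ_ξ + TΦ comes from `kernel_pde`, which is used only in the last step. -/
lemma hasDerivAt_psi (hD : IsContourData L i U c S) {al : ℂ} (ka : ℂ) (hal : 2 * al ∉ L.lattice)
    {x : ℂ} (hx : x ∈ U) (hxal : L.weierstrassP x ≠ L.weierstrassP al) {s : ℝ}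
    (hs : s ∈ Ioo (0 : ℝ) 1) :
    HasDerivAt (psi L al ka i c S x)
      (deriv (fun y => deriv (fun x => fPull L al ka i c S x s) y) x
        + coeffP L al x * deriv (fun x => fPull L al ka i c S x s) x
        + coeffQ L al ka x * fPull L al ka i c S x s) s := by
  obtain ⟨h1, h2⟩ := hD.avoid x hx s hs
  have hξ := hD.hasDerivAt_contour x s
  have z1 := (hasDerivAt_wZeta L h1).comp s (hξ.const_sub x)
  have z2 := (hasDerivAt_wZeta L h2).comp s (hξ.const_add x)
  have d0 := (differentiable_phi L al ka _).hasDerivAt.comp s hξ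
  have d1 := (differentiable_deriv_phi L al ka _).hasDerivAt.comp s hξ
  have da := ((z1.div_const 2).const_sub (wZeta L x)).sub (z2.div_const 2)
  have db := (z1.div_const 2).sub (z2.div_const 2)
  have dc := hD.hasDerivAt s
  have hT := hD.hasDerivAt_theta hx hs
  have hall := hT.mul
    ((((dc.const_mul 2).mul (da.mul d0)).add
      (((dc.pow 2).const_add 1).mul (d1.add (db.mul d0)))).add
      (((dc.const_mul (coeffP L al x)).add_const (coeffT L al ka x)).mul d0))
  have hpde := kernel_pde L (ka := ka) hal (hD.notHalf x hx) hxal h1 h2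
  rw [(hD.hasDerivAt_fPull al ka hx hs).deriv,
    (hD.hasDerivAt_deriv_fPull al ka hx hs rfl rfl rfl rfl rfl rfl rfl rfl rfl).deriv, hD.fPull_eq]
  refine HasDerivAt.congr_deriv (f := psi L al ka i c S x) hall ?_
  simp only [Function.comp_apply, Pi.mul_apply, Pi.add_apply, Pi.sub_apply, Pi.pow_apply,
    Nat.cast_ofNat, Nat.add_one_sub_one, pow_one]
  have ea : wZeta L x - wZeta L (x - contour L i c x s) / 2 - wZeta L (x + contour L i c x s) / 2
      = lgx L x (contour L i c x s) := rfl
  have eb : wZeta L (x - contour L i c x s) / 2 - wZeta L (x + contour L i c x s) / 2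
      = lgxi L x (contour L i c x s) := rfl
  rw [ea, eb]
  generalize wSigma L x / S x s = T at *
  generalize lgx L x (contour L i c x s) = a at *
  generalize lgxi L x (contour L i c x s) = b at *
  generalize deriv (deriv (phi L al ka)) (contour L i c x s) = f2 at *
  generalize deriv (phi L al ka) (contour L i c x s) = f1 at *
  generalize phi L al ka (contour L i c x s) = f0 at *
  -- The values ℘(x±ξ) produced on both sides cancel identically.
  linear_combination -T * (x - halfPeriod L i) * deriv c s * hpde

end IsContourData

end EllipticFuchs

namespace EllipticFuchs

open Filter Topology MeasureTheory Asymptotics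

variable {L : PeriodPair} {i : Fin 4} {U : Set ℂ} {c : ℝ → ℂ} {S : ℂ → ℝ → ℂ}

/-! ### Behaviour at the end points of the contour -/

lemma isBigO_sub_mul_one_sub {e : ℝ} (he : e = 0 ∨ e = 1) :
    (fun s : ℝ => s - e) =O[𝓝[Ioo 0 1] e] fun s => s * (1 - s) := by
  refine IsBigO.of_bound 2 ?_
  have h1 : ∀ᶠ s in 𝓝[Ioo 0 1] e, |s - e| < 1 / 2 := by
    have : ∀ᶠ s in 𝓝 e, |s - e| < 1 / 2 := by
      filter_upwards [Metric.ball_mem_nhds e (by norm_num : (0 : ℝ) < 1 / 2)] with s hs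
      simpa [Real.dist_eq] using hs
    exact nhdsWithin_le_nhds this
  filter_upwards [self_mem_nhdsWithin, h1] with s hs hs'
  have hpos : 0 < s * (1 - s) := mul_pos hs.1 (by linarith [hs.2])
  rw [Real.norm_eq_abs, Real.norm_of_nonneg hpos.le]
  rcases he with rfl | rfl
  · rw [sub_zero, abs_of_pos hs.1] at *
    nlinarith [hs.1]
  · rw [abs_of_neg (by linarith [hs.2])] at *
    nlinarith [hs.2]

namespace IsContourData

/-- A boundary term θ K(c(s)) with K vanishing at the end point is O((s(1-s))^(-1/2)) times
O(s(1-s)), hence of size √(s(1-s)). -/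
lemma tendsto_theta_mul (hD : IsContourData L i U c S) {x : ℂ} (hx : x ∈ U) {e : ℝ}
    (he : e = 0 ∨ e = 1) {k : ℝ → ℂ} {K : ℂ → ℂ} (hK : DifferentiableAt ℂ K (c e))
    (hK0 : K (c e) = 0) (hk : ∀ s ∈ Ioo (0 : ℝ) 1, k s = K (c s)) :
    Tendsto (fun s => wSigma L x / S x s * k s) (𝓝[Ioo 0 1] e) (𝓝 0) := by
  obtain ⟨r, hr, -, M, hM, hle⟩ := hD.exists_inv_branch_le hx
  have h1 : (fun s => K (c s)) =O[𝓝[Ioo 0 1] e] fun s : ℝ => s * (1 - s) := by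
    have h2 := (hK.hasDerivAt.comp e (hD.hasDerivAt e)).isBigO_sub
    simp only [Function.comp_apply, hK0, sub_zero] at h2
    exact (h2.mono nhdsWithin_le_nhds).trans (isBigO_sub_mul_one_sub he)
  have h2 : (fun s => wSigma L x / S x s * k s) =O[𝓝[Ioo 0 1] e]
      fun s : ℝ => (Real.sqrt (s * (1 - s)))⁻¹ * (s * (1 - s)) := by
    refine IsBigO.mul ?_ (h1.congr' ?_ EventuallyEq.rfl)
    · refine IsBigO.of_bound (‖wSigma L x‖ * M) ?_
      filter_upwards [self_mem_nhdsWithin] with s hs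
      rw [div_eq_mul_inv, norm_mul, mul_assoc, Real.norm_of_nonneg (by positivity)]
      gcongr
      exact hle x (Metric.mem_closedBall_self hr.le) s hs
    · filter_upwards [self_mem_nhdsWithin] with s hs using (hk s hs).symm
  refine h2.trans_tendsto ?_
  have h3 : Tendsto (fun s : ℝ => Real.sqrt (s * (1 - s))) (𝓝[Ioo 0 1] e) (𝓝 0) := by
    have : ContinuousAt (fun s : ℝ => Real.sqrt (s * (1 - s))) e := by fun_prop
    have h4 : Real.sqrt (e * (1 - e)) = 0 := by rcases he with rfl | rfl <;> simp
    rw [← h4]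
    exact this.tendsto.mono_left nhdsWithin_le_nhds
  refine h3.congr' ?_
  filter_upwards [self_mem_nhdsWithin] with s hs
  have hpos : 0 < s * (1 - s) := mul_pos hs.1 (by linarith [hs.2])
  have := Real.mul_self_sqrt hpos.le
  field_simp
  linarith

end IsContourData

lemma wZeta_eq_add (L : PeriodPair) {w : ℂ} (hw : w ∉ L.lattice) :
    wZeta L w = 1 / w + deriv (sigmaProd L) w / sigmaProd L w := by
  have := logDeriv_sigmaProd L hw
  rw [logDeriv_apply] at this
  rw [this]
  ring

lemma integral_eq_zero_of_tendsto {G Ψ : ℝ → ℂ} (hΨ : ∀ s ∈ Ioo (0 : ℝ) 1, HasDerivAt Ψ (G s) s)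
    (hG : IntervalIntegrable G volume 0 1) (h0 : Tendsto Ψ (𝓝[Ioo 0 1] 0) (𝓝 0))
    (h1 : Tendsto Ψ (𝓝[Ioo 0 1] 1) (𝓝 0)) : ∫ s in (0 : ℝ)..1, G s = 0 := by
  rw [nhdsWithin_Ioo_eq_nhdsGT zero_lt_one] at h0
  rw [nhdsWithin_Ioo_eq_nhdsLT zero_lt_one] at h1
  rw [intervalIntegral.integral_eq_sub_of_hasDerivAt_of_tendsto zero_lt_one hΨ hG h0 h1, sub_self]

namespace IsContourData

lemma neg_add_two_notMem (i : Fin 4) {x y : ℂ} (h : x + y ∉ L.lattice) :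
    2 * halfPeriod L i - x - y ∉ L.lattice := by
  have h1 := add_notMem L (neg_notMem L h) (two_mul_halfPeriod_mem L i)
  rwa [show -(x + y) + 2 * halfPeriod L i = 2 * halfPeriod L i - x - y by ring] at h1

/-- In the bracket of `psi`, ζ(x-ξ) has coefficient (1-c)²/2 and ζ(x+ξ) has coefficient -(1+c)²/2.
The double zero absorbs the pole of ζ(x-ξ), so the bracket extends differentiably to c = 1. -/
lemma tendsto_psi_one (hD : IsContourData L i U c S) {al : ℂ} (ka : ℂ) (hal : 2 * al ∉ L.lattice)
    {x : ℂ} (hx : x ∈ U) (hxal : L.weierstrassP x ≠ L.weierstrassP al) :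
    Tendsto (psi L al ka i c S x) (𝓝[Ioo 0 1] 1) (𝓝 0) := by
  set ω := halfPeriod L i with hω
  have hxω := hD.sub_ne_zero hx
  have d0 := differentiable_phi L al ka
  have d1 := differentiable_deriv_phi L al ka
  have ds := differentiable_sigmaProd L
  have ds' := differentiable_deriv ds
  have hx2 := hD.notHalf x hx
  have hxL := hD.notMem hx
  have halL := notMem_of_two_mul_notMem L hal
  have hend : x + (ω + (x - ω) * c 1) ∉ L.lattice := by
    rw [hD.right, show x + (ω + (x - ω) * 1) = 2 * x by ring]
    exact hx2
  refine hD.tendsto_theta_mul hx (Or.inr rfl) (K := fun v =>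
    phi L al ka (ω + (x - ω) * v) * (1 / 2 * ((1 - v) / (x - ω) + (1 - v) ^ 2 *
        (deriv (sigmaProd L) ((x - ω) * (1 - v)) / sigmaProd L ((x - ω) * (1 - v))))
      + 2 * v * wZeta L x - 1 / 2 * (1 + v) ^ 2 * wZeta L (x + (ω + (x - ω) * v))
      + (coeffP L al x * v + coeffT L al ka x))
      + (1 + v ^ 2) * deriv (phi L al ka) (ω + (x - ω) * v)) ?_ ?_ ?_
  · have hz : DifferentiableAt ℂ (fun v => wZeta L (x + (ω + (x - ω) * v))) (c 1) :=
      DifferentiableAt.comp (c 1) (g := wZeta L) (f := fun v => x + (ω + (x - ω) * v))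
        (hasDerivAt_wZeta L hend).differentiableAt (by fun_prop)
    have hq : DifferentiableAt ℂ (fun v => deriv (sigmaProd L) ((x - ω) * (1 - v))
        / sigmaProd L ((x - ω) * (1 - v))) (c 1) := by
      refine DifferentiableAt.div (by fun_prop) (by fun_prop) ?_
      rw [hD.right, sub_self, mul_zero, sigmaProd_zero]
      exact one_ne_zero
    fun_prop
  -- At c = 1 the value is φ(x)(2ζ(x) - 2ζ(2x) + p + T) + 2φ'(x). It vanishes by the duplication
  -- formula and the formula for ζ(x-α).
  · simp only [hD.right, mul_one, sub_self, add_sub_cancel]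
    have h1 : x - al ∉ L.lattice := fun h => hxal ((weierstrassP_eq_iff L hxL halL).2 (Or.inr h))
    have h2 : x + al ∉ L.lattice := fun h => hxal ((weierstrassP_eq_iff L hxL halL).2 (Or.inl h))
    rw [deriv_phi L ka h1, wZeta_sub L hxL halL h2 h1, ← two_mul x, wZeta_two_mul L hx2, coeffP,
      coeffT]
    ring
  · intro s hs
    obtain ⟨h1, h2⟩ := hD.avoid x hx s hs
    have e1 : x - contour L i c x s = (x - ω) * (1 - c s) := by rw [contour]; ring
    have hne : 1 - c s ≠ 0 := fun h => h1 (by rw [e1, h, mul_zero]; exact zero_mem _)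
    have e2 := wZeta_eq_add L h1
    rw [lgx, lgxi, e2, e1, contour, ← hω]
    field_simp
    ring

/-- Here ζ(x+ξ) has the pole, at 2ω instead of 0; the quasi-period η of ζ moves it to the origin.
The terms in η cancel in the boundary value. -/
lemma tendsto_psi_zero (hD : IsContourData L i U c S) {al : ℂ} (ka : ℂ) (hal : 2 * al ∉ L.lattice)
    {x : ℂ} (hx : x ∈ U) (hxal : L.weierstrassP x ≠ L.weierstrassP al) :
    Tendsto (psi L al ka i c S x) (𝓝[Ioo 0 1] 0) (𝓝 0) := by
  obtain ⟨η, hη⟩ := exists_wZeta_add L (two_mul_halfPeriod_mem L i)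
  set ω := halfPeriod L i with hω
  have hxω := hD.sub_ne_zero hx
  have d0 := differentiable_phi L al ka
  have d1 := differentiable_deriv_phi L al ka
  have ds := differentiable_sigmaProd L
  have ds' := differentiable_deriv ds
  have hx2 := hD.notHalf x hx
  have hxL := hD.notMem hx
  have halL := notMem_of_two_mul_notMem L hal
  have hω2 := two_mul_halfPeriod_mem L i
  have hend : x - (ω + (x - ω) * c 0) ∉ L.lattice := by
    rw [hD.left, show x - (ω + (x - ω) * -1) = 2 * x - 2 * ω by ring]
    exact hD.two_sub_notMem hx
  refine hD.tendsto_theta_mul hx (Or.inl rfl) (K := fun v =>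
    phi L al ka (ω + (x - ω) * v) * (-1 / 2 * ((1 + v) / (x - ω) + (1 + v) ^ 2 *
        (deriv (sigmaProd L) ((x - ω) * (1 + v)) / sigmaProd L ((x - ω) * (1 + v)) + η))
      + 2 * v * wZeta L x + 1 / 2 * (1 - v) ^ 2 * wZeta L (x - (ω + (x - ω) * v))
      + (coeffP L al x * v + coeffT L al ka x))
      + (1 + v ^ 2) * deriv (phi L al ka) (ω + (x - ω) * v)) ?_ ?_ ?_
  · have hz : DifferentiableAt ℂ (fun v => wZeta L (x - (ω + (x - ω) * v))) (c 0) :=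
      DifferentiableAt.comp (c 0) (g := wZeta L) (f := fun v => x - (ω + (x - ω) * v))
        (hasDerivAt_wZeta L hend).differentiableAt (by fun_prop)
    have hq : DifferentiableAt ℂ (fun v => deriv (sigmaProd L) ((x - ω) * (1 + v))
        / sigmaProd L ((x - ω) * (1 + v))) (c 0) := by
      refine DifferentiableAt.div (by fun_prop) (by fun_prop) ?_
      rw [hD.left, add_neg_cancel, mul_zero, sigmaProd_zero]
      exact one_ne_zero
    fun_prop
  · have h1 : x - al ∉ L.lattice := fun h => hxal ((weierstrassP_eq_iff L hxL halL).2 (Or.inr h))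
    have h2 : x + al ∉ L.lattice := fun h => hxal ((weierstrassP_eq_iff L hxL halL).2 (Or.inl h))
    have h3 : ω + (x - ω) * -1 - al ∉ L.lattice := by
      rw [show ω + (x - ω) * -1 - al = 2 * ω - x - al by ring]
      exact neg_add_two_notMem i h2
    have h4 : wZeta L (ω + (x - ω) * -1 - al) = -wZeta L (x + al) + η := by
      rw [show ω + (x - ω) * -1 - al = -(x + al) + 2 * ω by ring, hη _ (neg_notMem L h2), wZeta_neg]
    have h5 : wZeta L (x - (ω + (x - ω) * -1)) = wZeta L (2 * x) - η := by
      have h6 := hη _ (hD.two_sub_notMem hx)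
      rw [sub_add_cancel] at h6
      rw [h6, show x - (ω + (x - ω) * -1) = 2 * x - 2 * ω by ring]
      ring
    have h7 := wZeta_sub L (y := -al) hxL (neg_notMem L halL) (by rwa [← sub_eq_add_neg])
      (by rwa [sub_neg_eq_add])
    rw [sub_neg_eq_add, wZeta_neg, L.derivWeierstrassP_neg, L.weierstrassP_neg] at h7
    simp only [hD.left]
    rw [deriv_phi L ka h3, h4, h5, h7, wZeta_two_mul L hx2, coeffP, coeffT]
    ring
  · intro s hs
    obtain ⟨h1, h2⟩ := hD.avoid x hx s hs
    have e1 : x + contour L i c x s = (x - ω) * (1 + c s) + 2 * ω := by rw [contour]; ring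
    have hw : (x - ω) * (1 + c s) ∉ L.lattice := fun h => h2 (by rw [e1]; exact add_mem h hω2)
    have hne : 1 + c s ≠ 0 := fun h => hw (by rw [h, mul_zero]; exact zero_mem _)
    rw [lgx, lgxi, e1, hη _ hw, wZeta_eq_add L hw, contour, ← hω]
    field_simp
    ring

/-! ### Differentiation under the integral and the equation for `fInt`. -/

lemma hasDerivAt_fInt (hD : IsContourData L i U c S) (al ka : ℂ) {x : ℂ} (hx : x ∈ U) :
    HasDerivAt (fInt L al ka i c S)
      (∫ s in (0 : ℝ)..1, deriv (fun y => fPull L al ka i c S y s) x) x :=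
  (hD.isParamIntegrand_fPull al ka).hasDerivAt hD.isOpen hx

lemma hasDerivAt_deriv_fInt (hD : IsContourData L i U c S) (al ka : ℂ) {x : ℂ} (hx : x ∈ U) :
    HasDerivAt (deriv (fInt L al ka i c S))
      (∫ s in (0 : ℝ)..1, deriv (fun y => deriv (fun x => fPull L al ka i c S x s) y) x) x := by
  refine (((hD.isParamIntegrand_fPull al ka).deriv hD.isOpen).hasDerivAt hD.isOpen
    hx).congr_of_eventuallyEq ?_
  filter_upwards [hD.isOpen.mem_nhds hx] with y hy using (hD.hasDerivAt_fInt al ka hy).deriv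

lemma fInt_ode (hD : IsContourData L i U c S) {al : ℂ} (ka : ℂ) (hal : 2 * al ∉ L.lattice)
    {x : ℂ} (hx : x ∈ U) (hxal : L.weierstrassP x ≠ L.weierstrassP al) :
    deriv (deriv (fInt L al ka i c S)) x + coeffP L al x * deriv (fInt L al ka i c S) x
      + coeffQ L al ka x * fInt L al ka i c S x = 0 := by
  have k0 := hD.isParamIntegrand_fPull al ka
  have k1 := k0.deriv hD.isOpen
  have k2 := k1.deriv hD.isOpen
  have i0 := (k0.intervalIntegrable hx).const_mul (coeffQ L al ka x)
  have i1 := (k1.intervalIntegrable hx).const_mul (coeffP L al x)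
  have i2 := k2.intervalIntegrable hx
  have h := integral_eq_zero_of_tendsto (fun s hs => hD.hasDerivAt_psi ka hal hx hxal hs)
    ((i2.add i1).add i0) (hD.tendsto_psi_zero ka hal hx hxal) (hD.tendsto_psi_one ka hal hx hxal)
  rw [intervalIntegral.integral_add (i2.add i1) i0, intervalIntegral.integral_add i2 i1,
    intervalIntegral.integral_const_mul, intervalIntegral.integral_const_mul] at h
  rw [(hD.hasDerivAt_deriv_fInt al ka hx).deriv, (hD.hasDerivAt_fInt al ka hx).deriv]
  exact h

end IsContourData

end EllipticFuchs

namespace EllipticFuchs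

open Filter Topology MeasureTheory Asymptotics

variable {L : PeriodPair} {i : Fin 4} {U : Set ℂ} {c : ℝ → ℂ} {S : ℂ → ℝ → ℂ}

/-! ### The second integral, along contours that avoid the lattice -/

/-- Points of a level set with nonzero velocity are isolated in it. -/
lemma countable_regular_level (c : ℝ → ℂ) (v : ℂ) : {s : ℝ | c s = v ∧ deriv c s ≠ 0}.Countable := by
  have : DiscreteTopology {s : ℝ | c s = v ∧ deriv c s ≠ 0} := by
    rw [discreteTopology_subtype_iff]
    rintro s ⟨-, hs⟩
    rw [inf_principal_eq_bot]
    filter_upwards [(differentiableAt_of_deriv_ne_zero hs).hasDerivAt.eventually_ne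
      (c := v) hs] with y hy hy'
    exact hy hy'.1
  exact countable_of_Lindelof_of_discrete (X := {s : ℝ | c s = v ∧ deriv c s ≠ 0})

lemma differentiableOn_gam (L : PeriodPair) (al ka : ℂ) :
    DifferentiableOn ℂ (gam L al ka) (L.lattice : Set ℂ)ᶜ := by
  have d0 := differentiable_phi L al ka
  have d1 := differentiable_deriv_phi L al ka
  have d2 := differentiable_deriv_deriv_phi L al ka
  have hP := L.differentiableOn_weierstrassP
  have hz : DifferentiableOn ℂ (wZeta L) (L.lattice : Set ℂ)ᶜ := fun x hx =>
    (hasDerivAt_wZeta L hx).differentiableAt.differentiableWithinAt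
  unfold gam
  fun_prop

/-- `gPull` with its removable singularities removed. -/
noncomputable def gReg (L : PeriodPair) (al ka : ℂ) (i : Fin 4) (c : ℝ → ℂ) (S : ℂ → ℝ → ℂ) (x : ℂ)
    (s : ℝ) : ℂ :=
  wSigma L x / S x s * gam L al ka (contour L i c x s) * ((x - halfPeriod L i) * deriv c s)

namespace IsContourData

lemma contour_notMem (hD : IsContourData L i U c S)
    (hav : ∀ x ∈ U, ∀ s ∈ Ioo (0 : ℝ) 1, contour L i c x s ∉ L.lattice) :
    ∀ x ∈ U, ∀ s ∈ Icc (0 : ℝ) 1, contour L i c x s ∈ (L.lattice : Set ℂ)ᶜ := by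
  rintro x hx s ⟨hs0, hs1⟩
  have hxL := hD.notMem hx
  rcases hs0.eq_or_lt with rfl | hs0
  · rw [contour, hD.left, show halfPeriod L i + (x - halfPeriod L i) * -1
      = 2 * halfPeriod L i - x - 0 by ring]
    exact neg_add_two_notMem i (by rwa [add_zero])
  rcases hs1.eq_or_lt with rfl | hs1
  · rw [contour, hD.right, mul_one, add_sub_cancel]
    exact hxL
  · exact hav x hx s ⟨hs0, hs1⟩

lemma isParamIntegrand_gReg (hD : IsContourData L i U c S)
    (hav : ∀ x ∈ U, ∀ s ∈ Ioo (0 : ℝ) 1, contour L i c x s ∉ L.lattice) (al ka : ℂ) :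
    IsParamIntegrand U (gReg L al ka i c S) :=
  hD.isParamIntegrand (isOpen_compl_lattice L) (differentiableOn_gam L al ka)
    (hD.contour_notMem hav)

/-- The two sides can differ only where ξ ∈ ±α + Λ, since the weight has a zero denominator there.
Parameters with c'(s) = 0 do no harm, because both sides carry the factor c'(s); the other ones form
a countable set. -/
lemma gPull_ae_eq (hD : IsContourData L i U c S)
    (hav : ∀ x ∈ U, ∀ s ∈ Ioo (0 : ℝ) 1, contour L i c x s ∉ L.lattice) {al : ℂ} (ka : ℂ)
    (hal : 2 * al ∉ L.lattice) {x : ℂ} (hx : x ∈ U) :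
    gPull L al ka i c S x =ᵐ[volume.restrict (Ioo (0 : ℝ) 1)] gReg L al ka i c S x := by
  have hxω := hD.sub_ne_zero hx
  set ω := halfPeriod L i with hω
  set B : Set ℝ := ⋃ l ∈ (L.lattice : Set ℂ),
    ({s : ℝ | c s = (l + al - ω) / (x - ω) ∧ deriv c s ≠ 0}
      ∪ {s : ℝ | c s = (l - al - ω) / (x - ω) ∧ deriv c s ≠ 0})
  have hB : B.Countable := (countable_lattice L).biUnion fun l _ =>
    (countable_regular_level c _).union (countable_regular_level c _)
  have hB0 : ∀ᵐ s ∂(volume.restrict (Ioo (0 : ℝ) 1)), s ∉ B :=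
    ae_restrict_of_ae (hB.ae_notMem volume)
  filter_upwards [hB0, ae_restrict_mem measurableSet_Ioo] with s hsB hs
  have h0 := hav x hx s hs
  rw [gPull, gReg, hD.deriv_contour, ← hω]
  by_cases hc : deriv c s = 0
  · simp [hc]
  have key : ∀ l ∈ L.lattice, ∀ y, c s = (l + y - ω) / (x - ω) ↔ contour L i c x s - y = l := by
    intro l _ y
    rw [eq_div_iff hxω, contour, ← hω]
    constructor <;> intro h <;> linear_combination h
  have h1 : contour L i c x s - al ∉ L.lattice := fun h =>
    hsB (mem_biUnion h (Or.inl ⟨(key _ h al).2 rfl, hc⟩))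
  have h2 : contour L i c x s + al ∉ L.lattice := fun h =>
    hsB (mem_biUnion h (Or.inr ⟨by
      rw [sub_eq_add_neg _ al]
      exact (key _ h (-al)).2 (by ring), hc⟩))
  rw [← gWeight_mul_phi L ka hal h0 h1 h2, fKernel, phi]
  ring

lemma intervalIntegrable_gPull (hD : IsContourData L i U c S)
    (hav : ∀ x ∈ U, ∀ s ∈ Ioo (0 : ℝ) 1, contour L i c x s ∉ L.lattice) {al : ℂ} (ka : ℂ)
    (hal : 2 * al ∉ L.lattice) {x : ℂ} (hx : x ∈ U) :
    IntervalIntegrable (gPull L al ka i c S x) volume 0 1 := by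
  rw [intervalIntegrable_iff_integrableOn_Ioo_of_le zero_le_one]
  exact ((hD.isParamIntegrand_gReg hav al ka).integrableOn hx).congr
    (hD.gPull_ae_eq hav ka hal hx).symm

lemma integral_gPull_eq (hD : IsContourData L i U c S)
    (hav : ∀ x ∈ U, ∀ s ∈ Ioo (0 : ℝ) 1, contour L i c x s ∉ L.lattice) {al : ℂ} (ka : ℂ)
    (hal : 2 * al ∉ L.lattice) {x : ℂ} (hx : x ∈ U) :
    ∫ s in (0 : ℝ)..1, gPull L al ka i c S x s = ∫ s in (0 : ℝ)..1, gReg L al ka i c S x s := by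
  simp only [intervalIntegral.integral_of_le zero_le_one, integral_Ioc_eq_integral_Ioo]
  exact integral_congr_ae (hD.gPull_ae_eq hav ka hal hx)

/-- A primitive along the contour of the first-order relation between `fPull` and `gReg`. -/
noncomputable def psiFirst (L : PeriodPair) (al ka : ℂ) (i : Fin 4) (c : ℝ → ℂ) (S : ℂ → ℝ → ℂ)
    (x : ℂ) (s : ℝ) : ℂ :=
  wSigma L x / S x s * (prim L al ka x (contour L i c x s)
    + L.derivWeierstrassP x * c s * phi L al ka (contour L i c x s))

/-- `kernel_first_order` makes θ times `prim` a primitive for the undeformed kernel; the added term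
℘'(x) cΦ accounts for the dependence of ξ on x. -/
lemma hasDerivAt_psiFirst (hD : IsContourData L i U c S)
    (hav : ∀ x ∈ U, ∀ s ∈ Ioo (0 : ℝ) 1, contour L i c x s ∉ L.lattice) {al : ℂ} (ka : ℂ)
    (hal : 2 * al ∉ L.lattice) {x : ℂ} (hx : x ∈ U) {s : ℝ} (hs : s ∈ Ioo (0 : ℝ) 1) :
    HasDerivAt (psiFirst L al ka i c S x)
      (L.derivWeierstrassP x * deriv (fun x => fPull L al ka i c S x s) x
        - (L.weierstrassP x - L.weierstrassP al) * (gReg L al ka i c S x s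
          - (ka ^ 2 + L.weierstrassP al + 2 * L.weierstrassP x) * fPull L al ka i c S x s)
        + ka * L.derivWeierstrassP al * fPull L al ka i c S x s) s := by
  obtain ⟨h1, h2⟩ := hD.avoid x hx s hs
  have h0 := hav x hx s hs
  have hξ := hD.hasDerivAt_contour x s
  have d0 := (differentiable_phi L al ka _).hasDerivAt.comp s hξ
  have dp := (hasDerivAt_prim L al ka x h0).comp s hξ
  have hall := (hD.hasDerivAt_theta hx hs).mul
    (dp.add (((hD.hasDerivAt s).const_mul (L.derivWeierstrassP x)).mul d0))
  have hrel := kernel_first_order L (ka := ka) hal (hD.notMem hx) h0 h1 h2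
  rw [(hD.hasDerivAt_fPull al ka hx hs).deriv, hD.fPull_eq, gReg]
  refine HasDerivAt.congr_deriv (f := psiFirst L al ka i c S x) hall ?_
  simp only [Function.comp_apply, Pi.mul_apply, Pi.add_apply]
  linear_combination -(wSigma L x / S x s) * (x - halfPeriod L i) * deriv c s * hrel

lemma tendsto_psiFirst (hD : IsContourData L i U c S)
    (hav : ∀ x ∈ U, ∀ s ∈ Ioo (0 : ℝ) 1, contour L i c x s ∉ L.lattice) (al ka : ℂ) {x : ℂ}
    (hx : x ∈ U) {e : ℝ} (he : e = 0 ∨ e = 1) :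
    Tendsto (psiFirst L al ka i c S x) (𝓝[Ioo 0 1] e) (𝓝 0) := by
  set ω := halfPeriod L i with hω
  have d0 := differentiable_phi L al ka
  have hend : ω + (x - ω) * c e ∉ L.lattice :=
    hD.contour_notMem hav x hx e (by rcases he with rfl | rfl <;> simp)
  refine hD.tendsto_theta_mul hx he (K := fun v => prim L al ka x (ω + (x - ω) * v)
    + L.derivWeierstrassP x * v * phi L al ka (ω + (x - ω) * v)) ?_ ?_ fun s hs => rfl
  · have hp : DifferentiableAt ℂ (fun v => prim L al ka x (ω + (x - ω) * v)) (c e) :=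
      DifferentiableAt.comp (c e) (g := prim L al ka x) (f := fun v => ω + (x - ω) * v)
        (hasDerivAt_prim L al ka x hend).differentiableAt (by fun_prop)
    fun_prop
  -- At both ends ℘(ξ) = ℘(x) and ℘'(ξ) = c ℘'(x), so `prim` reduces to -℘'(x) c φ, which the second
  -- term cancels.
  · rcases he with rfl | rfl
    · have e1 : ω + (x - ω) * -1 = -x + ((⟨2 * ω, two_mul_halfPeriod_mem L i⟩ : L.lattice) : ℂ) := by
        simp only
        ring
      simp only [hD.left, prim]
      rw [e1, L.weierstrassP_add_coe, L.derivWeierstrassP_add_coe, L.weierstrassP_neg,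
        L.derivWeierstrassP_neg]
      ring
    · simp only [hD.right, prim, mul_one, add_sub_cancel]
      ring

lemma differentiableAt_integral_gReg (hD : IsContourData L i U c S)
    (hav : ∀ x ∈ U, ∀ s ∈ Ioo (0 : ℝ) 1, contour L i c x s ∉ L.lattice) (al ka : ℂ) {x : ℂ}
    (hx : x ∈ U) : DifferentiableAt ℂ (fun x => ∫ s in (0 : ℝ)..1, gReg L al ka i c S x s) x :=
  ((hD.isParamIntegrand_gReg hav al ka).hasDerivAt hD.isOpen hx).differentiableAt

/-- The first-order relation between the two integrals. -/
lemma first_order_relation (hD : IsContourData L i U c S)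
    (hav : ∀ x ∈ U, ∀ s ∈ Ioo (0 : ℝ) 1, contour L i c x s ∉ L.lattice) {al : ℂ} (ka : ℂ)
    (hal : 2 * al ∉ L.lattice) {x : ℂ} (hx : x ∈ U) :
    L.derivWeierstrassP x * deriv (fInt L al ka i c S) x
      = (L.weierstrassP x - L.weierstrassP al) * ((∫ s in (0 : ℝ)..1, gReg L al ka i c S x s)
          - (ka ^ 2 + L.weierstrassP al + 2 * L.weierstrassP x) * fInt L al ka i c S x)
        - ka * L.derivWeierstrassP al * fInt L al ka i c S x := by
  have k0 := hD.isParamIntegrand_fPull al ka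
  have i0 := k0.intervalIntegrable hx
  have i1 := (k0.deriv hD.isOpen).intervalIntegrable hx
  have ig := (hD.isParamIntegrand_gReg hav al ka).intervalIntegrable hx
  have j1 := i1.const_mul (L.derivWeierstrassP x)
  have j2 := ig.sub (i0.const_mul (ka ^ 2 + L.weierstrassP al + 2 * L.weierstrassP x))
  have j3 := j2.const_mul (L.weierstrassP x - L.weierstrassP al)
  have j4 := i0.const_mul (ka * L.derivWeierstrassP al)
  have h := integral_eq_zero_of_tendsto
    (fun s hs => hD.hasDerivAt_psiFirst hav ka hal hx hs) ((j1.sub j3).add j4)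
    (hD.tendsto_psiFirst hav al ka hx (Or.inl rfl)) (hD.tendsto_psiFirst hav al ka hx (Or.inr rfl))
  rw [intervalIntegral.integral_add (j1.sub j3) j4, intervalIntegral.integral_sub j1 j3,
    intervalIntegral.integral_const_mul, intervalIntegral.integral_const_mul,
    intervalIntegral.integral_const_mul, intervalIntegral.integral_sub ig (i0.const_mul _),
    intervalIntegral.integral_const_mul] at h
  rw [(hD.hasDerivAt_fInt al ka hx).deriv, fInt]
  linear_combination h

end IsContourData

end EllipticFuchs

namespace EllipticFuchs

/-! ### The coefficients of the Fuchsian equations in terms of the roots `e₁, e₂, e₃` -/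

/-- The shape shared by the three residue matrices of `D_Y(0,0,0,1)`. -/
noncomputable def rootResMatrix (A A' ka k d n e q : ℂ) : Matrix (Fin 2) (Fin 2) ℂ :=
  (1 / (4 * n)) •
    !![(A - e) * (ka ^ 2 + A + 2 * e) - ka * A', -(4 * k * d * (A - e));
      ((A - e) * (ka ^ 2 + A + 2 * e) ^ 2 - 2 * ka * A' * (ka ^ 2 + A + 2 * e)
        + 4 * ka ^ 2 * q) / (4 * k * d),
      -((A - e) * (ka ^ 2 + A + 2 * e) - ka * A')]

/-- The lower left entry is u²/w. In u² the only square of A' is divisible by A - e through `hA`, so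
the factor A - e of w cancels. -/
lemma resMatrix_eq_rootResMatrix {A A' ka k d n e q u w : ℂ} (hk : k ≠ 0) (hd : d ≠ 0)
    (hn : n ≠ 0) (he : A - e ≠ 0) (hA : A' ^ 2 = 4 * (A - e) * q)
    (hu : u = 1 / (4 * n) * ((A - e) * (ka ^ 2 + A + 2 * e) - ka * A'))
    (hw : w = k * d * (A - e) / n) : resMatrix u w 0 = rootResMatrix A A' ka k d n e q := by
  rw [hu, hw, resMatrix, rootResMatrix]
  ext a b
  fin_cases a <;> fin_cases b <;> simp
  · field_simp
  · field_simp
    linear_combination ka ^ 2 * hA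
  · ring

section

variable {e1 e2 e3 A A' ka k : ℂ}

lemma dyMatrix_eq (P : ℂ) (h0 : e1 + e2 + e3 = 0) (h21 : e2 ≠ e1) (h31 : e3 ≠ e1) (h32 : e3 ≠ e2)
    (hA1 : A ≠ e1) (hA2 : A ≠ e2) (hA3 : A ≠ e3) (hk : k ≠ 0) (hA' : A' ≠ 0)
    (hA : A' ^ 2 = 4 * (A - e1) * (A - e2) * (A - e3)) :
    dyMatrix 0 0 0 1 ((e3 - e1) / (e2 - e1)) ((A - e1) / (e2 - e1)) (-((e2 - e1) * ka / A')) k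
        ((P - e1) / (e2 - e1))
      = ((e2 - e1) / (P - e1)) • rootResMatrix A A' ka k (e2 - e1) ((e1 - e2) * (e1 - e3)) e1
          ((A - e2) * (A - e3))
        + ((e2 - e1) / (P - e2)) • rootResMatrix A A' ka k (e2 - e1) ((e2 - e1) * (e2 - e3)) e2
          ((A - e1) * (A - e3))
        + ((e2 - e1) / (P - e3)) • rootResMatrix A A' ka k (e2 - e1) ((e3 - e1) * (e3 - e2)) e3
          ((A - e1) * (A - e2)) := by
  have a21 := sub_ne_zero.2 h21
  have a31 := sub_ne_zero.2 h31
  have a32 := sub_ne_zero.2 h32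
  have a12 := sub_ne_zero.2 h21.symm
  have a13 := sub_ne_zero.2 h31.symm
  have a23 := sub_ne_zero.2 h32.symm
  have b1 := sub_ne_zero.2 hA1
  have b2 := sub_ne_zero.2 hA2
  have b3 := sub_ne_zero.2 hA3
  -- Here m is -μ/(e₂-e₁). After this substitution A' enters the entries u and w only through A'²,
  -- and the cubic equation makes them rational in A, the roots, m and k.
  obtain ⟨m, hm⟩ : ∃ m, ka = m * A' := ⟨ka / A', by field_simp⟩
  have hmu : (e2 - e1) * ka / A' = (e2 - e1) * m := by rw [hm]; field_simp
  have h1 : ka ^ 2 = m ^ 2 * (4 * (A - e1) * (A - e2) * (A - e3)) := by rw [hm, mul_pow, hA]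
  have h2 : ka * A' = m * (4 * (A - e1) * (A - e2) * (A - e3)) := by rw [hm, mul_assoc, ← sq, hA]
  have hz1 : ∀ x : ℂ, (x - e1) / (e2 - e1) - 1 = (x - e2) / (e2 - e1) := fun x => by
    field_simp; ring
  have hzt : ∀ x : ℂ, (x - e1) / (e2 - e1) - (e3 - e1) / (e2 - e1) = (x - e3) / (e2 - e1) :=
    fun x => by field_simp; ring
  have hs : e1 = -e2 - e3 := by linear_combination h0
  rw [dyMatrix]
  congr 1
  congr 1
  · congr 1
    · rw [one_div_div]
    · refine resMatrix_eq_rootResMatrix hk a21 (mul_ne_zero a12 a13) b1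
        (by rw [hA]; ring) ?_ ?_
      · rw [h1, h2, hmu]
        simp only [u0, kap1, hz1, hzt]
        rw [show (e1 - e2) * (e1 - e3) = (e2 - e1) * (e3 - e1) by ring]
        field_simp
        rw [hs]
        ring
      · rw [show (e1 - e2) * (e1 - e3) = (e2 - e1) * (e3 - e1) by ring]
        field_simp
  · congr 1
    · rw [hz1, one_div_div]
    · refine resMatrix_eq_rootResMatrix hk a21 (mul_ne_zero a21 a23) b2
        (by rw [hA]; ring) ?_ ?_
      · rw [h1, h2, hmu]
        simp only [u1, kap1, hz1, hzt]
        rw [show (e2 - e1) * (e2 - e3) = -((e2 - e1) * (e3 - e2)) by ring]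
        field_simp
        rw [hs]
        ring
      · rw [hz1, hz1, show (e2 - e1) * (e2 - e3) = -((e2 - e1) * (e3 - e2)) by ring]
        field_simp
  · congr 1
    · rw [hzt, one_div_div]
    · refine resMatrix_eq_rootResMatrix hk a21 (mul_ne_zero a31 a32) b3
        (by rw [hA]; ring) ?_ ?_
      · rw [h1, h2, hmu]
        simp only [ut, kap1, hz1, hzt]
        field_simp
        rw [hs]
        ring
      · rw [hzt, hz1]
        field_simp

lemma dyMatrix_mulVec {P P' f f' G G' : ℂ} (h0 : e1 + e2 + e3 = 0) (h21 : e2 ≠ e1) (h31 : e3 ≠ e1)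
    (h32 : e3 ≠ e2) (hA1 : A ≠ e1) (hA2 : A ≠ e2) (hA3 : A ≠ e3) (hk : k ≠ 0) (hA' : A' ≠ 0)
    (hA : A' ^ 2 = 4 * (A - e1) * (A - e2) * (A - e3)) (hP1 : P ≠ e1) (hP2 : P ≠ e2) (hP3 : P ≠ e3)
    (hP' : P' ≠ 0) (hP : P' ^ 2 = 4 * (P - e1) * (P - e2) * (P - e3))
    (hf : P' * f' = (P - A) * (G - (ka ^ 2 + A + 2 * P) * f) - ka * A' * f)
    (hG : P' * G' = (ka ^ 2 * (4 * (P ^ 2 + P * A + A ^ 2) + 4 * (e1 * e2 + e1 * e3 + e2 * e3))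
        + P' ^ 2 - (ka ^ 2 + A + 2 * P) ^ 2 * (P - A) - 2 * ka * A' * (ka ^ 2 + A + 2 * P)) * f
      + ((ka ^ 2 + A + 2 * P) * (P - A) + ka * A') * G) :
    (dyMatrix 0 0 0 1 ((e3 - e1) / (e2 - e1)) ((A - e1) / (e2 - e1)) (-((e2 - e1) * ka / A')) k
        ((P - e1) / (e2 - e1))).mulVec ![f, 1 / (4 * k * (e2 - e1)) * G]
      = ![f' * ((e2 - e1) / P'), 1 / (4 * k * (e2 - e1)) * (G' * ((e2 - e1) / P'))] := by
  have a21 := sub_ne_zero.2 h21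
  have a31 := sub_ne_zero.2 h31
  have a32 := sub_ne_zero.2 h32
  have b1 := sub_ne_zero.2 hP1
  have b2 := sub_ne_zero.2 hP2
  have b3 := sub_ne_zero.2 hP3
  -- Expanding by P' produces P'f', P'G' and P'², exactly the quantities that the hypotheses give
  -- without square roots.
  have hf2 : f' * ((e2 - e1) / P') = (e2 - e1) * (P' * f') / P' ^ 2 := by field_simp
  have hG2 : G' * ((e2 - e1) / P') = (e2 - e1) * (P' * G') / P' ^ 2 := by field_simp
  have hs : e1 = -e2 - e3 := by linear_combination h0
  have s1 : (e1 - e2) * (e1 - e3) = (e2 - e1) * (e3 - e1) := by ring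
  have s2 : (e2 - e1) * (e2 - e3) = -((e2 - e1) * (e3 - e2)) := by ring
  rw [dyMatrix_eq P h0 h21 h31 h32 hA1 hA2 hA3 hk hA' hA, hf2, hG2, hf, hG, hP, s1, s2]
  ext a
  fin_cases a
  · simp [rootResMatrix, Matrix.mulVec, dotProduct, Fin.sum_univ_two]
    field_simp
    rw [hs]
    ring
  · simp [rootResMatrix, Matrix.mulVec, dotProduct, Fin.sum_univ_two]
    field_simp
    rw [hs]
    ring

/-- The coefficients of `D_{y₁}(0,0,0,1)` under the change of variable `z = (P - e₁) / (e₂ - e₁)`. -/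
lemma dy1_coeff_eq {P : ℂ} (h0 : e1 + e2 + e3 = 0) (h21 : e2 ≠ e1) (h31 : e3 ≠ e1)
    (h32 : e3 ≠ e2) (hA' : A' ≠ 0) (hA : A' ^ 2 = 4 * (A - e1) * (A - e2) * (A - e3))
    (hP1 : P ≠ e1) (hP2 : P ≠ e2) (hP3 : P ≠ e3) (hPA : P ≠ A) :
    ∀ z t lam mu, z = (P - e1) / (e2 - e1) → t = (e3 - e1) / (e2 - e1) →
      lam = (A - e1) / (e2 - e1) → mu = -((e2 - e1) * ka / A') →
    (1 - 0) / z + (1 - 0) / (z - 1) + (1 - 0) / (z - t) - 1 / (z - lam)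
        = (e2 - e1) * (1 / (P - e1) + 1 / (P - e2) + 1 / (P - e3) - 1 / (P - A)) ∧
    kap1 0 0 0 1 * (kap2 0 0 0 1 + 1) / (z * (z - 1))
        + lam * (lam - 1) * mu / (z * (z - 1) * (z - lam))
        - t * (t - 1) * hamH 0 0 0 1 t lam mu / (z * (z - 1) * (z - t))
      = (e2 - e1) ^ 2 / (4 * (P - e1) * (P - e2) * (P - e3))
        * (-ka ^ 2 - A' / (P - A) * ka + P - A) := by
  rintro z t lam mu rfl rfl rfl rfl
  have a21 := sub_ne_zero.2 h21
  have a31 := sub_ne_zero.2 h31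
  have a32 := sub_ne_zero.2 h32
  have b1 := sub_ne_zero.2 hP1
  have b2 := sub_ne_zero.2 hP2
  have b3 := sub_ne_zero.2 hP3
  have b4 := sub_ne_zero.2 hPA
  obtain ⟨m, hm⟩ : ∃ m, ka = m * A' := ⟨ka / A', by field_simp⟩
  have hmu : (e2 - e1) * ka / A' = (e2 - e1) * m := by rw [hm]; field_simp
  have h1 : ka ^ 2 = m ^ 2 * (4 * (A - e1) * (A - e2) * (A - e3)) := by rw [hm, mul_pow, hA]
  have h2 : A' / (P - A) * ka = m * (4 * (A - e1) * (A - e2) * (A - e3)) / (P - A) := by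
    rw [← hA, hm]; ring
  have hz1 : ∀ x : ℂ, (x - e1) / (e2 - e1) - 1 = (x - e2) / (e2 - e1) := fun x => by
    field_simp; ring
  have hz : ∀ x y : ℂ, (x - e1) / (e2 - e1) - (y - e1) / (e2 - e1) = (x - y) / (e2 - e1) :=
    fun x y => by field_simp; ring
  have hs : e1 = -e2 - e3 := by linear_combination h0
  constructor
  · rw [hz1, hz, hz]
    field_simp
    ring
  · rw [hmu, h1, h2]
    simp only [hz1, hz, hamH, kap1, kap2]
    field_simp
    rw [hs]
    ring

end

end EllipticFuchs

namespace EllipticFuchs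

open Filter Topology MeasureTheory

variable {L : PeriodPair} {i : Fin 4} {U : Set ℂ} {c : ℝ → ℂ} {S : ℂ → ℝ → ℂ}

/-! ### The differential equations in the variable `x` -/

/-- The logarithmic derivative of ℘'² = 4(℘-e₁)(℘-e₂)(℘-e₃); it turns ℘''/℘' into the sum over the
roots. -/
lemma two_mul_second_deriv_div (L : PeriodPair) {x : ℂ} (hx : 2 * x ∉ L.lattice) :
    2 * (6 * L.weierstrassP x ^ 2 - L.g₂ / 2) = L.derivWeierstrassP x ^ 2
      * (1 / (L.weierstrassP x - eVal L 1) + 1 / (L.weierstrassP x - eVal L 2)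
        + 1 / (L.weierstrassP x - eVal L 3)) := by
  obtain ⟨h0, h1, -⟩ := invariants_eq L
  obtain ⟨n1, n2, n3⟩ := weierstrassP_ne_eVal L hx
  have b1 := sub_ne_zero.2 n1
  have b2 := sub_ne_zero.2 n2
  have b3 := sub_ne_zero.2 n3
  rw [derivWeierstrassP_sq_eq_prod L (notMem_of_two_mul_notMem L hx), h1]
  field_simp
  linear_combination 8 * L.weierstrassP x * h0

lemma coeffP_eq (L : PeriodPair) (al : ℂ) {x : ℂ} (hx : 2 * x ∉ L.lattice) :
    coeffP L al x = ((1 / (2 * (L.weierstrassP x - eVal L 1))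
        + 1 / (2 * (L.weierstrassP x - eVal L 2)) + 1 / (2 * (L.weierstrassP x - eVal L 3)))
      - 1 / (L.weierstrassP x - L.weierstrassP al)) * L.derivWeierstrassP x := by
  have h := two_mul_second_deriv_div L hx
  have hP := derivWeierstrassP_ne_zero L hx
  have e : (6 * L.weierstrassP x ^ 2 - L.g₂ / 2) / L.derivWeierstrassP x
      = 1 / 2 * (1 / (L.weierstrassP x - eVal L 1) + 1 / (L.weierstrassP x - eVal L 2)
        + 1 / (L.weierstrassP x - eVal L 3)) * L.derivWeierstrassP x := by
    rw [div_eq_iff hP]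
    linear_combination h / 2
  rw [coeffP, e]
  simp only [one_div, mul_inv]
  ring

namespace IsContourData

/-- The first-order relation, differentiated. -/
lemma first_order_relation_deriv (hD : IsContourData L i U c S)
    (hav : ∀ x ∈ U, ∀ s ∈ Ioo (0 : ℝ) 1, contour L i c x s ∉ L.lattice) {al : ℂ} (ka : ℂ)
    (hal : 2 * al ∉ L.lattice) {x : ℂ} (hx : x ∈ U) :
    (6 * L.weierstrassP x ^ 2 - L.g₂ / 2) * deriv (fInt L al ka i c S) x
        + L.derivWeierstrassP x * deriv (deriv (fInt L al ka i c S)) x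
      = L.derivWeierstrassP x * ((∫ s in (0 : ℝ)..1, gReg L al ka i c S x s)
          - (ka ^ 2 + L.weierstrassP al + 2 * L.weierstrassP x) * fInt L al ka i c S x)
        + (L.weierstrassP x - L.weierstrassP al)
          * (deriv (fun x => ∫ s in (0 : ℝ)..1, gReg L al ka i c S x s) x
            - (2 * L.derivWeierstrassP x * fInt L al ka i c S x
              + (ka ^ 2 + L.weierstrassP al + 2 * L.weierstrassP x)
                * deriv (fInt L al ka i c S) x))
        - ka * L.derivWeierstrassP al * deriv (fInt L al ka i c S) x := by
  have hxL := hD.notMem hx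
  have hP := hasDerivAt_weierstrassP L hxL
  have hP1 := hasDerivAt_derivWeierstrassP L hxL
  have hf := (hD.hasDerivAt_fInt al ka hx).differentiableAt.hasDerivAt
  have hf1 := (hD.hasDerivAt_deriv_fInt al ka hx).differentiableAt.hasDerivAt
  have hG := (hD.differentiableAt_integral_gReg hav al ka hx).hasDerivAt
  have h1 := hP1.mul hf1
  have h2 := ((hP.sub_const (L.weierstrassP al)).mul
    (hG.sub (((hP.const_mul 2).const_add (ka ^ 2 + L.weierstrassP al)).mul hf))).sub
    (hf.const_mul (ka * L.derivWeierstrassP al))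
  refine (h1.congr_of_eventuallyEq ?_).unique h2
  filter_upwards [hD.isOpen.mem_nhds hx] with y hy
  exact (hD.first_order_relation hav ka hal hy).symm

/-- Second row of the system. It is first found where ℘(x) ≠ ℘(α), by eliminating f'' and f' from
the differentiated first-order relation; both sides are continuous, so it persists at ℘(x) = ℘(α),
where the scalar equation is singular. -/
lemma deriv_integral_gReg (hD : IsContourData L i U c S)
    (hav : ∀ x ∈ U, ∀ s ∈ Ioo (0 : ℝ) 1, contour L i c x s ∉ L.lattice) {al : ℂ} (ka : ℂ)
    (hal : 2 * al ∉ L.lattice) {x : ℂ} (hx : x ∈ U) :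
    L.derivWeierstrassP x * deriv (fun x => ∫ s in (0 : ℝ)..1, gReg L al ka i c S x s) x
      = (ka ^ 2 * (4 * (L.weierstrassP x ^ 2 + L.weierstrassP x * L.weierstrassP al
            + L.weierstrassP al ^ 2) - L.g₂)
          + L.derivWeierstrassP x ^ 2
          - (ka ^ 2 + L.weierstrassP al + 2 * L.weierstrassP x) ^ 2
            * (L.weierstrassP x - L.weierstrassP al)
          - 2 * ka * L.derivWeierstrassP al
            * (ka ^ 2 + L.weierstrassP al + 2 * L.weierstrassP x)) * fInt L al ka i c S x
        + ((ka ^ 2 + L.weierstrassP al + 2 * L.weierstrassP x)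
            * (L.weierstrassP x - L.weierstrassP al) + ka * L.derivWeierstrassP al)
          * ∫ s in (0 : ℝ)..1, gReg L al ka i c S x s := by
  have hG : DifferentiableOn ℂ (fun x => ∫ s in (0 : ℝ)..1, gReg L al ka i c S x s) U :=
    fun y hy => (hD.differentiableAt_integral_gReg hav al ka hy).differentiableWithinAt
  have hG1 := (hG.deriv hD.isOpen).continuousOn
  have hG0 := hG.continuousOn
  have hP : ContinuousOn L.weierstrassP U := fun y hy =>
    (hasDerivAt_weierstrassP L (hD.notMem hy)).continuousAt.continuousWithinAt
  have hP1 : ContinuousOn L.derivWeierstrassP U := fun y hy =>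
    (hasDerivAt_derivWeierstrassP L (hD.notMem hy)).continuousAt.continuousWithinAt
  have hf : ContinuousOn (fInt L al ka i c S) U := fun y hy =>
    (hD.hasDerivAt_fInt al ka hy).continuousAt.continuousWithinAt
  have halL := notMem_of_two_mul_notMem L hal
  have key : ∀ {F₁ F₂ : ℂ → ℂ}, ContinuousOn F₁ U → ContinuousOn F₂ U →
      (∀ y ∈ U, L.weierstrassP y ≠ L.weierstrassP al → F₁ y = F₂ y) → F₁ x = F₂ x :=
    fun h1 h2 h => eqOn_of_eqOn_diff_countable hD.isOpen
      ((countable_preimage_lattice L (f := fun y => y + al) (add_left_injective al)).union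
        (countable_preimage_lattice L (f := fun y => y - al) sub_left_injective)) h1 h2
      (fun y hy => h y hy.1 fun h => hy.2 ((weierstrassP_eq_iff L (hD.notMem hy.1) halL).1 h)) hx
  refine key (F₁ := fun x => L.derivWeierstrassP x * deriv _ x) (F₂ := fun x =>
    (ka ^ 2 * (4 * (L.weierstrassP x ^ 2 + L.weierstrassP x * L.weierstrassP al
            + L.weierstrassP al ^ 2) - L.g₂)
          + L.derivWeierstrassP x ^ 2
          - (ka ^ 2 + L.weierstrassP al + 2 * L.weierstrassP x) ^ 2
            * (L.weierstrassP x - L.weierstrassP al)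
          - 2 * ka * L.derivWeierstrassP al
            * (ka ^ 2 + L.weierstrassP al + 2 * L.weierstrassP x)) * fInt L al ka i c S x
        + ((ka ^ 2 + L.weierstrassP al + 2 * L.weierstrassP x)
            * (L.weierstrassP x - L.weierstrassP al) + ka * L.derivWeierstrassP al)
          * ∫ s in (0 : ℝ)..1, gReg L al ka i c S x s) (hP1.mul hG1) (by fun_prop) ?_
  intro y hy hyal
  have hyL := hD.notMem hy
  have hPA := _root_.sub_ne_zero.2 hyal
  have hP0 := derivWeierstrassP_ne_zero L (hD.notHalf y hy)
  have r1 := hD.first_order_relation hav ka hal hy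
  have r2 := hD.first_order_relation_deriv hav ka hal hy
  have ode := hD.fInt_ode ka hal hy hyal
  have s1 := L.derivWeierstrassP_sq y hyL
  have s2 := L.derivWeierstrassP_sq al halL
  simp only [coeffP, coeffQ] at ode
  have ode' : L.derivWeierstrassP y ^ 2 * (L.weierstrassP y - L.weierstrassP al)
        * deriv (deriv (fInt L al ka i c S)) y
      + ((6 * L.weierstrassP y ^ 2 - L.g₂ / 2) * L.derivWeierstrassP y
          * (L.weierstrassP y - L.weierstrassP al) - L.derivWeierstrassP y ^ 3)
        * deriv (fInt L al ka i c S) y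
      + L.derivWeierstrassP y ^ 2 * ((L.weierstrassP y - L.weierstrassP al)
          * (-ka ^ 2 + L.weierstrassP y - L.weierstrassP al) - L.derivWeierstrassP al * ka)
        * fInt L al ka i c S y = 0 := by
    field_simp at ode
    linear_combination L.derivWeierstrassP y / 2 * ode
  -- One factor ℘(x)-℘(α) comes from the first-order relation, one from clearing the scalar
  -- equation. The term in `s1 - s2` uses that ℘'(x)²-℘'(α)² is divisible by ℘(x)-℘(α).
  refine mul_left_cancel₀ (pow_ne_zero 2 hPA) ?_
  linear_combination -L.derivWeierstrassP y * (L.weierstrassP y - L.weierstrassP al) * r2 + ode'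
    + ((L.weierstrassP y - L.weierstrassP al) * ((L.weierstrassP y - L.weierstrassP al)
      * (ka ^ 2 + L.weierstrassP al + 2 * L.weierstrassP y) + ka * L.derivWeierstrassP al)
      + L.derivWeierstrassP y ^ 2) * r1
    + ka ^ 2 * (L.weierstrassP y - L.weierstrassP al) * fInt L al ka i c S y * (s1 - s2)

end IsContourData

end EllipticFuchs

namespace EllipticFuchs

open Filter Topology MeasureTheory

variable {L : PeriodPair} {i : Fin 4} {U V : Set ℂ} {c : ℝ → ℂ} {S : ℂ → ℝ → ℂ} {φ : ℂ → ℂ}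

/-! ### The differential equations in the variable `z` -/

lemma hasDerivAt_zOf (L : PeriodPair) {x : ℂ} (hx : x ∉ L.lattice) :
    HasDerivAt (zOf L) (L.derivWeierstrassP x / (eVal L 2 - eVal L 1)) x :=
  ((hasDerivAt_weierstrassP L hx).sub_const _).div_const _

namespace IsContourData

/-- Off the half-periods ℘' does not vanish, so a continuous right inverse of z is automatically
holomorphic. -/
lemma hasDerivAt_inverseBranch (hD : IsContourData L i U c S) (hφ : IsInverseBranch L U V φ)
    {z : ℂ} (hz : z ∈ V) :
    HasDerivAt φ ((eVal L 2 - eVal L 1) / L.derivWeierstrassP (φ z)) z := by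
  have hx := hφ.mapsTo hz
  have hV := hφ.isOpen.mem_nhds hz
  have h := HasDerivAt.of_local_left_inverse (hφ.continuousOn.continuousAt hV)
    (hasDerivAt_zOf L (hD.notMem hx))
    (div_ne_zero (derivWeierstrassP_ne_zero L (hD.notHalf _ hx))
      (_root_.sub_ne_zero.2 (eVal_ne L).1))
    (by filter_upwards [hV] with y hy using hφ.right_inv y hy)
  rwa [inv_div] at h

lemma isSolutionDY (hD : IsContourData L i U c S)
    (hav : ∀ x ∈ U, ∀ s ∈ Ioo (0 : ℝ) 1, contour L i c x s ∉ L.lattice) {al : ℂ} (ka : ℂ) {k : ℂ}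
    (hal : 2 * al ∉ L.lattice) (hk : k ≠ 0) (hφ : IsInverseBranch L U V φ) :
    IsSolutionDY 0 0 0 1 (tOf L) (zOf L al) (muOf L al ka) k V
      (fun z => ![fInt L al ka i c S (φ z), gInt L al ka k i c S (φ z)]) := by
  intro z hz
  have hx := hφ.mapsTo hz
  have hφ' := hD.hasDerivAt_inverseBranch hφ hz
  have halL := notMem_of_two_mul_notMem L hal
  obtain ⟨h0, hg2, -⟩ := invariants_eq L
  obtain ⟨h21, h31, h32⟩ := eVal_ne L
  obtain ⟨a1, a2, a3⟩ := weierstrassP_ne_eVal L hal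
  obtain ⟨p1, p2, p3⟩ := weierstrassP_ne_eVal L (hD.notHalf _ hx)
  have hf := (hD.hasDerivAt_fInt al ka hx).differentiableAt.hasDerivAt.comp z hφ'
  have hg := ((hD.differentiableAt_integral_gReg hav al ka hx).hasDerivAt.comp z hφ').const_mul
    (1 / (4 * k * (eVal L 2 - eVal L 1)))
  have hgInt : ∀ x ∈ U, gInt L al ka k i c S x = 1 / (4 * k * (eVal L 2 - eVal L 1))
      * ∫ s in (0 : ℝ)..1, gReg L al ka i c S x s := fun x hx => by
    rw [gInt, hD.integral_gPull_eq hav ka hal hx]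
  have key := dyMatrix_mulVec (k := k) h0 h21 h31 h32 a1 a2 a3 hk (derivWeierstrassP_ne_zero L hal)
    (derivWeierstrassP_sq_eq_prod L halL) p1 p2 p3
    (derivWeierstrassP_ne_zero L (hD.notHalf _ hx))
    (derivWeierstrassP_sq_eq_prod L (hD.notMem hx)) (hD.first_order_relation hav ka hal hx)
    (by rw [hD.deriv_integral_gReg hav ka hal hx, hg2]; ring)
  have hzz : (L.weierstrassP (φ z) - eVal L 1) / (eVal L 2 - eVal L 1) = z := hφ.right_inv z hz
  rw [hzz, ← hgInt _ hx] at key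
  rw [tOf, zOf, muOf]
  beta_reduce
  rw [key, hasDerivAt_pi]
  intro a
  fin_cases a
  · exact hf
  · refine hg.congr_of_eventuallyEq ?_
    filter_upwards [hφ.isOpen.mem_nhds hz] with y hy
    exact hgInt _ (hφ.mapsTo hy)

lemma isSolutionDy1 (hD : IsContourData L i U c S) {al : ℂ} (ka : ℂ) (hal : 2 * al ∉ L.lattice)
    (hφ : IsInverseBranch L U V φ) :
    IsSolutionDy1 0 0 0 1 (tOf L) (zOf L al) (muOf L al ka) (V \ {zOf L al})
      (fun z => fInt L al ka i c S (φ z)) := by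
  have hy : ∀ z ∈ V, HasDerivAt (fun z => fInt L al ka i c S (φ z))
      (deriv (fInt L al ka i c S) (φ z)
        * ((eVal L 2 - eVal L 1) / L.derivWeierstrassP (φ z))) z := fun z hz =>
    (hD.hasDerivAt_fInt al ka (hφ.mapsTo hz)).differentiableAt.hasDerivAt.comp z
      (hD.hasDerivAt_inverseBranch hφ hz)
  refine ⟨fun z hz => (hy z hz.1).differentiableAt.differentiableWithinAt, ?_⟩
  rintro z ⟨hz, hzal⟩
  have hx := hφ.mapsTo hz
  have hφ' := hD.hasDerivAt_inverseBranch hφ hz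
  have halL := notMem_of_two_mul_notMem L hal
  have hx2 := hD.notHalf _ hx
  have hxL := hD.notMem hx
  obtain ⟨h0, hg2, -⟩ := invariants_eq L
  obtain ⟨h21, h31, h32⟩ := eVal_ne L
  obtain ⟨p1, p2, p3⟩ := weierstrassP_ne_eVal L hx2
  have hP0 := derivWeierstrassP_ne_zero L hx2
  have hzz : z = (L.weierstrassP (φ z) - eVal L 1) / (eVal L 2 - eVal L 1) :=
    (hφ.right_inv z hz).symm
  have hPA : L.weierstrassP (φ z) ≠ L.weierstrassP al := fun h => hzal <| by
    rw [mem_singleton_iff, hzz, h, zOf]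
  have hf1 := (hD.hasDerivAt_deriv_fInt al ka hx).differentiableAt.hasDerivAt.comp z hφ'
  have hP1 := (hasDerivAt_derivWeierstrassP L hxL).comp z hφ'
  have hy2 := hf1.mul ((hasDerivAt_const z (eVal L 2 - eVal L 1)).div hP1 hP0)
  have hy3 : deriv (deriv fun z => fInt L al ka i c S (φ z)) z = _ :=
    (hy2.congr_of_eventuallyEq (by
      filter_upwards [hφ.isOpen.mem_nhds hz] with w hw using (hy w hw).deriv)).deriv
  obtain ⟨c1, c2⟩ := dy1_coeff_eq (ka := ka) h0 h21 h31 h32 (derivWeierstrassP_ne_zero L hal)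
    (derivWeierstrassP_sq_eq_prod L halL) p1 p2 p3 hPA z (tOf L) (zOf L al) (muOf L al ka)
    hzz rfl rfl rfl
  have ode := hD.fInt_ode ka hal hx hPA
  have hPP := two_mul_second_deriv_div L hx2
  rw [c1, c2, ← derivWeierstrassP_sq_eq_prod L hxL, hy3, (hy z hz).deriv]
  simp only [coeffP, coeffQ] at ode
  simp only [Pi.div_apply, Function.comp_apply]
  set P := L.weierstrassP (φ z)
  set P' := L.derivWeierstrassP (φ z)
  set f := fInt L al ka i c S (φ z)
  set f1 := deriv (fInt L al ka i c S) (φ z)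
  -- The sum over the roots is absorbed by the derivative of 1/℘'(φ(z)) in the second z-derivative,
  -- and the equation in x remains.
  have hσ : 1 / (P - eVal L 1) + 1 / (P - eVal L 2) + 1 / (P - eVal L 3)
      = 2 * (6 * P ^ 2 - L.g₂ / 2) / P' ^ 2 := by
    rw [hPP]
    field_simp
  rw [hσ]
  have b := _root_.sub_ne_zero.2 hPA
  have hf2 := eq_neg_of_add_eq_zero_left ((add_assoc _ _ _).symm.trans ode)
  rw [hf2]
  field_simp
  ring

end IsContourData

end EllipticFuchs

open EllipticFuchs in
theorem mainTheorem4 (L : PeriodPair) (al ka k : ℂ) (hal : 2 * al ∉ L.lattice) (hk : k ≠ 0)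
    (i : Fin 4) (U : Set ℂ) (c : ℝ → ℂ) (S : ℂ → ℝ → ℂ) (hD : IsContourData L i U c S) :
    -- the system `D_Y(0,0,0,1; λ, μ; k)`, along contours that avoid the poles of `℘(ξ)`
    ((∀ x ∈ U, ∀ s ∈ Set.Ioo (0 : ℝ) 1, contour L i c x s ∉ L.lattice) →
      (∀ x ∈ U, IntervalIntegrable (gPull L al ka i c S x) MeasureTheory.volume 0 1) ∧
      ∀ (V : Set ℂ) (φ : ℂ → ℂ), IsInverseBranch L U V φ →
        IsSolutionDY 0 0 0 1 (tOf L) (zOf L al) (muOf L al ka) k V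
          (fun z => ![fInt L al ka i c S (φ z), gInt L al ka k i c S (φ z)])) ∧
    -- the integral `f_i` converges and is holomorphic
    (∀ x ∈ U, IntervalIntegrable (fPull L al ka i c S x) MeasureTheory.volume 0 1) ∧
    DifferentiableOn ℂ (fInt L al ka i c S) U ∧
    -- the equation `D_{y₁}(0,0,0,1; λ, μ)`
    (∀ (V : Set ℂ) (φ : ℂ → ℂ), IsInverseBranch L U V φ →
      IsSolutionDy1 0 0 0 1 (tOf L) (zOf L al) (muOf L al ka) (V \ {zOf L al})
        (fun z => fInt L al ka i c S (φ z))) ∧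
    -- the same equation in the variable `x`
    (∀ x ∈ U, L.weierstrassP x ≠ L.weierstrassP al →
      deriv (deriv (fInt L al ka i c S)) x
        + ((1 / (2 * (L.weierstrassP x - eVal L 1)) + 1 / (2 * (L.weierstrassP x - eVal L 2))
              + 1 / (2 * (L.weierstrassP x - eVal L 3)))
            - 1 / (L.weierstrassP x - L.weierstrassP al))
          * L.derivWeierstrassP x * deriv (fInt L al ka i c S) x
        + (-ka ^ 2
            - L.derivWeierstrassP al / (L.weierstrassP x - L.weierstrassP al) * ka
            + L.weierstrassP x - L.weierstrassP al) * fInt L al ka i c S x = 0) := by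
  refine ⟨fun hav => ⟨fun x hx => hD.intervalIntegrable_gPull hav ka hal hx,
      fun V φ hφ => hD.isSolutionDY hav ka hal hk hφ⟩,
    fun x hx => (hD.isParamIntegrand_fPull al ka).intervalIntegrable hx,
    fun x hx => (hD.hasDerivAt_fInt al ka hx).differentiableAt.differentiableWithinAt,
    fun V φ hφ => hD.isSolutionDy1 ka hal hφ, fun x hx hxal => ?_⟩
  rw [← coeffP_eq L al (hD.notHalf x hx)]
  exact hD.fInt_ode ka hal hx hxal
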